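/- Setting. Let $k$ be a commutative $\mathbb Q$-algebra (for instance $k=\mathbb C$), let functions of $t=(t_1=x,t_3,t_5,\dots)$ be formal power series in $t$ (Taylor expansions at a base point), and write $\partial=\partial/\partial x$, $\partial_{2n+1}=\partial/\partial t_{2n+1}$. Let $L=\partial+u_1\partial^{-1}+u_2\partial^{-2}+\cdots$ be a Lax operator of the BKP hierarchy, i.e. a formal pseudo-differential operator with coefficients in $k[[t]]$ and $$\partial_{2n+1}L=[B_{2n+1},L],\quad B_{2n+1}=(L^{2n+1})_+,\ n\ge 0,\qquad L^*=-\partial L\partial^{-1},$$ and let $W=1+\sum_{j\ge1}w_j\partial^{-j}$ be a dressing operator of it: $L=W\partial W^{-1}$, $\partial_{2n+1}W=-(L^{2n+1})_-W$, $W^*\partial W=\partial$. Put $\xi(t,\lambda)=\sum_{i\ge0}t_{2i+1}\lambda^{2i+1}$ and let $\psi_{BA}(t,\lambda)=W(e^{\xi(t,\lambda)})=\big(1+\sum_{j\ge1} w_j(t)\lambda^{-j}\big)e^{\xi(t,\lambda)}$ be the Baker–Akhiezer function. Let $[z^{-1}]=(z^{-1},\tfrac13z^{-3},\tfrac15z^{-5},\dots)$;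 a function of $t\pm2[z^{-1}]$ is its Taylor expansion in $z^{-1}$. Let $\int d\lambda\, f(\lambda)$ be the coefficient of $\lambda^{-1}$ in $f$. A function $\Phi$ is an eigenfunction if $\partial_{2n+1}\Phi=B_{2n+1}(\Phi)$ for all $n\ge0$. For functions $\Phi,\Psi$, a squared eigenfunction potential $S(\Phi,\Psi)$ is a solution $S$ of $$\partial_{2n+1}S=\mathrm{Res}\big(\partial^{-1}\Psi (L^{2n+1})_+\Phi\,\partial^{-1}\big)\qquad(n\ge0),$$ where $\mathrm{Res}\sum a_i\partial^i=a_{-1}$. All formulas for $S$ below mean: the right-hand side is such a potential, and the potentials are exactly the series that differ from it by a term independent of $t$ (the spectral parameters are treated as formal; in (1) all series lie in $k((\lambda^{-1}))((\mu^{-1}))[[t]]$, i.e. are expanded for $|\mu|>|\lambda|$). Statement. If $\Phi,\Phi_1,\Phi_2$ are eigenfunctions, then 1. $S(\psi_{BA}(t,\mu),\psi_{BA}(t,-\lambda)_x)=\tfrac12\big(\psi_{BA}(t,-\lambda)-\psi_{BA}(t-2[\mu^{-1}],-\lambda)\big)\psi_{BA}(t,\mu)$; 2. $S(\Phi(t),\psi_{BA}(t,-\lambda)_x)=\tfrac12\psi_{BA}(t,-\lambda)\big(\Phi(t+2[\lambda^{-1}])+\Phi(t)\big)$,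 and the right-hand side is the unique such potential of the normalized form $e^{-\xi(t,\lambda)}(\Phi(t)+O(\lambda^{-1}))$; 3. $S(\psi_{BA}(t,\lambda),\Phi_x(t))=\tfrac12\psi_{BA}(t,\lambda)\big(\Phi(t)-\Phi(t-2[\lambda^{-1}])\big)$; 4. the normalized potential $\varphi(t',\lambda)=S(\Phi(t'),\psi_{BA}(t',-\lambda)_{x'})$ of item 2 is a spectral density of $\Phi$, that is, $\Phi(t)=\int d\lambda\,\lambda^{-1}\varphi(t',\lambda)\psi_{BA}(t,\lambda)$ for all $t,t'$ (as formal power series in both); and for all spectral densities $\varphi_1,\varphi_2$ of $\Phi_1,\Phi_2$ and every choice of the potential $S(\psi_{BA}(t,\mu),\psi_{BA}(t,\lambda)_x)$, $$S(\Phi_1(t),\Phi_{2x}(t))=\iint d\lambda\,d\mu\,\lambda^{-1}\mu^{-1}\varphi_1(t',\mu)\,\varphi_2(t',\lambda)\,S\big(\psi_{BA}(t,\mu),\psi_{BA}(t,\lambda)_x\big).$$ -/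

import Mathlib

namespace BKP

/-- Formal power series in the odd times `t₁ = x, t₃, t₅, …` with coefficients in `R`;
the variable with index `n` is the time `t_{2n+1}`. -/
abbrev TimeSeries (R : Type*) : Type _ := MvPowerSeries ℕ R

namespace TimeSeries

/-- `∂ / ∂t_{2n+1}`. -/
noncomputable abbrev dt {R : Type*} [CommRing R] (n : ℕ) (f : TimeSeries R) : TimeSeries R :=
  MvPowerSeries.pderiv R n f

/-- `∂ = ∂ / ∂x`, with `x = t₁`. -/
noncomputable abbrev dx {R : Type*} [CommRing R] (f : TimeSeries R) : TimeSeries R := dt 0 f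

/-- Apply a function to every coefficient of a power series in the times. -/
def mapCoeff {R S : Type*} (g : R → S) (f : TimeSeries R) : TimeSeries S := fun m => g (f m)

/-- A series that does not depend on the times. -/
noncomputable abbrev const {R : Type*} [CommRing R] (c : R) : TimeSeries R :=
  MvPowerSeries.C c

theorem iterate_dx_zero {R : Type*} [CommRing R] (k : ℕ) :
    (dx^[k]) (0 : TimeSeries R) = 0 := by
  induction k with
  | zero => rfl
  | succ k ih => rw [Function.iterate_succ_apply', ih]; simp

end TimeSeries

open TimeSeries

/-- Formal pseudo-differential operators `∑_{i ≤ N} a_i ∂^i` in `∂ = ∂/∂x`, whose coefficients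
are power series in the times. -/
@[ext]
structure PDO (R : Type*) [CommRing R] where
  /-- `coeff i` is the coefficient `a_i` of `∂^i`, written on the left of `∂^i`. -/
  coeff : ℤ → TimeSeries R
  bdd : ∃ N : ℤ, ∀ i, N < i → coeff i = 0

namespace PDO

variable {R : Type*} [CommRing R]

/-- Composition, by the generalized Leibniz rule
`∂^i ∘ b = ∑_{k ≥ 0} (i choose k) (∂^k b) ∂^{i-k}` for all integers `i`.
The sum over `(i, k)` that gives the coefficient of `∂^m` has finitely many nonzero terms. -/
noncomputable instance : Mul (PDO R) where
  mul A B :=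
    { coeff := fun m => ∑ᶠ p : ℤ × ℕ,
        (Ring.choose p.1 p.2 : ℤ) • (A.coeff p.1 * (dx^[p.2]) (B.coeff (m - p.1 + p.2)))
      bdd := by
        obtain ⟨N, hN⟩ := A.bdd
        obtain ⟨M, hM⟩ := B.bdd
        refine ⟨N + M, fun m hm => ?_⟩
        rw [← finsum_zero (α := ℤ × ℕ)]
        congr 1
        funext p
        by_cases h : N < p.1
        · simp [hN _ h]
        · rw [hM (m - p.1 + p.2) (by omega), iterate_dx_zero]
          simp }

/-- The multiplication operator by the function `f`. -/
noncomputable def ofFun (f : TimeSeries R) : PDO R where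
  coeff i := if i = 0 then f else 0
  bdd := ⟨0, fun i hi => if_neg (by omega)⟩

/-- The operator `∂^j`, for any integer `j`. -/
noncomputable def dpow (j : ℤ) : PDO R where
  coeff i := if i = j then 1 else 0
  bdd := ⟨j, fun i hi => if_neg (by omega)⟩

/-- The power `A^n`. -/
noncomputable def pow (A : PDO R) : ℕ → PDO R
  | 0 => dpow 0
  | n + 1 => pow A n * A

/-- The differential part `A_+ = ∑_{i ≥ 0} a_i ∂^i`. -/
noncomputable def plus (A : PDO R) : PDO R where
  coeff i := if 0 ≤ i then A.coeff i else 0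
  bdd := by
    obtain ⟨N, hN⟩ := A.bdd
    exact ⟨N, fun i hi => by simp [hN i hi]⟩

/-- The integral part `A_- = ∑_{i < 0} a_i ∂^i`. -/
noncomputable def minus (A : PDO R) : PDO R where
  coeff i := if i < 0 then A.coeff i else 0
  bdd := by
    obtain ⟨N, hN⟩ := A.bdd
    exact ⟨N, fun i hi => by simp [hN i hi]⟩

/-- The formal adjoint `A^* = ∑_i (-∂)^i ∘ a_i`, expanded by the generalized Leibniz rule. -/
noncomputable def adj (A : PDO R) : PDO R where
  coeff m := ∑ᶠ k : ℕ, ((Int.negOnePow (m + k) : ℤ) * Ring.choose (m + k : ℤ) k) •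
    (dx^[k]) (A.coeff (m + k))
  bdd := by
    obtain ⟨N, hN⟩ := A.bdd
    refine ⟨N, fun m hm => ?_⟩
    rw [← finsum_zero (α := ℕ)]
    congr 1
    funext k
    rw [hN (m + k) (by omega), iterate_dx_zero, smul_zero]

/-- `Res A = a_{-1}`. -/
def res (A : PDO R) : TimeSeries R := A.coeff (-1)

/-- The action `B(f) = ∑_{i ≥ 0} b_i ∂^i f` of a differential operator `B` on a function. -/
noncomputable def apply (B : PDO R) (f : TimeSeries R) : TimeSeries R :=
  ∑ᶠ i : ℕ, B.coeff i * (dx^[i]) f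

/-- Extension of the coefficient ring. -/
noncomputable def baseChange {S : Type*} [CommRing S] (g : R →+* S) (A : PDO R) : PDO S where
  coeff i := MvPowerSeries.map g (A.coeff i)
  bdd := by
    obtain ⟨N, hN⟩ := A.bdd
    exact ⟨N, fun i hi => by rw [hN i hi, map_zero]⟩

end PDO

open PDO

section Hierarchy

variable {R : Type*} [CommRing R]

/-- `B_{2n+1} = (L^{2n+1})_+`. -/
noncomputable def B (L : PDO R) (n : ℕ) : PDO R := plus (PDO.pow L (2 * n + 1))

/-- `L` is a Lax operator of the BKP hierarchy and `W` is a dressing operator of it. -/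
structure IsBKP (L W : PDO R) : Prop where
  /-- `L = ∂ + u₁ ∂⁻¹ + u₂ ∂⁻² + ⋯` -/
  lax_form : L.coeff 1 = 1 ∧ L.coeff 0 = 0 ∧ ∀ i, 1 < i → L.coeff i = 0
  /-- the Lax equations `∂_{2n+1} L = [B_{2n+1}, L]` -/
  lax : ∀ n i, dt n (L.coeff i) = (B L n * L).coeff i - (L * B L n).coeff i
  /-- the BKP constraint `L^* = -∂ L ∂⁻¹` -/
  constraint : ∀ i, (adj L).coeff i = -(dpow 1 * L * dpow (-1)).coeff i
  /-- `W = 1 + w₁ ∂⁻¹ + w₂ ∂⁻² + ⋯` -/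
  dressing_form : W.coeff 0 = 1 ∧ ∀ i, 0 < i → W.coeff i = 0
  /-- `L = W ∂ W⁻¹` -/
  dressing : L * W = W * dpow 1
  /-- the Sato equations `∂_{2n+1} W = -(L^{2n+1})_- W` -/
  sato : ∀ n i, dt n (W.coeff i) = -(minus (PDO.pow L (2 * n + 1)) * W).coeff i
  /-- the BKP constraint `W^* ∂ W = ∂` -/
  sato_constraint : adj W * dpow 1 * W = dpow 1

/-- `Φ` is an eigenfunction: `∂_{2n+1} Φ = B_{2n+1}(Φ)` for all `n ≥ 0`. -/
def IsEigenfunction (L : PDO R) (Φ : TimeSeries R) : Prop :=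
  ∀ n, dt n Φ = PDO.apply (B L n) Φ

/-- `S` is a squared eigenfunction potential `S(Φ, Ψ)`:
`∂_{2n+1} S = Res(∂⁻¹ Ψ (L^{2n+1})_+ Φ ∂⁻¹)` for all `n ≥ 0`. -/
def IsSEP (L : PDO R) (Φ Ψ S : TimeSeries R) : Prop :=
  ∀ n, dt n S = res (dpow (-1) * ofFun Ψ * plus (PDO.pow L (2 * n + 1)) * ofFun Φ * dpow (-1))

/-- `F(t + c[z⁻¹])`, where `[z⁻¹] = (z⁻¹, z⁻³/3, z⁻⁵/5, …)`, as the Taylor expansion in `z⁻¹`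
(the variable of the Laurent series is `z⁻¹`).
The coefficient of `t^m z^{-n}` is the sum over all multi-indices `a` with `∑ (2i+1) a_i = n` of
`∏_i ((m_i + a_i) choose a_i) (c/(2i+1))^{a_i}` times the coefficient of `t^{m+a}` in `F`;
such `a` vanish at all `i ≥ n` and have all their entries at most `n`. -/
noncomputable def shift [Algebra ℚ R] (c : ℚ) (F : TimeSeries R) :
    TimeSeries (LaurentSeries R) := fun m =>
  HahnSeries.ofPowerSeries ℤ R (PowerSeries.mk fun n =>
    ∑ a ∈ (Finset.range n).finsupp (fun _ => Finset.range (n + 1)) with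
        (a.sum fun i e => (2 * i + 1) * e) = n,
      (a.prod fun i e => ((m i + e).choose e : ℚ) * (c / (2 * i + 1)) ^ e) •
        MvPowerSeries.coeff (m + a) F)

end Hierarchy

section BakerAkhiezer

variable {k : Type*} [CommRing k]

/-- The series `w(t,λ) = ∑_j w_j(t) λ^{-j}` attached to `W = ∑_j w_j ∂^{-j}`.
Throughout, the variable of `LaurentSeries k` is `λ⁻¹`: its `coeff n` is the coefficient
of `λ^{-n}`. -/
noncomputable def symbol (W : PDO k) : TimeSeries (LaurentSeries k) := fun m =>
  HahnSeries.ofSuppBddBelow (fun n : ℤ => MvPowerSeries.coeff m (W.coeff (-n))) (by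
    obtain ⟨N, hN⟩ := W.bdd
    refine ⟨-N, fun n hn => ?_⟩
    by_contra h
    exact hn (by simp [hN (-n) (by omega)]))

/-- `e^{ξ(t,λ)}` with `ξ(t,λ) = ∑_i t_{2i+1} λ^{2i+1}`: the coefficient of `t^m` is
`λ^{∑ (2i+1) m_i} / ∏ m_i!`. -/
noncomputable def expXi [Algebra ℚ k] : TimeSeries (LaurentSeries k) := fun m =>
  HahnSeries.single (-(m.sum fun i e => (2 * (i : ℤ) + 1) * e))
    (algebraMap ℚ k (m.prod fun _ e => 1 / (Nat.factorial e : ℚ)))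

/-- The Baker-Akhiezer function `ψ(t,λ) = W(e^{ξ(t,λ)}) = w(t,λ) e^{ξ(t,λ)}`. -/
noncomputable def ba [Algebra ℚ k] (W : PDO k) : TimeSeries (LaurentSeries k) :=
  symbol W * expXi

/-- The substitution `λ ↦ -λ`. -/
def negVar (f : LaurentSeries k) : LaurentSeries k where
  coeff n := (Int.negOnePow n : ℤ) • f.coeff n
  isPWO_support' := f.isPWO_support.mono fun n hn h => hn (by simp [h])

/-- `ψ(t,-λ)`. -/
noncomputable def baNeg [Algebra ℚ k] (W : PDO k) : TimeSeries (LaurentSeries k) :=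
  mapCoeff negVar (ba W)

/-- Regard a Laurent series in one spectral parameter as a series in `μ⁻¹`, inside the ring of
Laurent series in `μ⁻¹` with coefficients in the Laurent series in `λ⁻¹`. -/
noncomputable def inMu (f : LaurentSeries k) : LaurentSeries (LaurentSeries k) :=
  HahnSeries.map f (HahnSeries.C : k →+* LaurentSeries k)

/-- Regard a Laurent series in one spectral parameter as a series in `λ⁻¹`, inside the same
ring. -/
noncomputable def inLam (f : LaurentSeries k) : LaurentSeries (LaurentSeries k) :=
  HahnSeries.C f

/-- `∫ dλ f(λ)`, the coefficient of `λ⁻¹`. -/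
def integral (f : LaurentSeries k) : k := f.coeff 1

/-- The Laurent series `λ⁻¹`. -/
noncomputable def lamInv : LaurentSeries k := HahnSeries.single 1 1

/-- `∫ dλ λ⁻¹ φ(t',λ) F(t,λ)`, a power series in `t` whose coefficients are power series
in `t'`. -/
noncomputable def spectralIntegral (φ F : TimeSeries (LaurentSeries k)) :
    TimeSeries (TimeSeries k) := fun m m' =>
  integral (lamInv * MvPowerSeries.coeff m' φ * MvPowerSeries.coeff m F)

/-- `∫∫ dλ dμ λ⁻¹ μ⁻¹ φ₁(t',μ) φ₂(t',λ) F(t,μ,λ)`, a power series in `t` whose coefficients are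
power series in `t'`. -/
noncomputable def doubleSpectralIntegral (φ₁ φ₂ : TimeSeries (LaurentSeries k))
    (F : TimeSeries (LaurentSeries (LaurentSeries k))) : TimeSeries (TimeSeries k) :=
  fun m m' => integral (integral (inLam lamInv * inMu lamInv *
    MvPowerSeries.coeff m' (mapCoeff inMu φ₁ * mapCoeff inLam φ₂) * MvPowerSeries.coeff m F))

/-- Regard a function of `t` as a function of `(t, t')` that does not depend on `t'`. -/
noncomputable def indepOfPrime (f : TimeSeries k) : TimeSeries (TimeSeries k) :=
  MvPowerSeries.map (MvPowerSeries.C : k →+* TimeSeries k) f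

/-- `φ(t',λ)` is a spectral density of `Φ`: `Φ(t) = ∫ dλ λ⁻¹ φ(t',λ) ψ(t,λ)` for all `t`, `t'`. -/
def IsSpectralDensity [Algebra ℚ k] (W : PDO k) (Φ : TimeSeries k)
    (φ : TimeSeries (LaurentSeries k)) : Prop :=
  indepOfPrime Φ = spectralIntegral φ (ba W)

/-- `S = e^{-ξ(t,λ)} (Φ(t) + O(λ⁻¹))`, the normalization of `S(Φ(t), ψ(t,-λ)_x)`. -/
def IsNormalized [Algebra ℚ k] (Φ : TimeSeries k) (S : TimeSeries (LaurentSeries k)) : Prop :=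
  ∃ G : TimeSeries (LaurentSeries k), S = mapCoeff negVar expXi * G ∧
    ∀ m, (∀ n : ℤ, n < 0 → (MvPowerSeries.coeff m G).coeff n = 0) ∧
      (MvPowerSeries.coeff m G).coeff 0 = MvPowerSeries.coeff m Φ

/-- The Lax operator with coefficients extended to Laurent series in `λ⁻¹`. -/
noncomputable def lax₁ (L : PDO k) : PDO (LaurentSeries k) := L.baseChange HahnSeries.C

/-- The Lax operator with coefficients extended to Laurent series in `μ⁻¹` over Laurent series
in `λ⁻¹`. -/
noncomputable def lax₂ (L : PDO k) : PDO (LaurentSeries (LaurentSeries k)) :=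
  (lax₁ L).baseChange HahnSeries.C

/-- A function of `t`, regarded as a function of `(t, λ)` that does not depend on `λ`. -/
noncomputable def indepOfLam (f : TimeSeries k) : TimeSeries (LaurentSeries k) :=
  MvPowerSeries.map (HahnSeries.C : k →+* LaurentSeries k) f

end BakerAkhiezer

end BKP

/-! Everything happens among functions P(e^ξ) with P a pseudo-differential operator. On them ∂ acts
as left multiplication by the invertible operator ∂, so it is injective (`IsWave.eq_zero_of_dx`).
The candidate for S(Φ, ψ_x) is (∂⁻¹Φ∂W)(e^ξ), the operator being `potential`. Its x-derivative is
Φψ_x. Differentiating W^*∂W = ∂ along the flows gives B^*∂ = -∂B (`IsBKP.adj_B_mul`). With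
Lagrange's identity, the prescribed t_{2n+1}-derivative of the potential then has x-derivative
∂_{2n+1}(Φψ_x) (`IsBKP.dx_omega_B`), and injectivity of ∂ gives the flow equations
(`IsBKP.isSEP_of_dx`). Integration by parts yields S(ψ, Φ_x) = Φψ - S(Φ, ψ_x).

The closed form comes from residues. Let φ be the candidate with λ replaced by -λ. The identity
W∂⁻¹W^* = ∂⁻¹ says that the constant term in λ of (∂^jψ)(t,λ) ψ(t,-λ) is δ_{j0}
(`IsBKP.ct_iterate_dx_mul`). Hence all time derivatives of φ are orthogonal to all x-derivatives of
ψ. So ∫ dλ λ⁻¹ φ(t',λ)ψ(t,λ) is independent of t' and equals Φ(t): φ is a spectral density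
(`IsBKP.isSpectralDensity`).

Now shift t by -2[z⁻¹] in this integral. The exponential acquires the factor (1-λ/z)/(1+λ/z) =
2/(1+λ/z) - 1, and the integral becomes 2p(z)v(z) - Φ, where p is the symbol of ∂⁻¹Φ∂W and v(z) =
w(t-2[z⁻¹],-z) (`IsBKP.shiftSeries_eq`). The same computation with W in place of ∂⁻¹Φ∂W and 1 in
place of Φ gives wv = 1. Therefore 2p = w(Φ(t-2[z⁻¹]) + Φ) (`IsBKP.two_mul_wave`).

The formula with two Baker-Akhiezer functions is the one for S(ψ, Φ_x) over the coefficient ring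
k((λ⁻¹)), where ψ(t,-λ) is itself an eigenfunction. The double integral formula follows by applying
the integration functional to the flow equations of S(ψ(t,μ), ψ(t,λ)_x)
(`IsSEP.doubleSpectralIntegral`). -/

namespace BKP
open TimeSeries PDO

/-! ### Commuting derivations on power series in the times. -/

namespace TimeSeries
variable {R S : Type*} [CommRing R] [CommRing S]

theorem iterate_dx_add (n : ℕ) (f g : TimeSeries R) :
    (dx^[n]) (f + g) = (dx^[n]) f + (dx^[n]) g :=
  iterate_map_add (MvPowerSeries.pderiv R 0) n f g

theorem dt_comm (i j : ℕ) (f : TimeSeries R) : dt i (dt j f) = dt j (dt i f) := by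
  ext m
  simp only [dt, MvPowerSeries.coeff_pderiv, Finsupp.add_apply]
  rw [add_right_comm]
  by_cases h : i = j
  · subst h; rfl
  · simp [h, Ne.symm h]; ring

theorem dt_iterate_dx (i n : ℕ) (f : TimeSeries R) : dt i ((dx^[n]) f) = (dx^[n]) (dt i f) := by
  induction n with
  | zero => rfl
  | succ n ih => rw [Function.iterate_succ_apply', Function.iterate_succ_apply', ← ih, dt_comm]

theorem map_dt (g : R →+* S) (i : ℕ) (f : TimeSeries R) :
    MvPowerSeries.map g (dt i f) = dt i (MvPowerSeries.map g f) := by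
  ext m
  simp [dt, MvPowerSeries.coeff_pderiv]

theorem map_iterate_dx (g : R →+* S) (n : ℕ) (f : TimeSeries R) :
    MvPowerSeries.map g ((dx^[n]) f) = (dx^[n]) (MvPowerSeries.map g f) := by
  induction n with
  | zero => rfl
  | succ n ih => rw [Function.iterate_succ_apply', Function.iterate_succ_apply', ← ih, map_dt]

end TimeSeries

/-! ### The ring of pseudo-differential operators. -/

namespace PDO
variable {R S : Type*} [CommRing R] [CommRing S]

instance : Zero (PDO R) := ⟨⟨fun _ => 0, 0, fun _ _ => rfl⟩⟩

noncomputable instance : Add (PDO R) := ⟨fun A B => ⟨fun i => A.coeff i + B.coeff i, by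
  obtain ⟨N, hN⟩ := A.bdd
  obtain ⟨M, hM⟩ := B.bdd
  exact ⟨max N M, fun i hi => by rw [hN i (by omega), hM i (by omega), add_zero]⟩⟩⟩

noncomputable instance : Neg (PDO R) := ⟨fun A => ⟨fun i => -A.coeff i, by
  obtain ⟨N, hN⟩ := A.bdd
  exact ⟨N, fun i hi => by rw [hN i hi, neg_zero]⟩⟩⟩

noncomputable instance : SMul (TimeSeries R) (PDO R) := ⟨fun a A => ⟨fun i => a * A.coeff i, by
  obtain ⟨N, hN⟩ := A.bdd
  exact ⟨N, fun i hi => by rw [hN i hi, mul_zero]⟩⟩⟩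

@[simp] theorem coeff_zero (i : ℤ) : (0 : PDO R).coeff i = 0 := rfl
@[simp] theorem coeff_add (A B : PDO R) (i : ℤ) : (A + B).coeff i = A.coeff i + B.coeff i := rfl
@[simp] theorem coeff_neg (A : PDO R) (i : ℤ) : (-A).coeff i = -A.coeff i := rfl
@[simp] theorem coeff_smul (a : TimeSeries R) (A : PDO R) (i : ℤ) :
    (a • A).coeff i = a * A.coeff i := rfl

noncomputable instance : AddCommGroup (PDO R) where
  add_assoc A B C := by ext1; funext i; simp [add_assoc]
  zero_add A := by ext1; funext i; simp
  add_zero A := by ext1; funext i; simp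
  add_comm A B := by ext1; funext i; simp [add_comm]
  neg_add_cancel A := by ext1; funext i; simp
  nsmul := nsmulRec
  zsmul := zsmulRec

/-- The coefficient of `∂^i` as an additive map. -/
noncomputable def coeffHom (i : ℤ) : PDO R →+ TimeSeries R where
  toFun A := A.coeff i
  map_zero' := rfl
  map_add' _ _ := rfl

@[simp] theorem coeff_sub (A B : PDO R) (i : ℤ) : (A - B).coeff i = A.coeff i - B.coeff i :=
  map_sub (coeffHom i) A B

@[simp] theorem coeff_zsmul (n : ℤ) (A : PDO R) (i : ℤ) : (n • A).coeff i = n • A.coeff i :=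
  map_zsmul (coeffHom i) n A

theorem coeff_sum {ι : Type*} (s : Finset ι) (f : ι → PDO R) (i : ℤ) :
    (∑ j ∈ s, f j).coeff i = ∑ j ∈ s, (f j).coeff i :=
  map_sum (coeffHom i) f s

noncomputable instance : Module (TimeSeries R) (PDO R) where
  one_smul A := by ext1; funext i; simp
  mul_smul a b A := by ext1; funext i; simp [mul_assoc]
  smul_zero a := by ext1; funext i; simp
  smul_add a A B := by ext1; funext i; simp [mul_add]
  add_smul a b A := by ext1; funext i; simp [add_mul]
  zero_smul A := by ext1; funext i; simp

/-- `A` has order at most `n`. -/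
def OrdLE (A : PDO R) (n : ℤ) : Prop := ∀ i, n < i → A.coeff i = 0

theorem OrdLE.mono {A : PDO R} {n m : ℤ} (h : OrdLE A n) (hnm : n ≤ m) : OrdLE A m :=
  fun i hi => h i (by omega)

theorem OrdLE.sub {A B : PDO R} {n : ℤ} (hA : OrdLE A n) (hB : OrdLE B n) : OrdLE (A - B) n :=
  fun i hi => by rw [coeff_sub, hA i hi, hB i hi, sub_zero]

theorem OrdLE.add {A B : PDO R} {n : ℤ} (hA : OrdLE A n) (hB : OrdLE B n) : OrdLE (A + B) n :=
  fun i hi => by rw [coeff_add, hA i hi, hB i hi, add_zero]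

theorem OrdLE.neg {A : PDO R} {n : ℤ} (hA : OrdLE A n) : OrdLE (-A) n :=
  fun i hi => by rw [coeff_neg, hA i hi, neg_zero]

theorem OrdLE.smul {A : PDO R} {n : ℤ} (a : TimeSeries R) (hA : OrdLE A n) : OrdLE (a • A) n :=
  fun i hi => by rw [coeff_smul, hA i hi, mul_zero]

theorem ordLE_dpow (n : ℤ) : OrdLE (dpow n : PDO R) n := fun i hi => if_neg (by omega)

theorem ordLE_ofFun (f : TimeSeries R) : OrdLE (ofFun f) 0 := fun i hi => if_neg (by omega)

theorem coeff_dpow (i j : ℤ) : (dpow i : PDO R).coeff j = if j = i then 1 else 0 := rfl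

theorem coeff_ofFun (f : TimeSeries R) (j : ℤ) : (ofFun f).coeff j = if j = 0 then f else 0 := rfl

theorem ofFun_eq_smul (f : TimeSeries R) : ofFun f = f • dpow 0 := by
  ext1; funext i; simp [coeff_dpow, coeff_ofFun]

/-- An additive map that vanishes on operators of low order and on monomials vanishes. -/
theorem eq_zero_of_monomial {X : Type*} [AddCommGroup X] (F : PDO R →+ X) (n : ℤ)
    (hlow : ∀ A, OrdLE A n → F A = 0)
    (hmono : ∀ (a : TimeSeries R) (i : ℤ), F (a • dpow i) = 0) (A : PDO R) :
    F A = 0 := by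
  obtain ⟨N, hN⟩ := A.bdd
  have h : OrdLE (A - ∑ i ∈ Finset.Ioc n N, A.coeff i • dpow i) n := by
    intro i hi
    rw [coeff_sub, coeff_sum]
    by_cases hiN : i ≤ N
    · rw [Finset.sum_eq_single i]
      · simp [coeff_dpow]
      · intro j _ hj; simp [coeff_dpow, Ne.symm hj]
      · intro h; exact absurd (Finset.mem_Ioc.2 ⟨hi, hiN⟩) h
    · rw [hN i (by omega), Finset.sum_eq_zero, sub_zero]
      intro j hj
      rw [Finset.mem_Ioc] at hj
      rw [coeff_smul, coeff_dpow, if_neg (by omega), mul_zero]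
  have h2 := hlow _ h
  rw [map_sub, map_sum, Finset.sum_eq_zero (fun i _ => hmono _ i), sub_zero] at h2
  exact h2

/-- Each output coefficient depends on finitely many input coefficients, because the maps raise the
order by at most `c`. Associativity and the rules for adjoints and time derivatives are reduced to
monomials a∂^i in this way, which avoids binomial identities. -/
theorem eq_of_monomial {F G : PDO R →+ PDO R} (c : ℤ)
    (hF : ∀ A n, OrdLE A n → OrdLE (F A) (n + c)) (hG : ∀ A n, OrdLE A n → OrdLE (G A) (n + c))
    (h : ∀ (a : TimeSeries R) (i : ℤ), F (a • dpow i) = G (a • dpow i)) (A : PDO R) :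
    F A = G A := by
  ext1; funext m
  have key := eq_zero_of_monomial ((coeffHom m).comp (F - G)) (m - c - 1) ?_ ?_ A
  · rw [← sub_eq_zero, ← coeff_sub]
    exact key
  · intro A hA
    exact ((hF A _ hA).sub (hG A _ hA)) m (by omega)
  · intro a i
    simp [h]

theorem coeff_mul_eq_finsum (A B : PDO R) (m : ℤ) : (A * B).coeff m = ∑ᶠ p : ℤ × ℕ,
    (Ring.choose p.1 p.2 : ℤ) • (A.coeff p.1 * (dx^[p.2]) (B.coeff (m - p.1 + p.2))) := rfl

/-- The cutoffs `l` and `K` are left free so that several products can be written over one index set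
and compared termwise. -/
theorem coeff_mul_eq_sum {A B : PDO R} {N M : ℤ} (hA : OrdLE A N) (hB : OrdLE B M) (m l : ℤ)
    (hl : l ≤ m - M) (K : ℕ) (hK : N + M - m < K) :
    (A * B).coeff m = ∑ i ∈ Finset.Icc l N, ∑ k ∈ Finset.range K,
      (Ring.choose i k : ℤ) • (A.coeff i * (dx^[k]) (B.coeff (m - i + k))) := by
  rw [coeff_mul_eq_finsum, ← Finset.sum_product']
  refine finsum_eq_sum_of_support_subset _ ?_
  rintro ⟨i, k⟩ hik
  simp only [Finset.coe_product, Set.mem_prod, Finset.mem_coe, Finset.mem_Icc, Finset.mem_range]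
  by_contra hc
  apply hik
  by_cases hi : N < i
  · simp [hA i hi]
  · simp only
    rw [hB (m - i + k) (by omega), iterate_dx_zero]
    simp

theorem OrdLE.mul {A B : PDO R} {n m : ℤ} (hA : OrdLE A n) (hB : OrdLE B m) :
    OrdLE (A * B) (n + m) := by
  intro j hj
  -- Above order n + m the cutoff `K = 0` is admissible, so the sum over k is empty.
  rw [coeff_mul_eq_sum hA hB j (j - m) le_rfl 0 (by simp; omega)]
  simp

theorem add_mul' (A B C : PDO R) : (A + B) * C = A * C + B * C := by
  obtain ⟨N, hN⟩ := A.bdd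
  obtain ⟨M, hM⟩ := B.bdd
  obtain ⟨L, hL⟩ := C.bdd
  have hA : OrdLE A (max N M) := OrdLE.mono hN (by omega)
  have hB : OrdLE B (max N M) := OrdLE.mono hM (by omega)
  ext1; funext m
  have hK : max N M + L - m < ((max N M + L - m + 1).toNat : ℤ) := by omega
  rw [coeff_add, coeff_mul_eq_sum (hA.add hB) hL m _ le_rfl _ hK,
    coeff_mul_eq_sum hA hL m _ le_rfl _ hK, coeff_mul_eq_sum hB hL m _ le_rfl _ hK]
  simp only [← Finset.sum_add_distrib, coeff_add, add_mul, smul_add]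

theorem mul_add' (A B C : PDO R) : A * (B + C) = A * B + A * C := by
  obtain ⟨N, hN⟩ := B.bdd
  obtain ⟨M, hM⟩ := C.bdd
  obtain ⟨L, hL⟩ := A.bdd
  have hB : OrdLE B (max N M) := OrdLE.mono hN (by omega)
  have hC : OrdLE C (max N M) := OrdLE.mono hM (by omega)
  ext1; funext m
  have hK : L + max N M - m < ((L + max N M - m + 1).toNat : ℤ) := by omega
  rw [coeff_add, coeff_mul_eq_sum hL (hB.add hC) m _ le_rfl _ hK,
    coeff_mul_eq_sum hL hB m _ le_rfl _ hK, coeff_mul_eq_sum hL hC m _ le_rfl _ hK]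
  simp only [← Finset.sum_add_distrib, coeff_add, iterate_dx_add, mul_add, smul_add]

theorem smul_mul' (a : TimeSeries R) (A B : PDO R) : (a • A) * B = a • (A * B) := by
  obtain ⟨N, hN⟩ := A.bdd
  obtain ⟨M, hM⟩ := B.bdd
  have hA : OrdLE A N := hN
  ext1; funext m
  have hK : N + M - m < ((N + M - m + 1).toNat : ℤ) := by omega
  rw [coeff_smul, coeff_mul_eq_sum (hA.smul a) hM m _ le_rfl _ hK,
    coeff_mul_eq_sum hA hM m _ le_rfl _ hK]
  simp only [Finset.mul_sum, coeff_smul, mul_assoc, mul_smul_comm]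

noncomputable instance : NonUnitalNonAssocRing (PDO R) where
  left_distrib := mul_add'
  right_distrib := add_mul'
  zero_mul A := by
    have := add_mul' 0 0 A
    rw [add_zero] at this
    exact left_eq_add.1 this
  mul_zero A := by
    have := mul_add' A 0 0
    rw [add_zero] at this
    exact left_eq_add.1 this

theorem coeff_dpow_mul {B : PDO R} {M : ℤ} (hB : OrdLE B M) (i m : ℤ) (K : ℕ)
    (hK : i + M - m < K) :
    (dpow i * B).coeff m =
      ∑ k ∈ Finset.range K, (Ring.choose i k : ℤ) • (dx^[k]) (B.coeff (m - i + k)) := by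
  rw [coeff_mul_eq_sum (ordLE_dpow i) hB m (min i (m - M)) (by omega) K hK, Finset.sum_eq_single i]
  · simp [coeff_dpow]
  · intro j _ hj; simp [coeff_dpow, hj]
  · intro h; exact absurd (Finset.mem_Icc.2 ⟨by omega, le_rfl⟩) h

theorem dpow_zero_mul (B : PDO R) : dpow 0 * B = B := by
  obtain ⟨M, hM⟩ := B.bdd
  ext1; funext m
  rw [coeff_dpow_mul hM 0 m ((M - m).toNat + 1) (by omega), Finset.sum_range_succ']
  simp [Ring.choose_zero_succ]

theorem coeff_dpow_one_mul (B : PDO R) (m : ℤ) :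
    (dpow 1 * B).coeff m = B.coeff (m - 1) + dx (B.coeff m) := by
  obtain ⟨M, hM⟩ := B.bdd
  rw [coeff_dpow_mul hM 1 m ((1 + M - m).toNat + 2) (by omega), Finset.sum_range_succ',
    Finset.sum_range_succ', Finset.sum_eq_zero]
  · simp [add_comm]
  · intro k _
    have : Ring.choose (1 : ℤ) (k + 1 + 1) = 0 := by
      have := Ring.choose_natCast (R := ℤ) 1 (k + 1 + 1)
      rw [Nat.choose_eq_zero_of_lt (by omega)] at this
      simpa using this
    rw [this, zero_smul]

/-- Pascal's rule for choose(i+1, k). The right side can be read both as ∂(∂^i B) and as ∂^i(∂B),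
which gives the next two lemmas. -/
theorem dpow_add_one_mul_aux {B : PDO R} {M : ℤ} (hB : OrdLE B M) (i m : ℤ) (K : ℕ)
    (hK : i + M - m + 1 < K) :
    (dpow (i + 1) * B).coeff m = ∑ k ∈ Finset.range K, (Ring.choose i k : ℤ) •
      ((dx^[k]) (B.coeff (m - 1 - i + k)) + (dx^[k + 1]) (B.coeff (m - i + k))) := by
  rw [coeff_dpow_mul hB (i + 1) m (K + 1) (by push_cast; omega), Finset.sum_range_succ']
  simp only [smul_add, Finset.sum_add_distrib, Ring.choose_succ_succ, add_smul]
  have h1 : ∀ k : ℕ, m - (i + 1) + ((k + 1 : ℕ) : ℤ) = m - i + k := fun k => by push_cast; ring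
  simp only [h1]
  have h2 := Finset.sum_range_succ'
    (fun k => (Ring.choose i k : ℤ) • (dx^[k]) (B.coeff (m - 1 - i + k))) K
  rw [Finset.sum_range_succ, hB (m - 1 - i + K) (by omega), iterate_dx_zero, smul_zero,
    add_zero] at h2
  rw [h2]
  have h3 : ∀ k : ℕ, m - 1 - i + ((k + 1 : ℕ) : ℤ) = m - i + k := fun k => by push_cast; ring
  simp only [h3]
  have h4 : m - (i + 1) = m - 1 - i := by ring
  simp only [Ring.choose_zero_right, h4]
  abel

theorem dpow_add_one_mul (i : ℤ) (B : PDO R) : dpow (i + 1) * B = dpow 1 * (dpow i * B) := by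
  obtain ⟨M, hM⟩ := B.bdd
  ext1; funext m
  have hK : i + M - m + 1 < ((i + M - m + 2).toNat : ℤ) := by omega
  rw [dpow_add_one_mul_aux hM i m _ hK, coeff_dpow_one_mul,
    coeff_dpow_mul hM i (m - 1) (i + M - m + 2).toNat (by omega),
    coeff_dpow_mul hM i m (i + M - m + 2).toNat (by omega)]
  simp only [dx, dt, map_sum, map_zsmul, ← Finset.sum_add_distrib, smul_add,
    Function.iterate_succ_apply']

theorem dpow_add_one_mul' (i : ℤ) (B : PDO R) : dpow (i + 1) * B = dpow i * (dpow 1 * B) := by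
  obtain ⟨M, hM⟩ := B.bdd
  ext1; funext m
  have hK : i + M - m + 1 < ((i + M - m + 2).toNat : ℤ) := by omega
  rw [dpow_add_one_mul_aux hM i m _ hK,
    coeff_dpow_mul ((ordLE_dpow 1).mul hM) i m (i + M - m + 2).toNat (by omega)]
  refine Finset.sum_congr rfl fun k _ => ?_
  rw [coeff_dpow_one_mul, iterate_dx_add, Function.iterate_succ_apply,
    show m - i + k - 1 = m - 1 - i + (k : ℤ) by ring]

/-- Multiplication by ∂⁻¹ undoes ∂ by `dpow_add_one_mul'` at i = -1, before associativity is known.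
Cancelling ∂ then serves for the negative half of inductions over ℤ. -/
theorem dpow_one_mul_injective {A B : PDO R} (h : dpow 1 * A = dpow 1 * B) : A = B := by
  have h2 := congrArg (fun X => dpow (-1) * X) h
  simp only [← dpow_add_one_mul'] at h2
  simpa [dpow_zero_mul] using h2

theorem dpow_mul_dpow_mul (i j : ℤ) (B : PDO R) :
    dpow i * (dpow j * B) = dpow (i + j) * B := by
  induction i with
  | zero => rw [dpow_zero_mul, zero_add]
  | succ i ih => rw [dpow_add_one_mul, ih, ← dpow_add_one_mul]; congr 2; ring
  | pred i ih =>
    apply dpow_one_mul_injective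
    rw [← dpow_add_one_mul, ← dpow_add_one_mul, sub_add_cancel, ih]; congr 2; ring

theorem mul_dpow_zero (A : PDO R) : A * dpow 0 = A := by
  refine eq_of_monomial (F := AddMonoidHom.mulRight (dpow 0)) (G := AddMonoidHom.id _) 0
    (fun A n hA => hA.mul (ordLE_dpow 0)) (fun A n hA => hA.mono (by simp)) ?_ A
  intro a i
  simp only [AddMonoidHom.coe_mulRight, smul_mul', AddMonoidHom.id_apply]
  congr 1
  induction i with
  | zero => rw [dpow_zero_mul]
  | succ i ih =>
    have h := dpow_mul_dpow_mul (R := R) i 1 (dpow 0)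
    ext1; funext m
    rw [dpow_add_one_mul, ih, coeff_dpow_one_mul]
    simp only [coeff_dpow]
    split_ifs <;> simp <;> omega
  | pred i ih =>
    apply dpow_one_mul_injective
    rw [← dpow_add_one_mul, sub_add_cancel, ih]
    ext1; funext m
    rw [coeff_dpow_one_mul]
    simp only [coeff_dpow]
    split_ifs <;> simp <;> omega

theorem dpow_mul_dpow (i j : ℤ) : (dpow i * dpow j : PDO R) = dpow (i + j) := by
  have := dpow_mul_dpow_mul (R := R) i j (dpow 0)
  rwa [mul_dpow_zero, mul_dpow_zero] at this

theorem dpow_one_mul_smul (a : TimeSeries R) (B : PDO R) :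
    dpow 1 * (a • B) = a • (dpow 1 * B) + dx a • B := by
  ext1; funext m
  simp only [coeff_dpow_one_mul, coeff_add, coeff_smul, dx, dt, Derivation.leibniz, smul_eq_mul]
  ring

theorem dpow_one_mul_assoc (B C : PDO R) : dpow 1 * B * C = dpow 1 * (B * C) := by
  obtain ⟨M, hM⟩ := C.bdd
  refine eq_of_monomial
    (F := (AddMonoidHom.mulRight C).comp (AddMonoidHom.mulLeft (dpow 1)))
    (G := (AddMonoidHom.mulLeft (dpow 1)).comp (AddMonoidHom.mulRight C)) (1 + M)
    (fun A n hA => (((ordLE_dpow 1).mul hA).mul hM).mono (by omega))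
    (fun A n hA => ((ordLE_dpow 1).mul (hA.mul hM)).mono (by omega)) ?_ B
  intro a i
  simp only [AddMonoidHom.comp_apply, AddMonoidHom.coe_mulRight, AddMonoidHom.coe_mulLeft,
    dpow_one_mul_smul, smul_mul', dpow_mul_dpow, dpow_mul_dpow_mul, add_mul]

theorem dpow_mul_assoc (i : ℤ) (B C : PDO R) : dpow i * B * C = dpow i * (B * C) := by
  induction i with
  | zero => rw [dpow_zero_mul, dpow_zero_mul]
  | succ i ih => rw [dpow_add_one_mul, dpow_add_one_mul, dpow_one_mul_assoc, ih]
  | pred i ih =>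
    apply dpow_one_mul_injective
    rw [← dpow_one_mul_assoc, ← dpow_add_one_mul, ← dpow_add_one_mul, sub_add_cancel, ih]

/-- By additivity and order, A may be taken to be a monomial a∂^i. The function a factors out on the
left, and ∂^i is handled by induction from the Leibniz rule for ∂. -/
theorem mul_assoc' (A B C : PDO R) : A * B * C = A * (B * C) := by
  obtain ⟨M, hM⟩ := C.bdd
  obtain ⟨N, hN⟩ := B.bdd
  refine eq_of_monomial
    (F := (AddMonoidHom.mulRight C).comp (AddMonoidHom.mulRight B))
    (G := AddMonoidHom.mulRight (B * C)) (N + M)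
    (fun A n hA => ((hA.mul hN).mul hM).mono (by omega))
    (fun A n hA => hA.mul (OrdLE.mul hN hM)) ?_ A
  intro a i
  simp only [AddMonoidHom.comp_apply, AddMonoidHom.coe_mulRight, smul_mul', dpow_mul_assoc]

noncomputable instance : Ring (PDO R) where
  one := dpow 0
  mul_assoc := mul_assoc'
  one_mul := dpow_zero_mul
  mul_one := mul_dpow_zero
  neg_add_cancel := neg_add_cancel
  zsmul := zsmulRec

theorem pow_eq_pow (A : PDO R) (n : ℕ) : PDO.pow A n = A ^ n := by
  induction n with
  | zero => rw [pow_zero]; rfl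
  | succ n ih => rw [pow_succ, ← ih]; rfl

theorem ofFun_mul (f : TimeSeries R) (A : PDO R) : ofFun f * A = f • A := by
  rw [ofFun_eq_smul, smul_mul', dpow_zero_mul]

theorem ofFun_mul_ofFun (f g : TimeSeries R) : ofFun f * ofFun g = ofFun (f * g) := by
  rw [ofFun_mul, ofFun_eq_smul, ofFun_eq_smul, smul_smul]

theorem smul_dpow (a : TimeSeries R) (i : ℤ) : a • dpow i = ofFun a * dpow i := (ofFun_mul _ _).symm

theorem dpow_one_mul_ofFun (f : TimeSeries R) :
    dpow 1 * ofFun f = ofFun f * dpow 1 + ofFun (dx f) := by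
  rw [ofFun_eq_smul, dpow_one_mul_smul, dpow_mul_dpow, ofFun_eq_smul, smul_mul', dpow_mul_dpow]
  rfl

/-- Multiplication by `∂^j` on the right shifts the coefficients. -/
theorem coeff_mul_dpow (A : PDO R) (j m : ℤ) : (A * dpow j).coeff m = A.coeff (m - j) := by
  obtain ⟨N, hN⟩ := A.bdd
  refine sub_eq_zero.1 (eq_zero_of_monomial
    ((coeffHom m).comp (AddMonoidHom.mulRight (dpow j)) - coeffHom (m - j)) (m - j - 1) ?_ ?_ A)
  · intro A hA
    have h1 := (hA.mul (ordLE_dpow j)) m (by omega)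
    have h2 := hA (m - j) (by omega)
    simp [coeffHom, h1, h2]
  · intro a i
    simp only [coeffHom, AddMonoidHom.sub_apply, AddMonoidHom.comp_apply,
      AddMonoidHom.coe_mulRight, AddMonoidHom.coe_mk, ZeroHom.coe_mk, smul_mul', dpow_mul_dpow,
      coeff_smul, coeff_dpow]
    by_cases h : m = i + j
    · rw [if_pos h, if_pos (by omega), sub_self]
    · rw [if_neg h, if_neg (by omega), sub_self]

/-- A monic operator can be cancelled on the right. -/
theorem eq_zero_of_mul_eq_zero {A W : PDO R} (hW0 : W.coeff 0 = 1) (hW : OrdLE W 0)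
    (h : A * W = 0) : A = 0 := by
  obtain ⟨N, hN⟩ := A.bdd
  -- As W has leading coefficient 1, the top coefficient of AW is that of A. The coefficients of A
  -- therefore vanish one after another from the top.
  have key : ∀ n : ℕ, OrdLE A (N - n) := by
    intro n
    induction n with
    | zero => exact OrdLE.mono hN (by simp)
    | succ n ih =>
      intro i hi
      by_cases hi2 : N - n < i
      · exact ih i hi2
      have hi3 : i = N - n := by push_cast at hi; omega
      have h1 := congrArg (fun X => X.coeff i) h
      simp only [coeff_zero] at h1
      rw [coeff_mul_eq_sum ih hW i (i - 0) le_rfl 1 (by omega), ← hi3] at h1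
      simpa [hW0] using h1
  ext1; funext i
  exact key (N - i + 1).toNat i (by omega)

/-! ### The adjoint -/

theorem negOnePow_mul_self (i : ℤ) : ((i.negOnePow : ℤ) * (i.negOnePow : ℤ)) = 1 := by
  rw [← Units.val_mul, Int.units_mul_self, Units.val_one]

theorem OrdLE.adj {A : PDO R} {n : ℤ} (hA : OrdLE A n) : OrdLE (adj A) n := by
  intro m hm
  change ∑ᶠ k : ℕ, _ = _
  rw [← finsum_zero (α := ℕ)]
  congr 1
  funext k
  rw [hA (m + k) (by omega), iterate_dx_zero, smul_zero]

theorem coeff_adj_eq_sum {A : PDO R} {n : ℤ} (hA : OrdLE A n) (m : ℤ) (K : ℕ) (hK : n - m < K) :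
    (PDO.adj A).coeff m = ∑ k ∈ Finset.range K,
      ((Int.negOnePow (m + k) : ℤ) * Ring.choose (m + k : ℤ) k) • (dx^[k]) (A.coeff (m + k)) := by
  refine finsum_eq_sum_of_support_subset _ ?_
  intro k hk
  simp only [Finset.coe_range, Set.mem_Iio]
  by_contra hc
  apply hk
  simp only
  rw [hA (m + k) (by omega), iterate_dx_zero, smul_zero]

/-- The adjoint as an additive map. -/
noncomputable def adjHom : PDO R →+ PDO R where
  toFun := PDO.adj
  map_zero' := by
    ext1; funext m
    exact (OrdLE.adj (A := (0 : PDO R)) (n := m - 1) fun i _ => rfl) m (by omega)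
  map_add' A B := by
    obtain ⟨N, hN⟩ := A.bdd
    obtain ⟨M, hM⟩ := B.bdd
    have hA : OrdLE A (max N M) := OrdLE.mono hN (by omega)
    have hB : OrdLE B (max N M) := OrdLE.mono hM (by omega)
    ext1; funext m
    have hK : max N M - m < ((max N M - m + 1).toNat : ℤ) := by omega
    rw [coeff_add, coeff_adj_eq_sum hA m _ hK, coeff_adj_eq_sum hB m _ hK,
      coeff_adj_eq_sum (hA.add hB) m _ hK]
    simp only [coeff_add, iterate_dx_add, smul_add, Finset.sum_add_distrib]

theorem adj_add (A B : PDO R) : PDO.adj (A + B) = PDO.adj A + PDO.adj B := map_add adjHom A B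

theorem adj_sub (A B : PDO R) : PDO.adj (A - B) = PDO.adj A - PDO.adj B := map_sub adjHom A B

theorem adj_smul_dpow (a : TimeSeries R) (i : ℤ) :
    PDO.adj (a • dpow i) = (i.negOnePow : ℤ) • (dpow i * ofFun a) := by
  ext1; funext m
  have hK : i - m < ((i - m + 1).toNat : ℤ) := by omega
  rw [coeff_adj_eq_sum ((ordLE_dpow i).smul a) m _ hK, coeff_zsmul,
    coeff_dpow_mul (ordLE_ofFun a) i m (i - m + 1).toNat (by omega), Finset.smul_sum]
  refine Finset.sum_congr rfl fun k _ => ?_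
  rw [coeff_smul, coeff_dpow, coeff_ofFun]
  by_cases h : m + k = i
  · rw [if_pos h, if_pos (by omega), h, smul_smul, mul_one]
  · rw [if_neg h, if_neg (by omega), mul_zero, iterate_dx_zero]
    simp

theorem adj_dpow (i : ℤ) : PDO.adj (dpow i : PDO R) = (i.negOnePow : ℤ) • dpow i := by
  have := adj_smul_dpow (1 : TimeSeries R) i
  rwa [one_smul, ofFun_eq_smul, one_smul, mul_dpow_zero] at this

theorem adj_smul (a : TimeSeries R) (A : PDO R) : PDO.adj (a • A) = PDO.adj A * ofFun a := by
  refine eq_of_monomial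
    (F := adjHom.comp (DistribSMul.toAddMonoidHom (PDO R) a))
    (G := (AddMonoidHom.mulRight (ofFun a)).comp adjHom) 0
    (fun A n hA => ((hA.smul a).adj).mono (by omega))
    (fun A n hA => hA.adj.mul (ordLE_ofFun a)) ?_ A
  intro b i
  change PDO.adj (a • b • dpow i) = PDO.adj (b • dpow i) * ofFun a
  rw [smul_smul, adj_smul_dpow, adj_smul_dpow, smul_mul_assoc, mul_assoc, ofFun_mul_ofFun,
    mul_comm a b]

theorem adj_dpow_one_mul (A : PDO R) : PDO.adj (dpow 1 * A) = -(PDO.adj A * dpow 1) := by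
  refine eq_of_monomial
    (F := adjHom.comp (AddMonoidHom.mulLeft (dpow 1)))
    (G := -(AddMonoidHom.mulRight (dpow 1)).comp adjHom) 1
    (fun A n hA => (((ordLE_dpow 1).mul hA).adj).mono (by omega))
    (fun A n hA => (hA.adj.mul (ordLE_dpow 1)).neg) ?_ A
  intro b i
  change PDO.adj (dpow 1 * b • dpow i) = -(PDO.adj (b • dpow i) * dpow 1)
  rw [dpow_one_mul_smul, dpow_mul_dpow, adj_add, adj_smul_dpow, adj_smul_dpow, adj_smul_dpow,
    smul_mul_assoc, mul_assoc]
  have h1 := dpow_one_mul_ofFun b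
  have h2 : (dpow (1 + i) : PDO R) = dpow i * dpow 1 := by rw [dpow_mul_dpow, add_comm]
  rw [h2, mul_assoc, h1, mul_add, add_comm 1 i, Int.negOnePow_succ]
  simp

theorem adj_dpow_mul (i : ℤ) (A : PDO R) :
    PDO.adj (dpow i * A) = (i.negOnePow : ℤ) • (PDO.adj A * dpow i) := by
  induction i with
  | zero => rw [dpow_zero_mul, mul_dpow_zero]; simp
  | succ i ih =>
    rw [dpow_add_one_mul, adj_dpow_one_mul, ih, smul_mul_assoc, mul_assoc, dpow_mul_dpow,
      Int.negOnePow_succ]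
    simp
  | pred i ih =>
    have h : PDO.adj (dpow (-(i : ℤ)) * A) = -(PDO.adj (dpow (-(i : ℤ) - 1) * A) * dpow 1) := by
      rw [← adj_dpow_one_mul, ← dpow_add_one_mul, sub_add_cancel]
    rw [ih] at h
    have h2 := congrArg (fun X => X * dpow (-1)) h
    simp only [neg_mul, mul_assoc, dpow_mul_dpow, smul_mul_assoc] at h2
    rw [show (1 : ℤ) + -1 = 0 by norm_num, mul_dpow_zero] at h2
    rw [← neg_eq_iff_eq_neg] at h2
    rw [← h2, Int.negOnePow_sub, Int.negOnePow_one]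
    simp [sub_eq_add_neg]

theorem adj_mul (A B : PDO R) : PDO.adj (A * B) = PDO.adj B * PDO.adj A := by
  obtain ⟨N, hN⟩ := B.bdd
  refine eq_of_monomial
    (F := adjHom.comp (AddMonoidHom.mulRight B))
    (G := (AddMonoidHom.mulLeft (PDO.adj B)).comp adjHom) N
    (fun A n hA => (hA.mul hN).adj)
    (fun A n hA => ((OrdLE.adj hN).mul hA.adj).mono (by omega)) ?_ A
  intro a i
  change PDO.adj (a • dpow i * B) = PDO.adj B * PDO.adj (a • dpow i)
  rw [smul_mul', adj_smul, adj_dpow_mul, adj_smul_dpow, smul_mul_assoc, mul_smul_comm, mul_assoc]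

/-! ### Derivatives in the times -/

/-- The derivative of the coefficients with respect to `t_{2n+1}`. -/
noncomputable def dtCoeff (n : ℕ) : PDO R →+ PDO R where
  toFun A := ⟨fun i => dt n (A.coeff i), by
    obtain ⟨N, hN⟩ := A.bdd
    exact ⟨N, fun i hi => by rw [hN i hi]; simp⟩⟩
  map_zero' := by ext1; funext i; exact map_zero (MvPowerSeries.pderiv R n)
  map_add' A B := by ext1; funext i; exact map_add (MvPowerSeries.pderiv R n) _ _

theorem coeff_dtCoeff (n : ℕ) (A : PDO R) (i : ℤ) : (dtCoeff n A).coeff i = dt n (A.coeff i) := rfl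

theorem OrdLE.dtCoeff {A : PDO R} {m : ℤ} (n : ℕ) (hA : OrdLE A m) : OrdLE (dtCoeff n A) m :=
  fun i hi => by rw [coeff_dtCoeff, hA i hi]; simp

theorem dtCoeff_smul (n : ℕ) (a : TimeSeries R) (A : PDO R) :
    dtCoeff n (a • A) = dt n a • A + a • dtCoeff n A := by
  ext1; funext i
  simp only [coeff_dtCoeff, coeff_smul, coeff_add, dt, Derivation.leibniz, smul_eq_mul]
  ring

theorem dtCoeff_dpow (n : ℕ) (i : ℤ) : dtCoeff n (dpow i : PDO R) = 0 := by
  ext1; funext j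
  rw [coeff_dtCoeff, coeff_dpow]
  split_ifs
  · simp [dt]
  · simp

theorem dtCoeff_dpow_one_mul (n : ℕ) (A : PDO R) :
    dtCoeff n (dpow 1 * A) = dpow 1 * dtCoeff n A := by
  ext1; funext i
  simp only [coeff_dtCoeff, coeff_dpow_one_mul]
  rw [dx, dx, dt_comm 0 n]
  simp [dt]

theorem dtCoeff_dpow_mul (n : ℕ) (i : ℤ) (A : PDO R) :
    dtCoeff n (dpow i * A) = dpow i * dtCoeff n A := by
  induction i with
  | zero => rw [dpow_zero_mul, dpow_zero_mul]
  | succ i ih => rw [dpow_add_one_mul, dpow_add_one_mul, dtCoeff_dpow_one_mul, ih]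
  | pred i ih =>
    apply dpow_one_mul_injective
    rw [← dtCoeff_dpow_one_mul, ← dpow_add_one_mul, ← dpow_add_one_mul, sub_add_cancel, ih]

theorem dtCoeff_mul (n : ℕ) (A B : PDO R) :
    dtCoeff n (A * B) = dtCoeff n A * B + A * dtCoeff n B := by
  obtain ⟨N, hN⟩ := B.bdd
  refine eq_of_monomial
    (F := (dtCoeff n).comp (AddMonoidHom.mulRight B))
    (G := (AddMonoidHom.mulRight B).comp (dtCoeff n) + AddMonoidHom.mulRight (dtCoeff n B)) N
    (fun A m hA => (hA.mul hN).dtCoeff n)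
    (fun A m hA => ((hA.dtCoeff n).mul hN).add (hA.mul (OrdLE.dtCoeff n hN))) ?_ A
  intro a i
  change dtCoeff n (a • dpow i * B) = dtCoeff n (a • dpow i) * B + a • dpow i * dtCoeff n B
  rw [smul_mul', dtCoeff_smul, dtCoeff_smul, dtCoeff_dpow, dtCoeff_dpow_mul, smul_zero, add_zero,
    smul_mul', smul_mul']

theorem dtCoeff_ofFun (n : ℕ) (f : TimeSeries R) : dtCoeff n (ofFun f) = ofFun (dt n f) := by
  rw [ofFun_eq_smul, dtCoeff_smul, dtCoeff_dpow, smul_zero, add_zero, ofFun_eq_smul]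

theorem dtCoeff_adj (n : ℕ) (A : PDO R) : dtCoeff n (PDO.adj A) = PDO.adj (dtCoeff n A) := by
  refine eq_of_monomial
    (F := (dtCoeff n).comp adjHom) (G := adjHom.comp (dtCoeff n)) 0
    (fun A m hA => (hA.adj.dtCoeff n).mono (by omega))
    (fun A m hA => ((hA.dtCoeff n).adj).mono (by omega)) ?_ A
  intro a i
  change dtCoeff n (PDO.adj (a • dpow i)) = PDO.adj (dtCoeff n (a • dpow i))
  rw [adj_smul_dpow, dtCoeff_smul, dtCoeff_dpow, smul_zero, add_zero, adj_smul_dpow, map_zsmul,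
    dtCoeff_dpow_mul, dtCoeff_ofFun]

/-! ### Extension of the coefficient ring -/

theorem coeff_baseChange (g : R →+* S) (A : PDO R) (i : ℤ) :
    (baseChange g A).coeff i = MvPowerSeries.map g (A.coeff i) := rfl

theorem OrdLE.baseChange {A : PDO R} {n : ℤ} (g : R →+* S) (hA : OrdLE A n) :
    OrdLE (baseChange g A) n := fun i hi => by rw [coeff_baseChange, hA i hi, map_zero]

theorem baseChange_dpow (g : R →+* S) (i : ℤ) : baseChange g (dpow i) = dpow i := by
  ext1; funext j
  rw [coeff_baseChange, coeff_dpow, coeff_dpow]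
  split_ifs <;> simp

theorem baseChange_mul (g : R →+* S) (A B : PDO R) :
    baseChange g (A * B) = baseChange g A * baseChange g B := by
  obtain ⟨N, hN⟩ := A.bdd
  obtain ⟨M, hM⟩ := B.bdd
  ext1; funext m
  have hK : N + M - m < ((N + M - m + 1).toNat : ℤ) := by omega
  rw [coeff_baseChange, coeff_mul_eq_sum hN hM m _ le_rfl _ hK,
    coeff_mul_eq_sum (OrdLE.baseChange g hN) (OrdLE.baseChange g hM) m _ le_rfl _ hK]
  simp only [map_sum, map_zsmul, map_mul, map_iterate_dx, coeff_baseChange]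

theorem baseChange_pow (g : R →+* S) (A : PDO R) (n : ℕ) :
    baseChange g (PDO.pow A n) = PDO.pow (baseChange g A) n := by
  induction n with
  | zero => exact baseChange_dpow g 0
  | succ n ih =>
    change baseChange g (PDO.pow A n * A) = PDO.pow (baseChange g A) n * baseChange g A
    rw [baseChange_mul, ih]

theorem baseChange_adj (g : R →+* S) (A : PDO R) :
    baseChange g (PDO.adj A) = PDO.adj (baseChange g A) := by
  obtain ⟨N, hN⟩ := A.bdd
  ext1; funext m
  have hK : N - m < ((N - m + 1).toNat : ℤ) := by omega
  rw [coeff_baseChange, coeff_adj_eq_sum hN m _ hK,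
    coeff_adj_eq_sum (OrdLE.baseChange g hN) m _ hK]
  simp only [map_sum, map_zsmul, map_iterate_dx, coeff_baseChange]

theorem baseChange_plus (g : R →+* S) (A : PDO R) :
    baseChange g (plus A) = plus (baseChange g A) := by
  ext1; funext i
  change MvPowerSeries.map g (if 0 ≤ i then A.coeff i else 0) = if 0 ≤ i then _ else 0
  split_ifs
  · rfl
  · exact map_zero _

theorem baseChange_minus (g : R →+* S) (A : PDO R) :
    baseChange g (minus A) = minus (baseChange g A) := by
  ext1; funext i
  change MvPowerSeries.map g (if i < 0 then A.coeff i else 0) = if i < 0 then _ else 0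
  split_ifs
  · rfl
  · exact map_zero _

end PDO

namespace PDO
variable {R S : Type*} [CommRing R] [CommRing S]

/-! ### Differential operators -/

/-- `A` is a differential operator. -/
def IsDiff (A : PDO R) : Prop := ∀ i < 0, A.coeff i = 0

theorem isDiff_plus (A : PDO R) : IsDiff (plus A) := fun _ hi => if_neg (by omega)

theorem exists_ordLE_natCast (A : PDO R) : ∃ K : ℕ, OrdLE A K := by
  obtain ⟨N, hN⟩ := A.bdd
  exact ⟨N.toNat, OrdLE.mono hN (by omega)⟩

theorem plus_add_minus (A : PDO R) : plus A + minus A = A := by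
  ext1; funext i
  change (if 0 ≤ i then A.coeff i else 0) + (if i < 0 then A.coeff i else 0) = A.coeff i
  by_cases h : 0 ≤ i
  · rw [if_pos h, if_neg (by omega), add_zero]
  · rw [if_neg h, if_pos (by omega), zero_add]

theorem IsDiff.eq_sum {A : PDO R} (hA : IsDiff A) {K : ℕ} (hK : OrdLE A K) :
    A = ∑ i ∈ Finset.range (K + 1), A.coeff i • dpow (i : ℤ) := by
  ext1; funext j
  rw [coeff_sum]
  simp only [coeff_smul, coeff_dpow]
  by_cases h0 : j < 0
  · rw [hA j h0, Finset.sum_eq_zero]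
    intro i _
    rw [if_neg (by omega), mul_zero]
  by_cases h1 : j ≤ K
  · rw [Finset.sum_eq_single j.toNat]
    · rw [if_pos (by omega), mul_one, Int.toNat_of_nonneg (by omega)]
    · intro i _ hi
      rw [if_neg (by omega), mul_zero]
    · intro h; exact absurd (Finset.mem_range.2 (by omega)) h
  · rw [hK j (by omega), Finset.sum_eq_zero]
    intro i hi
    rw [Finset.mem_range] at hi
    rw [if_neg (by omega), mul_zero]

theorem apply_eq_sum {A : PDO R} {N : ℤ} (hA : OrdLE A N) (K : ℕ) (hK : N < K)
    (f : TimeSeries R) : PDO.apply A f = ∑ i ∈ Finset.range K, A.coeff i * (dx^[i]) f := by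
  refine finsum_eq_sum_of_support_subset _ ?_
  intro i hi
  simp only [Finset.coe_range, Set.mem_Iio]
  by_contra hc
  apply hi
  simp only
  rw [hA i (by omega), zero_mul]

/-- The action on a fixed function, as an additive map. -/
noncomputable def applyHom (f : TimeSeries R) : PDO R →+ TimeSeries R where
  toFun A := PDO.apply A f
  map_zero' := by
    rw [apply_eq_sum (A := (0 : PDO R)) (N := -1) (fun _ _ => rfl) 0 (by simp)]
    simp
  map_add' A B := by
    obtain ⟨N, hN⟩ := A.bdd
    obtain ⟨M, hM⟩ := B.bdd
    have hA : OrdLE A (max N M) := OrdLE.mono hN (by omega)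
    have hB : OrdLE B (max N M) := OrdLE.mono hM (by omega)
    have hK : max N M < ((max N M + 1).toNat : ℤ) := by omega
    rw [apply_eq_sum hA _ hK, apply_eq_sum hB _ hK, apply_eq_sum (hA.add hB) _ hK]
    simp only [coeff_add, add_mul, Finset.sum_add_distrib]

theorem applyHom_apply (f : TimeSeries R) (A : PDO R) : applyHom f A = PDO.apply A f := rfl

theorem apply_smul (a : TimeSeries R) (A : PDO R) (f : TimeSeries R) :
    PDO.apply (a • A) f = a * PDO.apply A f := by
  obtain ⟨N, hN⟩ := A.bdd
  have hK : N < ((N + 1).toNat : ℤ) := by omega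
  rw [apply_eq_sum hN _ hK, apply_eq_sum (OrdLE.smul a hN) _ hK, Finset.mul_sum]
  simp only [coeff_smul, mul_assoc]

theorem apply_dpow (i : ℕ) (f : TimeSeries R) :
    PDO.apply (dpow (i : ℤ)) f = (dx^[i]) f := by
  rw [apply_eq_sum (ordLE_dpow (i : ℤ)) (i + 1) (by simp), Finset.sum_eq_single i]
  · simp [coeff_dpow]
  · intro j _ hj
    rw [coeff_dpow, if_neg (by omega), zero_mul]
  · intro h; simp at h

theorem apply_dpow_one_mul {A : PDO R} (hA : A.coeff (-1) = 0) (f : TimeSeries R) :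
    PDO.apply (dpow 1 * A) f = dx (PDO.apply A f) := by
  obtain ⟨N, hN⟩ := A.bdd
  rw [apply_eq_sum ((ordLE_dpow 1).mul hN) ((N + 1).toNat + 1) (by omega),
    apply_eq_sum hN (N + 1).toNat (by omega)]
  simp only [coeff_dpow_one_mul, add_mul, Finset.sum_add_distrib, dx, dt, map_sum,
    Derivation.leibniz, smul_eq_mul]
  rw [Finset.sum_range_succ', Finset.sum_range_succ (fun x => MvPowerSeries.pderiv R 0 _ * _),
    hN (((N + 1).toNat : ℕ) : ℤ) (by omega)]
  simp only [Nat.cast_add, Nat.cast_one, add_sub_cancel_right, Nat.cast_zero, zero_sub, hA,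
    zero_mul, add_zero, map_zero, Function.iterate_succ_apply']
  congr 1
  exact Finset.sum_congr rfl fun i _ => mul_comm _ _

theorem IsDiff.dpow_one_mul {A : PDO R} (hA : IsDiff A) : IsDiff (dpow 1 * A) := by
  intro i hi
  rw [coeff_dpow_one_mul, hA _ hi, hA _ (by omega)]
  simp

theorem dpow_succ_mul (i : ℕ) (A : PDO R) :
    dpow ((i + 1 : ℕ) : ℤ) * A = dpow 1 * (dpow (i : ℤ) * A) := by
  rw [← dpow_add_one_mul]; push_cast; rfl

theorem IsDiff.dpow_mul {A : PDO R} (hA : IsDiff A) (i : ℕ) : IsDiff (dpow (i : ℤ) * A) := by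
  induction i with
  | zero => rw [Nat.cast_zero, dpow_zero_mul]; exact hA
  | succ i ih => rw [dpow_succ_mul]; exact ih.dpow_one_mul

theorem apply_dpow_mul {A : PDO R} (hA : IsDiff A) (i : ℕ) (f : TimeSeries R) :
    PDO.apply (dpow (i : ℤ) * A) f = (dx^[i]) (PDO.apply A f) := by
  induction i with
  | zero => rw [Nat.cast_zero, dpow_zero_mul]; rfl
  | succ i ih =>
    rw [dpow_succ_mul, apply_dpow_one_mul (hA.dpow_mul i _ (by omega)), ih,
      Function.iterate_succ_apply']

theorem isDiff_ofFun (f : TimeSeries R) : IsDiff (ofFun f) := fun _ hi => if_neg (by omega)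

theorem isDiff_smul_dpow (f : TimeSeries R) (i : ℕ) :
    IsDiff (f • (dpow (i : ℤ) : PDO R)) := fun j hj => by
  rw [coeff_smul, coeff_dpow, if_neg (by omega), mul_zero]

theorem coeff_zero_dpow_mul_ofFun (i : ℕ) (f : TimeSeries R) :
    (dpow (i : ℤ) * ofFun f).coeff 0 = (dx^[i]) f := by
  induction i with
  | zero => rw [Nat.cast_zero, dpow_zero_mul]; rfl
  | succ i ih =>
    rw [dpow_succ_mul, coeff_dpow_one_mul, ih, (isDiff_ofFun f).dpow_mul i _ (by omega), zero_add,
      Function.iterate_succ_apply']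

/-! ### The bilinear form of a squared eigenfunction potential -/

/-- `Res(∂⁻¹ f ∂^i Φ ∂⁻¹)`, computed by moving derivatives to the left. -/
noncomputable def bires : ℕ → TimeSeries R → TimeSeries R → TimeSeries R
  | 0, _, _ => 0
  | i + 1, f, Φ => f * (dx^[i]) Φ - bires i (dx f) Φ

theorem res_eq_bires (i : ℕ) (f Φ : TimeSeries R) :
    res (dpow (-1) * ofFun f * dpow (i : ℤ) * ofFun Φ * dpow (-1)) = bires i f Φ := by
  induction i generalizing f with
  | zero =>
    refine (((((ordLE_dpow (-1)).mul (ordLE_ofFun f)).mul (ordLE_dpow _)).mul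
      (ordLE_ofFun Φ)).mul (ordLE_dpow (-1))) _ (by simp)
  | succ i ih =>
    have h : dpow (-1) * ofFun f * dpow ((i + 1 : ℕ) : ℤ) =
        ofFun f * dpow (i : ℤ) - dpow (-1) * ofFun (dx f) * dpow (i : ℤ) := by
      have h1 : ofFun f * dpow 1 = dpow 1 * ofFun f - ofFun (dx f) := by
        rw [dpow_one_mul_ofFun, add_sub_cancel_right]
      have h2 : (dpow ((i + 1 : ℕ) : ℤ) : PDO R) = dpow 1 * dpow (i : ℤ) := by
        rw [dpow_mul_dpow]; congr 1; push_cast; ring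
      rw [h2, mul_assoc, ← mul_assoc (ofFun f), h1, sub_mul, mul_sub, ← mul_assoc, ← mul_assoc,
        dpow_mul_dpow, ← mul_assoc, show (-1 + 1 : ℤ) = 0 by norm_num, dpow_zero_mul]
    rw [h, sub_mul, sub_mul]
    unfold res at ih ⊢
    rw [coeff_sub, ih, bires, coeff_mul_dpow, mul_assoc, ofFun_mul, coeff_smul,
      show (-1 - -1 : ℤ) = 0 by norm_num, coeff_zero_dpow_mul_ofFun]

/-- Integrating by parts i times moves all derivatives from Φ to f, and `bires` collects the
boundary terms. This gives an explicit differential polynomial as primitive. -/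
theorem dx_bires (i : ℕ) (f Φ : TimeSeries R) :
    dx (bires i f Φ) = f * (dx^[i]) Φ - ((i : ℤ).negOnePow : ℤ) • (dx^[i]) f * Φ := by
  induction i generalizing f with
  | zero => simp [bires]
  | succ i ih =>
    rw [bires]
    have h : dx (f * (dx^[i]) Φ - bires i (dx f) Φ) =
        dx f * (dx^[i]) Φ + f * dx ((dx^[i]) Φ) - dx (bires i (dx f) Φ) := by
      simp only [dx, dt, map_sub, Derivation.leibniz, smul_eq_mul]; ring
    rw [h, ih, Function.iterate_succ_apply', Function.iterate_succ_apply]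
    push_cast
    rw [Int.negOnePow_succ]
    simp

theorem map_bires (g : R →+* S) (i : ℕ) (f Φ : TimeSeries R) :
    MvPowerSeries.map g (bires i f Φ) =
      bires i (MvPowerSeries.map g f) (MvPowerSeries.map g Φ) := by
  induction i generalizing f with
  | zero => exact map_zero _
  | succ i ih => rw [bires, bires, map_sub, map_mul, map_iterate_dx, ih, map_dt]

/-- `Res(∂⁻¹ Ψ A Φ ∂⁻¹)` for a differential operator `A`. -/
noncomputable def omega (A : PDO R) (Φ Ψ : TimeSeries R) : TimeSeries R :=
  ∑ i ∈ Finset.range (A.exists_ordLE_natCast.choose + 1), bires i (Ψ * A.coeff i) Φ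

theorem res_eq_sum {A : PDO R} (hA : IsDiff A) {K : ℕ} (hK : OrdLE A K) (Φ Ψ : TimeSeries R) :
    res (dpow (-1) * ofFun Ψ * A * ofFun Φ * dpow (-1)) =
      ∑ i ∈ Finset.range (K + 1), bires i (Ψ * A.coeff i) Φ := by
  conv_lhs => rw [hA.eq_sum hK]
  simp only [Finset.mul_sum, Finset.sum_mul]
  unfold res
  rw [coeff_sum]
  refine Finset.sum_congr rfl fun i _ => ?_
  rw [← res_eq_bires, smul_dpow, ← mul_assoc, mul_assoc (dpow (-1)) (ofFun Ψ), ofFun_mul_ofFun]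
  rfl

theorem omega_eq_sum {A : PDO R} (hA : IsDiff A) {K : ℕ} (hK : OrdLE A K) (Φ Ψ : TimeSeries R) :
    omega A Φ Ψ = ∑ i ∈ Finset.range (K + 1), bires i (Ψ * A.coeff i) Φ := by
  rw [← res_eq_sum hA hK, res_eq_sum hA A.exists_ordLE_natCast.choose_spec]; rfl

theorem map_omega (g : R →+* S) {A : PDO R} (hA : IsDiff A) (Φ Ψ : TimeSeries R) :
    MvPowerSeries.map g (omega A Φ Ψ) =
      omega (baseChange g A) (MvPowerSeries.map g Φ) (MvPowerSeries.map g Ψ) := by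
  obtain ⟨K, hK⟩ := A.exists_ordLE_natCast
  have hA' : IsDiff (baseChange g A) := fun i hi => by rw [coeff_baseChange, hA i hi, map_zero]
  rw [omega_eq_sum hA hK, omega_eq_sum hA' (hK.baseChange g)]
  simp only [map_sum, map_bires, map_mul, coeff_baseChange]

theorem map_apply (g : R →+* S) (A : PDO R) (f : TimeSeries R) :
    MvPowerSeries.map g (PDO.apply A f) = PDO.apply (baseChange g A) (MvPowerSeries.map g f) := by
  obtain ⟨K, hK⟩ := A.exists_ordLE_natCast
  rw [apply_eq_sum hK (K + 1) (by simp), apply_eq_sum (hK.baseChange g) (K + 1) (by simp)]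
  simp only [map_sum, map_mul, map_iterate_dx, coeff_baseChange]

/-- Lagrange's identity. -/
theorem dx_omega {A : PDO R} (hA : IsDiff A) (Φ f : TimeSeries R) :
    dx (omega A Φ (dx f)) = dx f * PDO.apply A Φ - Φ * PDO.apply (adj A * dpow 1) f := by
  obtain ⟨K, hK⟩ := A.exists_ordLE_natCast
  have h1 : PDO.apply (adj A * dpow 1) f =
      ∑ i ∈ Finset.range (K + 1), ((i : ℤ).negOnePow : ℤ) • (dx^[i]) (dx f * A.coeff i) := by
    conv_lhs => rw [hA.eq_sum hK]
    rw [show adj (∑ i ∈ Finset.range (K + 1), A.coeff i • dpow (i : ℤ)) = _ from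
      map_sum adjHom _ _, Finset.sum_mul, ← applyHom_apply, map_sum]
    refine Finset.sum_congr rfl fun i _ => ?_
    change applyHom f (adj (A.coeff i • dpow (i : ℤ)) * dpow 1) = _
    rw [adj_smul_dpow, smul_mul_assoc, map_zsmul, applyHom_apply, mul_assoc, ← smul_dpow]
    have h2 : (dpow 1 : PDO R) = dpow ((1 : ℕ) : ℤ) := rfl
    rw [h2, apply_dpow_mul (isDiff_smul_dpow _ _), apply_smul, apply_dpow, mul_comm]
    rfl
  rw [omega_eq_sum hA hK, apply_eq_sum hK (K + 1) (by simp), h1]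
  simp only [dx, dt, map_sum]
  rw [Finset.mul_sum, Finset.mul_sum, ← Finset.sum_sub_distrib]
  refine Finset.sum_congr rfl fun i _ => ?_
  have := dx_bires i (dx f * A.coeff i) Φ
  simp only [dx, dt] at this
  rw [this]
  ring

end PDO

/-! ### Base change, and operator identities that follow from the BKP equations. -/

section
variable {R S : Type*} [CommRing R] [CommRing S] {L W : PDO R}

theorem isDiff_B (n : ℕ) : IsDiff (B L n) := isDiff_plus _

theorem isSEP_iff {Φ Ψ P : TimeSeries R} :
    IsSEP L Φ Ψ P ↔ ∀ n, dt n P = omega (B L n) Φ Ψ := by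
  refine forall_congr' fun n => ?_
  rw [res_eq_sum (isDiff_plus _) (B L n).exists_ordLE_natCast.choose_spec]
  rfl

theorem baseChange_B (g : R →+* S) (n : ℕ) : baseChange g (B L n) = B (baseChange g L) n := by
  rw [B, baseChange_plus, baseChange_pow]; rfl

theorem IsSEP.map (g : R →+* S) {Φ Ψ P : TimeSeries R} (h : IsSEP L Φ Ψ P) :
    IsSEP (baseChange g L) (MvPowerSeries.map g Φ) (MvPowerSeries.map g Ψ)
      (MvPowerSeries.map g P) := by
  rw [isSEP_iff] at h ⊢
  intro n
  rw [← map_dt, h, map_omega g (isDiff_B n), baseChange_B]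

theorem IsEigenfunction.map (g : R →+* S) {Φ : TimeSeries R} (h : IsEigenfunction L Φ) :
    IsEigenfunction (baseChange g L) (MvPowerSeries.map g Φ) := by
  intro n
  rw [← map_dt, h, map_apply, baseChange_B]

theorem IsBKP.map (g : R →+* S) (h : IsBKP L W) : IsBKP (baseChange g L) (baseChange g W) where
  lax_form := by
    obtain ⟨h1, h2, h3⟩ := h.lax_form
    exact ⟨by rw [coeff_baseChange, h1, map_one], by rw [coeff_baseChange, h2, map_zero],
      fun i hi => by rw [coeff_baseChange, h3 i hi, map_zero]⟩
  lax n i := by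
    rw [← baseChange_B, ← baseChange_mul, ← baseChange_mul, coeff_baseChange, coeff_baseChange,
      coeff_baseChange, ← map_dt, h.lax, map_sub]
  constraint i := by
    rw [← baseChange_adj, ← baseChange_dpow g, ← baseChange_dpow g, ← baseChange_mul,
      ← baseChange_mul, coeff_baseChange, coeff_baseChange, h.constraint, map_neg]
  dressing_form := ⟨by rw [coeff_baseChange, h.dressing_form.1, map_one],
    fun i hi => by rw [coeff_baseChange, h.dressing_form.2 i hi, map_zero]⟩
  dressing := by
    rw [← baseChange_dpow g, ← baseChange_mul, ← baseChange_mul, h.dressing]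
  sato n i := by
    rw [← baseChange_pow, ← baseChange_minus, ← baseChange_mul, coeff_baseChange,
      coeff_baseChange, ← map_dt, h.sato, map_neg]
  sato_constraint := by
    rw [← baseChange_adj, ← baseChange_dpow g, ← baseChange_mul, ← baseChange_mul,
      h.sato_constraint]

namespace IsBKP

theorem pow_mul_dressing (h : IsBKP L W) (n : ℕ) : L ^ n * W = W * dpow (n : ℤ) := by
  induction n with
  | zero => rw [pow_zero, one_mul, Nat.cast_zero, mul_dpow_zero]
  | succ n ih =>
    rw [pow_succ, mul_assoc, h.dressing, ← mul_assoc, ih, mul_assoc, dpow_mul_dpow]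
    push_cast; rfl

/-- The Sato equation with -L^{2n+1}_- written as B - L^{2n+1}, and L^{2n+1}W = W∂^{2n+1}. -/
theorem dtCoeff_dressing (h : IsBKP L W) (n : ℕ) :
    dtCoeff n W = B L n * W - W * dpow ((2 * n + 1 : ℕ) : ℤ) := by
  have h1 : dtCoeff n W = -(minus (PDO.pow L (2 * n + 1)) * W) := by
    ext1; funext i
    rw [coeff_dtCoeff, h.sato, coeff_neg]
  have h2 := plus_add_minus (PDO.pow L (2 * n + 1))
  rw [h1, ← h.pow_mul_dressing, ← pow_eq_pow, B]
  conv_rhs => rw [← h2]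
  rw [add_mul]
  simp only [h2]
  abel

/-- The constraint makes V = ∂⁻¹W^*∂ a left inverse of W. It is a right inverse too, because (WV -
1)W = 0 and the monic W cancels. -/
theorem dressing_mul_eq_one (h : IsBKP L W) : W * (dpow (-1) * adj W * dpow 1) = 1 := by
  rw [← sub_eq_zero]
  refine eq_zero_of_mul_eq_zero h.dressing_form.1 h.dressing_form.2 ?_
  rw [sub_mul, one_mul, mul_assoc, mul_assoc, mul_assoc, ← mul_assoc (adj W), h.sato_constraint,
    dpow_mul_dpow]
  simp [mul_dpow_zero]

theorem dressing_mul_adj (h : IsBKP L W) : W * dpow (-1) * adj W = dpow (-1) := by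
  have h1 := congrArg (fun X => X * dpow (-1)) h.dressing_mul_eq_one
  simp only [mul_assoc, dpow_mul_dpow, one_mul] at h1
  simpa [mul_dpow_zero, mul_assoc] using h1

/-- Differentiate W^*∂W = ∂ along t_{2n+1}. The terms with ∂^{2n+1} cancel because 2n+1 is odd,
leaving W^*XW = 0 with X = B^*∂ + ∂B. The factor W cancels on the right, and W^* on the left through
W∂⁻¹W^* = ∂⁻¹. -/
theorem adj_B_mul (h : IsBKP L W) (n : ℕ) : adj (B L n) * dpow 1 = -(dpow 1 * B L n) := by
  set N : ℤ := ((2 * n + 1 : ℕ) : ℤ) with hN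
  have hodd : (N.negOnePow : ℤ) = -1 := by
    rw [Int.negOnePow_odd N ⟨n, by rw [hN]; push_cast; ring⟩]; rfl
  have h1 := congrArg (dtCoeff n) h.sato_constraint
  rw [dtCoeff_mul, dtCoeff_mul, dtCoeff_adj, dtCoeff_dpow, h.dtCoeff_dressing, adj_sub, adj_mul,
    adj_mul, adj_dpow, ← hN, hodd] at h1
  have h2 : adj W * ((adj (B L n) * dpow 1 + dpow 1 * B L n) * W) +
      (dpow N * (adj W * dpow 1 * W) - adj W * dpow 1 * W * dpow N) = 0 := by
    rw [← h1]
    simp only [neg_smul, one_smul, neg_mul, sub_neg_eq_add, mul_zero, add_zero]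
    noncomm_ring
  rw [h.sato_constraint, dpow_mul_dpow, dpow_mul_dpow, add_comm N 1, sub_self, add_zero] at h2
  set X := adj (B L n) * dpow 1 + dpow 1 * B L n with hX
  have h3 : adj W * X = 0 :=
    eq_zero_of_mul_eq_zero h.dressing_form.1 h.dressing_form.2 (by rw [mul_assoc, h2])
  have h4 : dpow (-1) * X = 0 := by
    rw [← h.dressing_mul_adj, mul_assoc, h3, mul_zero]
  have h5 : X = 0 := by
    have := congrArg (fun Y => dpow 1 * Y) h4
    simpa [← mul_assoc, dpow_mul_dpow, dpow_zero_mul] using this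
  rw [← sub_eq_zero, sub_neg_eq_add, ← hX, h5]

/-- In Lagrange's identity B(Φ) is ∂_{2n+1}Φ and (B^*∂)(f) = -∂B(f) is -∂_{2n+1}f_x, so the product
rule applies. This is the compatibility of the x-flow of the potential with the other flows. -/
theorem dx_omega_B (h : IsBKP L W) {Φ f : TimeSeries R} (hΦ : IsEigenfunction L Φ)
    (hf : IsEigenfunction L f)
    (n : ℕ) : dx (omega (B L n) Φ (dx f)) = dt n (Φ * dx f) := by
  rw [dx_omega (isDiff_B n), ← hΦ n, h.adj_B_mul,
    show PDO.apply (-(dpow 1 * B L n)) f = -PDO.apply (dpow 1 * B L n) f from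
      map_neg (applyHom f) _, apply_dpow_one_mul (isDiff_B n _ (by omega)), ← hf n,
    show dx (dt n f) = dt n (dx f) from dt_comm 0 n f]
  simp only [dt, Derivation.leibniz, smul_eq_mul]
  ring

end IsBKP
end

/-! ### The involution λ ↦ -λ on Laurent series. -/

section Laurent
variable {k : Type*} [CommRing k]

@[simp] theorem coeff_negVar (f : LaurentSeries k) (n : ℤ) :
    (negVar f).coeff n = (Int.negOnePow n : ℤ) • f.coeff n := rfl

theorem negVar_mul (f g : LaurentSeries k) : negVar (f * g) = negVar f * negVar g := by
  have hs : ∀ (f : LaurentSeries k) i, (negVar f).coeff i ≠ 0 ↔ f.coeff i ≠ 0 := by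
    intro f i
    rw [coeff_negVar]
    rcases Int.units_eq_one_or i.negOnePow with h | h <;> simp [h]
  ext n
  rw [coeff_negVar, HahnSeries.coeff_mul, HahnSeries.coeff_mul, Finset.smul_sum]
  refine Finset.sum_congr ?_ fun p hp => ?_
  · ext p
    simp only [Finset.mem_antidiagonal, HahnSeries.mem_support, hs]
  · rw [Finset.mem_antidiagonal] at hp
    rw [coeff_negVar, coeff_negVar, smul_mul_smul_comm, ← hp.2.2, Int.negOnePow_add]
    simp

/-- The substitution `λ ↦ -λ` as a ring homomorphism. -/
noncomputable def negVarHom : LaurentSeries k →+* LaurentSeries k where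
  toFun := negVar
  map_one' := by
    ext n
    rw [coeff_negVar, HahnSeries.coeff_one]
    split_ifs with h
    · subst h; simp
    · simp
  map_zero' := by ext n; simp
  map_add' f g := by ext n; simp
  map_mul' := negVar_mul

theorem coeff_negVarHom (f : LaurentSeries k) (n : ℤ) :
    (negVarHom f).coeff n = (Int.negOnePow n : ℤ) • f.coeff n := rfl

theorem negVarHom_single (n : ℤ) (a : k) :
    negVarHom (HahnSeries.single n a) = HahnSeries.single n ((Int.negOnePow n : ℤ) • a) := by
  ext m
  rw [coeff_negVarHom, HahnSeries.coeff_single, HahnSeries.coeff_single]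
  split_ifs with h
  · rw [h]
  · simp

theorem negVarHom_negVarHom (f : LaurentSeries k) : negVarHom (negVarHom f) = f := by
  ext n
  rw [coeff_negVarHom, coeff_negVarHom, smul_smul, negOnePow_mul_self, one_smul]

theorem negVarHom_comp_C : (negVarHom (k := k)).comp HahnSeries.C = HahnSeries.C := by
  ext a n
  simp [negVarHom_single, HahnSeries.C]

theorem coeff_mul_eq_zero_of_lt {x y : LaurentSeries k} {p q r : ℤ}
    (hx : ∀ i < p, x.coeff i = 0) (hy : ∀ i < q, y.coeff i = 0) (hr : r < p + q) :
    (x * y).coeff r = 0 := by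
  rw [HahnSeries.coeff_mul]
  refine Finset.sum_eq_zero fun ij hij => ?_
  rw [Finset.mem_antidiagonal] at hij
  obtain ⟨h1, h2, h3⟩ := hij
  by_cases h : ij.1 < p
  · exact absurd (hx _ h) h1
  · exact absurd (hy _ (by omega)) h2

end Laurent

/-! ### Symbols of operators and residues in the spectral parameter. -/

section Symbol
variable {k : Type*} [CommRing k]

/-- The substitution `λ ↦ -λ` in all coefficients. -/
noncomputable abbrev negLam : TimeSeries (LaurentSeries k) →+* TimeSeries (LaurentSeries k) :=
  MvPowerSeries.map negVarHom

theorem negLam_negLam (f : TimeSeries (LaurentSeries k)) : negLam (negLam f) = f := by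
  ext1 m
  simp [negVarHom_negVarHom]

theorem negLam_indepOfLam (f : TimeSeries k) : negLam (indepOfLam f) = indepOfLam f := by
  ext1 m
  simp only [indepOfLam, MvPowerSeries.coeff_map]
  exact RingHom.congr_fun negVarHom_comp_C _

/-- The power `λ^j`. -/
noncomputable abbrev lamPow (j : ℤ) : TimeSeries (LaurentSeries k) :=
  const (HahnSeries.single (-j) 1)

theorem coeff_symbol (P : PDO k) (m : ℕ →₀ ℕ) (n : ℤ) :
    (MvPowerSeries.coeff m (symbol P)).coeff n = MvPowerSeries.coeff m (P.coeff (-n)) := rfl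

theorem symbol_injective {P Q : PDO k} (h : symbol P = symbol Q) : P = Q := by
  ext i m
  have := congrArg (fun f => (MvPowerSeries.coeff m f).coeff (-i)) h
  simpa [coeff_symbol] using this

/-- The symbol as an additive map. -/
noncomputable def symbolHom : PDO k →+ TimeSeries (LaurentSeries k) where
  toFun := symbol
  map_zero' := by ext m n; simp [coeff_symbol]
  map_add' A B := by ext m n; simp [coeff_symbol]

theorem symbol_smul (f : TimeSeries k) (P : PDO k) :
    symbol (f • P) = indepOfLam f * symbol P := by
  classical
  ext m n
  rw [coeff_symbol, coeff_smul, MvPowerSeries.coeff_mul, MvPowerSeries.coeff_mul,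
    HahnSeries.coeff_sum]
  refine Finset.sum_congr rfl fun p _ => ?_
  rw [indepOfLam, MvPowerSeries.coeff_map, HahnSeries.C_mul_eq_smul, HahnSeries.coeff_smul,
    coeff_symbol, smul_eq_mul]

theorem symbol_mul_dpow (P : PDO k) (j : ℤ) : symbol (P * dpow j) = lamPow j * symbol P := by
  ext m n
  rw [coeff_symbol, coeff_mul_dpow, MvPowerSeries.coeff_C_mul, HahnSeries.coeff_single_mul,
    coeff_symbol, one_mul]
  congr 2; ring

theorem dt_symbol (n : ℕ) (P : PDO k) : dt n (symbol P) = symbol (dtCoeff n P) := by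
  ext m j
  rw [dt, MvPowerSeries.coeff_pderiv, coeff_symbol, coeff_dtCoeff, dt, MvPowerSeries.coeff_pderiv,
    ← Nat.cast_succ, ← Nat.cast_succ, ← nsmul_eq_mul', ← nsmul_eq_mul', HahnSeries.coeff_smul]
  rfl

theorem indepOfLam_mul (f g : TimeSeries k) :
    indepOfLam (f * g) = indepOfLam f * indepOfLam g := map_mul (MvPowerSeries.map _) f g

theorem dt_indepOfLam (n : ℕ) (f : TimeSeries k) :
    dt n (indepOfLam f) = indepOfLam (dt n f) := (map_dt _ n f).symm

theorem lamPow_mul_lamPow (i j : ℤ) :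
    (lamPow i * lamPow j : TimeSeries (LaurentSeries k)) = lamPow (i + j) := by
  rw [lamPow, lamPow, lamPow, const, const, const, ← map_mul, HahnSeries.single_mul_single,
    one_mul, neg_add]

theorem negLam_lamPow (j : ℤ) :
    negLam (lamPow j : TimeSeries (LaurentSeries k)) = (j.negOnePow : ℤ) • lamPow j := by
  rw [negLam, lamPow, const, MvPowerSeries.map_C, negVarHom_single, Int.negOnePow_neg, ← map_zsmul]
  congr 1
  ext n
  rw [HahnSeries.coeff_smul, HahnSeries.coeff_single, HahnSeries.coeff_single]
  split_ifs <;> simp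

theorem iterate_dx_indepOfLam (n : ℕ) (f : TimeSeries k) :
    (dx^[n]) (indepOfLam f) = indepOfLam ((dx^[n]) f) := (map_iterate_dx _ n f).symm

theorem coeff_B_lax₁ {L : PDO k} (n : ℕ) (i : ℤ) :
    (B (lax₁ L) n).coeff i = indepOfLam ((B L n).coeff i) := by
  rw [lax₁, ← baseChange_B]; rfl

theorem IsBKP.lax₁ {L W : PDO k} (h : IsBKP L W) :
    IsBKP (lax₁ L) (baseChange HahnSeries.C W) := h.map _

theorem IsEigenfunction.indepOfLam {L : PDO k} {Φ : TimeSeries k} (h : IsEigenfunction L Φ) :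
    IsEigenfunction (lax₁ L) (indepOfLam Φ) := h.map _

/-! ### The constant term in the spectral parameter -/

/-- `∫ dλ λ⁻¹ f(λ)`, the constant term. -/
noncomputable def ct : TimeSeries (LaurentSeries k) →+ TimeSeries k where
  toFun f := fun m => (MvPowerSeries.coeff m f).coeff 0
  map_zero' := rfl
  map_add' _ _ := rfl

theorem coeff_ct (f : TimeSeries (LaurentSeries k)) (m : ℕ →₀ ℕ) :
    MvPowerSeries.coeff m (ct f) = (MvPowerSeries.coeff m f).coeff 0 := rfl

theorem ct_indepOfLam_mul (f : TimeSeries k) (a : TimeSeries (LaurentSeries k)) :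
    ct (indepOfLam f * a) = f * ct a := by
  classical
  ext m
  rw [coeff_ct, MvPowerSeries.coeff_mul, MvPowerSeries.coeff_mul, HahnSeries.coeff_sum]
  refine Finset.sum_congr rfl fun p _ => ?_
  rw [indepOfLam, MvPowerSeries.coeff_map, HahnSeries.C_mul_eq_smul, HahnSeries.coeff_smul,
    coeff_ct, smul_eq_mul]

theorem ct_dt (n : ℕ) (a : TimeSeries (LaurentSeries k)) : ct (dt n a) = dt n (ct a) := by
  ext m
  rw [coeff_ct, dt, dt, MvPowerSeries.coeff_pderiv, MvPowerSeries.coeff_pderiv, coeff_ct,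
    ← Nat.cast_succ, ← Nat.cast_succ, ← nsmul_eq_mul', ← nsmul_eq_mul', HahnSeries.coeff_smul]

theorem ct_negLam (a : TimeSeries (LaurentSeries k)) : ct (negLam a) = ct a := by
  ext m
  rw [coeff_ct, negLam, MvPowerSeries.coeff_map, coeff_negVarHom, Int.negOnePow_zero, coeff_ct]
  simp

theorem ct_lamPow_mul_indepOfLam (j : ℤ) (f : TimeSeries k) :
    ct (indepOfLam f * lamPow j) = if j = 0 then f else 0 := by
  rw [ct_indepOfLam_mul]
  have h : ct (lamPow j : TimeSeries (LaurentSeries k)) = if j = 0 then 1 else 0 := by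
    classical
    ext m
    rw [coeff_ct, lamPow, const, MvPowerSeries.coeff_C]
    by_cases hj : j = 0 <;> by_cases hm : m = 0 <;>
      simp [hj, hm, MvPowerSeries.coeff_one, Ne.symm]
  rw [h]; split_ifs <;> simp

theorem coeff_neg_one_dpow_mul_ofFun (l : ℤ) (f : TimeSeries k) :
    (dpow l * ofFun f).coeff (-1) = if l = -1 then f else 0 := by
  split_ifs with h
  · subst h
    rw [coeff_dpow_mul (ordLE_ofFun f) (-1) (-1) 1 (by simp)]
    simp [coeff_ofFun]
  · by_cases hl : l < -1
    · exact ((ordLE_dpow l).mul (ordLE_ofFun f)) _ (by omega)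
    · obtain ⟨n, rfl⟩ : ∃ n : ℕ, l = n := ⟨l.toNat, by omega⟩
      exact (isDiff_ofFun f).dpow_mul n _ (by omega)

theorem symbol_smul_dpow (f : TimeSeries k) (i : ℤ) :
    symbol (f • dpow i) = indepOfLam f * lamPow i := by
  have h1 : symbol (dpow 0 : PDO k) = 1 := by
    classical
    ext m n
    rw [coeff_symbol, coeff_dpow, MvPowerSeries.coeff_one]
    by_cases hn : n = 0 <;> by_cases hm : m = 0 <;> simp [hn, hm, MvPowerSeries.coeff_one]
  have h := symbol_mul_dpow (dpow 0 : PDO k) i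
  rw [dpow_mul_dpow, zero_add, h1, mul_one] at h
  rw [symbol_smul, h]

theorem ct_symbol_mul_symbol_low {A Q : PDO k} {n m : ℤ} (hA : OrdLE A n) (hQ : OrdLE Q m)
    (h : n + m < 0) : ct (symbol A * negLam (symbol Q)) = 0 := by
  classical
  ext r
  rw [coeff_ct, MvPowerSeries.coeff_mul, HahnSeries.coeff_sum, Finset.sum_eq_zero]
  · simp
  intro p _
  refine coeff_mul_eq_zero_of_lt (p := -n) (q := -m) ?_ ?_ (by omega)
  · intro i hi
    rw [coeff_symbol, hA _ (by omega), map_zero]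
  · intro i hi
    rw [negLam, MvPowerSeries.coeff_map, coeff_negVarHom, coeff_symbol, hQ _ (by omega), map_zero,
      smul_zero]

/-- Both sides are (-1)^j ab when i + j = 0 and zero otherwise: ∂^l b has a ∂⁻¹ term only for l =
-1, being a differential operator for l ≥ 0 and of too low an order for l < -1. -/
theorem ct_symbol_mul_symbol_monomial (a b : TimeSeries k) (i j : ℤ) :
    ct (symbol (a • dpow i) * negLam (symbol (b • dpow j))) =
      (a • (dpow i : PDO k) * dpow (-1) * adj (b • dpow j)).coeff (-1) := by
  have h1 : indepOfLam a * lamPow i * (indepOfLam b * (j.negOnePow : ℤ) • lamPow j) =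
      (j.negOnePow : ℤ) • (indepOfLam (a * b) * lamPow (i + j)) := by
    have aux : ∀ (x y u v : TimeSeries (LaurentSeries k)) (n : ℤ),
        x * y * (u * n • v) = n • (x * u * (y * v)) := by
      intro x y u v n
      rw [zsmul_eq_mul, zsmul_eq_mul]
      ring
    rw [aux, ← indepOfLam_mul, lamPow_mul_lamPow]
  have h2 : a • (dpow i : PDO k) * dpow (-1) * adj (b • dpow j) =
      (j.negOnePow : ℤ) • (a • (dpow (i + -1 + j) * ofFun b)) := by
    rw [adj_smul_dpow, PDO.smul_mul', dpow_mul_dpow, mul_smul_comm, PDO.smul_mul', ← mul_assoc,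
      dpow_mul_dpow]
  rw [symbol_smul_dpow, symbol_smul_dpow, map_mul negLam, negLam_indepOfLam, negLam_lamPow,
    h1, map_zsmul, ct_lamPow_mul_indepOfLam, h2, coeff_zsmul, coeff_smul,
    coeff_neg_one_dpow_mul_ofFun]
  by_cases h : i + j = 0
  · rw [if_pos h, if_pos (by omega)]
  · rw [if_neg h, if_neg (by omega)]; simp

/-- The residue in the spectral parameter is a residue of pseudo-differential operators. -/
theorem ct_symbol_mul_symbol (A Q : PDO k) :
    ct (symbol A * negLam (symbol Q)) = (A * dpow (-1) * adj Q).coeff (-1) := by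
  obtain ⟨N, hN⟩ := A.bdd
  -- Reduction to monomials, in Q and then in A. When the orders of A and Q add up to a negative
  -- number, both sides vanish, which determines the cutoffs.
  have key := eq_zero_of_monomial (X := TimeSeries k)
    ((ct.comp (AddMonoidHom.mulLeft (symbol A))).comp
        ((negLam (k := k)).toAddMonoidHom.comp symbolHom) -
      (coeffHom (-1)).comp ((AddMonoidHom.mulLeft (A * dpow (-1))).comp adjHom)) (-N - 1) ?_ ?_ Q
  · exact sub_eq_zero.1 key
  · intro Q hQ
    refine sub_eq_zero.2 ?_
    change ct (symbol A * negLam (symbol Q)) = (A * dpow (-1) * adj Q).coeff (-1)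
    rw [ct_symbol_mul_symbol_low hN hQ (by omega)]
    exact ((OrdLE.mul (OrdLE.mul hN (ordLE_dpow (-1))) hQ.adj) _ (by omega)).symm
  · intro b j
    refine sub_eq_zero.2 ?_
    change ct (symbol A * negLam (symbol (b • dpow j))) =
      (A * dpow (-1) * adj (b • dpow j)).coeff (-1)
    have key2 := eq_zero_of_monomial (X := TimeSeries k)
      ((ct.comp (AddMonoidHom.mulRight (negLam (symbol (b • dpow j))))).comp symbolHom -
        (coeffHom (-1)).comp ((AddMonoidHom.mulRight (adj (b • dpow j))).comp
          (AddMonoidHom.mulRight (dpow (-1))))) (-j - 1) ?_ ?_ A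
    · exact sub_eq_zero.1 key2
    · intro A hA
      refine sub_eq_zero.2 ?_
      change ct (symbol A * negLam (symbol (b • dpow j))) =
        (A * dpow (-1) * adj (b • dpow j)).coeff (-1)
      rw [ct_symbol_mul_symbol_low hA ((ordLE_dpow j).smul b) (by omega)]
      exact ((OrdLE.mul (OrdLE.mul hA (ordLE_dpow (-1))) ((ordLE_dpow j).smul b).adj) _
        (by omega)).symm
    · intro a i
      refine sub_eq_zero.2 ?_
      change ct (symbol (a • dpow i) * negLam (symbol (b • dpow j))) =
        (a • dpow i * dpow (-1) * adj (b • dpow j)).coeff (-1)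
      exact ct_symbol_mul_symbol_monomial a b i j

end Symbol

/-! ### Functions P(e^ξ) and the operator form of the potentials. -/

section Wave
theorem eq_const_of_dt_eq_zero {R : Type*} [CommRing R] [Algebra ℚ R] {f : TimeSeries R}
    (h : ∀ n, dt n f = 0) : f = const (MvPowerSeries.constantCoeff f) := by
  have := IsAddTorsionFree.of_module_rat R
  refine MvPowerSeries.pderiv.ext (fun i => ?_) (by simp)
  rw [MvPowerSeries.pderiv_C]; exact h i

theorem dt_const {R : Type*} [CommRing R] (n : ℕ) (c : R) : dt n (const c) = 0 :=
  MvPowerSeries.pderiv_C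

theorem prod_add_single_mul {M : Type*} [CommMonoid M] (m : ℕ →₀ ℕ) (n : ℕ) (f : ℕ → ℕ → M)
    (hf : ∀ i, f i 0 = 1) :
    (m + Finsupp.single n 1).prod f * f n (m n) = m.prod f * f n (m n + 1) := by
  rw [← Finsupp.mul_prod_erase' m n f (fun i => hf i),
    ← Finsupp.mul_prod_erase' (m + Finsupp.single n 1) n f (fun i => hf i), Finsupp.erase_add]
  simp
  ac_rfl

variable {k : Type*} [CommRing k] [Algebra ℚ k]

theorem dt_expXi (n : ℕ) :
    dt n (expXi (k := k)) = lamPow ((2 * n + 1 : ℕ) : ℤ) * expXi := by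
  ext1 m
  rw [dt, MvPowerSeries.coeff_pderiv, MvPowerSeries.coeff_C_mul]
  change HahnSeries.single _ _ * _ = _ * HahnSeries.single _ _
  rw [HahnSeries.single_mul_single, one_mul, ← Nat.cast_succ, ← nsmul_eq_mul',
    show ∀ (a : ℤ) (b : k), (m n).succ • HahnSeries.single a b =
      HahnSeries.single a ((m n).succ • b) from
      fun a b => (map_nsmul (HahnSeries.single.addMonoidHom a) _ b).symm]
  congr 1
  · congr 1
    rw [Finsupp.sum_add_index' (by simp) (by intros; push_cast; ring), Finsupp.sum_single_index
      (by simp)]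
    push_cast; ring
  · rw [← map_nsmul]
    congr 1
    have h := prod_add_single_mul m n (fun _ e => 1 / (Nat.factorial e : ℚ)) (by simp)
    rw [nsmul_eq_mul, mul_comm]
    simp only [Nat.factorial_succ] at h
    push_cast at h ⊢
    field_simp at h ⊢
    exact h

theorem constantCoeff_expXi : MvPowerSeries.constantCoeff (expXi (k := k)) = 1 := by
  change HahnSeries.single _ _ = _
  simp

/-- All exponents in ξ are odd in λ, so the two logarithmic derivatives cancel in every time and the
product equals its value 1 at t = 0. -/
theorem expXi_mul_negLam : expXi (k := k) * negLam expXi = 1 := by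
  have h : ∀ n, dt n (expXi (k := k) * negLam expXi) = 0 := by
    intro n
    have h1 : dt n (expXi (k := k) * negLam expXi) =
        dt n expXi * negLam expXi + expXi * dt n (negLam expXi) := by
      simp only [dt, Derivation.leibniz, smul_eq_mul]; ring
    rw [h1, ← map_dt, dt_expXi, map_mul, negLam_lamPow,
      Int.negOnePow_odd _ ⟨(n : ℤ), by push_cast; ring⟩]
    simp only [Units.val_neg, Units.val_one, neg_smul, one_smul]
    ring
  rw [eq_const_of_dt_eq_zero h, map_mul, constantCoeff_expXi, one_mul]
  have : MvPowerSeries.constantCoeff (negLam (expXi (k := k))) = 1 := by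
    rw [negLam, MvPowerSeries.constantCoeff_map, constantCoeff_expXi, map_one]
  rw [this]
  exact map_one _

theorem mul_expXi_injective {f g : TimeSeries (LaurentSeries k)} (h : f * expXi = g * expXi) :
    f = g := by
  have := congrArg (fun x => x * negLam expXi) h
  simpa only [mul_assoc, expXi_mul_negLam, mul_one] using this

/-- `P(e^ξ)` for a pseudo-differential operator `P`. -/
noncomputable def wave : PDO k →+ TimeSeries (LaurentSeries k) :=
  (AddMonoidHom.mulRight expXi).comp symbolHom

theorem wave_apply (P : PDO k) : wave P = symbol P * expXi := rfl

theorem ba_eq_wave (W : PDO k) : ba W = wave W := rfl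

theorem baNeg_eq (W : PDO k) : baNeg W = negLam (ba W) := rfl

theorem wave_smul (f : TimeSeries k) (P : PDO k) : wave (f • P) = indepOfLam f * wave P := by
  rw [wave_apply, symbol_smul, mul_assoc, wave_apply]

theorem wave_mul_dpow (P : PDO k) (j : ℤ) : wave (P * dpow j) = lamPow j * wave P := by
  rw [wave_apply, symbol_mul_dpow, mul_assoc, wave_apply]

theorem dt_wave (n : ℕ) (P : PDO k) :
    dt n (wave P) = wave (dtCoeff n P + P * dpow ((2 * n + 1 : ℕ) : ℤ)) := by
  rw [map_add, wave_mul_dpow, wave_apply, wave_apply]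
  have h1 : dt n (symbol P * expXi) = dt n (symbol P) * expXi + symbol P * dt n expXi := by
    simp only [dt, Derivation.leibniz, smul_eq_mul]; ring
  rw [h1, dt_symbol, dt_expXi]
  ring

theorem dx_wave (P : PDO k) : dx (wave P) = wave (dpow 1 * P) := by
  rw [dx, dt_wave]
  congr 1
  ext1; funext i
  rw [coeff_dpow_one_mul, coeff_add]
  simp only [mul_zero, zero_add, Nat.cast_one, coeff_mul_dpow]
  rw [add_comm]; rfl

theorem iterate_dx_wave (i : ℕ) (P : PDO k) : (dx^[i]) (wave P) = wave (dpow (i : ℤ) * P) := by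
  induction i with
  | zero => rw [Nat.cast_zero, dpow_zero_mul]; rfl
  | succ i ih => rw [Function.iterate_succ_apply', ih, dx_wave, dpow_succ_mul]

theorem wave_mul {A : PDO k} (hA : IsDiff A) (P : PDO k) :
    wave (A * P) = PDO.apply (baseChange HahnSeries.C A) (wave P) := by
  obtain ⟨K, hK⟩ := A.exists_ordLE_natCast
  rw [apply_eq_sum (hK.baseChange _) (K + 1) (by simp)]
  conv_lhs => rw [hA.eq_sum hK]
  rw [Finset.sum_mul, map_sum]
  refine Finset.sum_congr rfl fun i _ => ?_
  rw [PDO.smul_mul', wave_smul, iterate_dx_wave]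
  rfl

theorem wave_injective {P Q : PDO k} (h : wave P = wave Q) : P = Q :=
  symbol_injective (mul_expXi_injective h)

/-- The functions `P(e^ξ)`. -/
def IsWave (f : TimeSeries (LaurentSeries k)) : Prop := ∃ P, f = wave P

theorem IsWave.sub {f g : TimeSeries (LaurentSeries k)} (hf : IsWave f) (hg : IsWave g) :
    IsWave (f - g) := by
  obtain ⟨P, rfl⟩ := hf
  obtain ⟨Q, rfl⟩ := hg
  exact ⟨P - Q, (map_sub wave P Q).symm⟩

theorem IsWave.indepOfLam_mul (f : TimeSeries k) {g : TimeSeries (LaurentSeries k)}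
    (hg : IsWave g) : IsWave (indepOfLam f * g) := by
  obtain ⟨Q, rfl⟩ := hg
  exact ⟨f • Q, (wave_smul f Q).symm⟩

theorem IsWave.dt (n : ℕ) {f : TimeSeries (LaurentSeries k)} (hf : IsWave f) :
    IsWave (dt n f) := by
  obtain ⟨P, rfl⟩ := hf
  exact ⟨_, dt_wave n P⟩

theorem IsWave.iterate_dx (n : ℕ) {f : TimeSeries (LaurentSeries k)} (hf : IsWave f) :
    IsWave ((dx^[n]) f) := by
  obtain ⟨P, rfl⟩ := hf
  exact ⟨_, iterate_dx_wave n P⟩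

theorem isWave_sum {ι : Type*} (s : Finset ι) {f : ι → TimeSeries (LaurentSeries k)}
    (hf : ∀ i ∈ s, IsWave (f i)) : IsWave (∑ i ∈ s, f i) := by
  classical
  induction s using Finset.induction_on with
  | empty => exact ⟨0, (map_zero wave).symm⟩
  | insert a s ha ih =>
    rw [Finset.sum_insert ha]
    obtain ⟨P, hP⟩ := hf a (Finset.mem_insert_self a s)
    obtain ⟨Q, hQ⟩ := ih fun i hi => hf i (Finset.mem_insert_of_mem hi)
    exact ⟨P + Q, by rw [hP, hQ, map_add]⟩

/-- The operator P is determined by P(e^ξ), and ∂P = 0 forces P = 0. No integration constant can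
occur among these functions, so equations between them may be checked after one x-derivative. -/
theorem IsWave.eq_zero_of_dx {f : TimeSeries (LaurentSeries k)} (hf : IsWave f)
    (h : dx f = 0) : f = 0 := by
  obtain ⟨P, rfl⟩ := hf
  rw [dx_wave, ← map_zero wave] at h
  have h2 := wave_injective h
  rw [← mul_zero (dpow 1)] at h2
  rw [dpow_one_mul_injective h2, map_zero]

theorem IsWave.bires_left (i : ℕ) {f : TimeSeries (LaurentSeries k)} (hf : IsWave f)
    (Φ : TimeSeries k) : IsWave (bires i f (indepOfLam Φ)) := by
  induction i generalizing f with
  | zero => exact ⟨0, (map_zero wave).symm⟩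
  | succ i ih =>
    rw [bires, iterate_dx_indepOfLam, mul_comm]
    exact (hf.indepOfLam_mul _).sub (ih (hf.dt 0))

theorem IsWave.bires_right (i : ℕ) {f : TimeSeries (LaurentSeries k)} (hf : IsWave f)
    (Φ : TimeSeries k) : IsWave (bires i (indepOfLam Φ) f) := by
  induction i generalizing Φ with
  | zero => exact ⟨0, (map_zero wave).symm⟩
  | succ i ih =>
    rw [bires, dx, dt_indepOfLam]
    exact ((hf.iterate_dx i).indepOfLam_mul _).sub (ih _)

variable {L W : PDO k}

theorem IsWave.omega_left {f : TimeSeries (LaurentSeries k)} (hf : IsWave f) (n : ℕ)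
    (Φ : TimeSeries k) : IsWave (omega (B (lax₁ L) n) (indepOfLam Φ) f) := by
  refine isWave_sum _ fun i _ => ?_
  rw [coeff_B_lax₁, mul_comm]
  exact (hf.indepOfLam_mul _).bires_left i Φ

theorem IsWave.omega_right {f : TimeSeries (LaurentSeries k)} (hf : IsWave f) (n : ℕ)
    (Ψ : TimeSeries k) : IsWave (omega (B (lax₁ L) n) f (indepOfLam Ψ)) := by
  refine isWave_sum _ fun i _ => ?_
  rw [coeff_B_lax₁, ← BKP.indepOfLam_mul]
  exact hf.bires_right i _

theorem IsBKP.isEigenfunction_ba (h : IsBKP L W) : IsEigenfunction (BKP.lax₁ L) (ba W) := by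
  intro n
  rw [ba_eq_wave, dt_wave, h.dtCoeff_dressing, sub_add_cancel, wave_mul (isDiff_B n), baseChange_B]
  rfl

/-- A function `P(e^ξ)` with the right derivative in `x` is a squared eigenfunction potential. -/
theorem IsBKP.isSEP_of_dx (h : IsBKP L W) {Φ f P : TimeSeries (LaurentSeries k)}
    (hΦ : IsEigenfunction (BKP.lax₁ L) Φ) (hf : IsEigenfunction (BKP.lax₁ L) f) (hP : IsWave P)
    (hO : ∀ n, IsWave (omega (B (BKP.lax₁ L) n) Φ (dx f))) (hdx : dx P = Φ * dx f) :
    IsSEP (BKP.lax₁ L) Φ (dx f) P := by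
  rw [isSEP_iff]
  intro n
  refine sub_eq_zero.1 (((hP.dt n).sub (hO n)).eq_zero_of_dx ?_)
  have h1 := h.lax₁.dx_omega_B hΦ hf n
  rw [← hdx] at h1
  rw [show dx (dt n P - omega (B (BKP.lax₁ L) n) Φ (dx f)) = dx (dt n P) -
    dx (omega (B (BKP.lax₁ L) n) Φ (dx f)) from map_sub _ _ _, h1, dx, dt_comm, sub_self]

/-- The potential `∂⁻¹ Φ ∂ W (e^ξ)`. -/
noncomputable def potential (W : PDO k) (Φ : TimeSeries k) : PDO k :=
  dpow (-1) * (Φ • (dpow 1 * W))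

theorem dx_wave_potential (Φ : TimeSeries k) :
    dx (wave (potential W Φ)) = indepOfLam Φ * dx (ba W) := by
  rw [dx_wave, potential, dpow_mul_dpow_mul, show (1 + -1 : ℤ) = 0 by norm_num, dpow_zero_mul,
    wave_smul, ba_eq_wave, dx_wave]

theorem IsBKP.isSEP_potential (h : IsBKP L W) {Φ : TimeSeries k} (hΦ : IsEigenfunction L Φ) :
    IsSEP (BKP.lax₁ L) (BKP.indepOfLam Φ) (dx (ba W)) (wave (potential W Φ)) :=
  h.isSEP_of_dx hΦ.indepOfLam h.isEigenfunction_ba ⟨_, rfl⟩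
    (fun n => (IsWave.dt 0 ⟨_, ba_eq_wave W⟩).omega_left n Φ) (dx_wave_potential Φ)

/-- Integration by parts: Φψ minus the potential with derivative Φψ_x has derivative ψΦ_x. -/
theorem IsBKP.isSEP_sub_potential (h : IsBKP L W) {Φ : TimeSeries k}
    (hΦ : IsEigenfunction L Φ) :
    IsSEP (BKP.lax₁ L) (ba W) (dx (BKP.indepOfLam Φ))
      (BKP.indepOfLam Φ * ba W - wave (potential W Φ)) := by
  refine h.isSEP_of_dx h.isEigenfunction_ba hΦ.indepOfLam
    ((IsWave.indepOfLam_mul Φ ⟨_, ba_eq_wave W⟩).sub ⟨_, rfl⟩) (fun n => ?_) ?_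
  · rw [dx, dt_indepOfLam]
    exact IsWave.omega_right ⟨_, ba_eq_wave W⟩ n _
  · have := dx_wave_potential (W := W) Φ
    simp only [dx, dt, map_sub, Derivation.leibniz, smul_eq_mul] at this ⊢
    rw [this]; ring

end Wave

/-! ### Bilinear identities and spectral densities. -/

section Pairing
variable {k : Type*} [CommRing k]

theorem ct_apply_mul (A : PDO k) {K : ℕ} (hK : OrdLE A K) (f g : TimeSeries (LaurentSeries k)) :
    ct (PDO.apply (baseChange HahnSeries.C A) f * g) =
      ∑ i ∈ Finset.range (K + 1), A.coeff i * ct ((dx^[i]) f * g) := by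
  rw [apply_eq_sum (hK.baseChange _) (K + 1) (by simp), Finset.sum_mul, map_sum]
  refine Finset.sum_congr rfl fun i _ => ?_
  rw [← ct_indepOfLam_mul, mul_assoc]; rfl

theorem ct_dt_mul (n : ℕ) (f g : TimeSeries (LaurentSeries k)) :
    dt n (ct (f * g)) = ct (dt n f * g) + ct (f * dt n g) := by
  rw [← ct_dt, ← map_add]
  congr 1
  simp only [dt, Derivation.leibniz, smul_eq_mul]
  ring

theorem baseChange_negVarHom_lax₁ {L : PDO k} : baseChange negVarHom (lax₁ L) = lax₁ L := by
  ext1; funext i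
  exact negLam_indepOfLam _

theorem integral_lamInv_mul (f : LaurentSeries k) : integral (lamInv * f) = f.coeff 0 := by
  rw [integral, lamInv, HahnSeries.coeff_single_mul, one_mul, sub_self]

end Pairing

section Pairing
variable {k : Type*} [CommRing k] [Algebra ℚ k] {L W : PDO k}

theorem wave_mul_negLam_wave (A Q : PDO k) :
    wave A * negLam (wave Q) = symbol A * negLam (symbol Q) := by
  rw [wave_apply, wave_apply, map_mul negLam]
  calc symbol A * expXi * (negLam (symbol Q) * negLam expXi)
      = symbol A * negLam (symbol Q) * (expXi * negLam expXi) := by ring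
    _ = _ := by rw [expXi_mul_negLam, mul_one]

/-- The BKP bilinear identity. The exponentials cancel, and what remains is the residue of ∂^j
W∂⁻¹W^* = ∂^{j-1}. -/
theorem IsBKP.ct_iterate_dx_mul (h : IsBKP L W) (j : ℕ) :
    ct ((dx^[j]) (ba W) * baNeg W) = if j = 0 then 1 else 0 := by
  rw [baNeg_eq, ba_eq_wave, iterate_dx_wave, wave_mul_negLam_wave, ct_symbol_mul_symbol,
    mul_assoc, mul_assoc, ← mul_assoc W, h.dressing_mul_adj, dpow_mul_dpow, coeff_dpow]
  by_cases hj : j = 0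
  · rw [if_pos hj, if_pos (by omega)]
  · rw [if_neg hj, if_neg (by omega)]

/-- The operators `B_{2n+1}` have no constant term. -/
theorem IsBKP.coeff_zero_B (h : IsBKP L W) (n : ℕ) : (B L n).coeff 0 = 0 := by
  obtain ⟨K, hK⟩ := (B L n).exists_ordLE_natCast
  have h1 : ct (dt n (ba W) * baNeg W) = (B L n).coeff 0 := by
    rw [h.isEigenfunction_ba n, BKP.lax₁, ← baseChange_B, ct_apply_mul _ hK,
      Finset.sum_eq_single 0]
    · rw [h.ct_iterate_dx_mul, if_pos rfl, mul_one]; rfl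
    · intro i _ hi
      rw [h.ct_iterate_dx_mul, if_neg hi, mul_zero]
    · intro h; simp at h
  -- The substitution λ ↦ -λ keeps the constant term and exchanges the two factors. Hence both
  -- halves of the t_{2n+1}-derivative of the constant 1 equal the same coefficient, and twice that
  -- coefficient is zero.
  have h2 : ct (ba W * dt n (baNeg W)) = (B L n).coeff 0 := by
    rw [← h1, ← ct_negLam (dt n (ba W) * baNeg W), map_mul negLam, map_dt, baNeg_eq,
      negLam_negLam, mul_comm]
  have h3 := h.ct_iterate_dx_mul 0
  rw [if_pos rfl, Function.iterate_zero_apply] at h3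
  have h4 := ct_dt_mul n (ba W) (baNeg W)
  rw [h3, h1, h2, dt, MvPowerSeries.pderiv_one, ← two_nsmul] at h4
  have := IsAddTorsionFree.of_module_rat (TimeSeries k)
  exact (nsmul_eq_zero_iff_right (by norm_num)).1 h4.symm

/-- `Y` pairs to zero with all derivatives of the Baker-Akhiezer function. -/
def Orth (W : PDO k) (Y : TimeSeries (LaurentSeries k)) : Prop :=
  ∀ j, ct ((dx^[j]) (ba W) * Y) = 0

theorem Orth.sub {X Y : TimeSeries (LaurentSeries k)} (hX : Orth W X) (hY : Orth W Y) :
    Orth W (X - Y) := fun j => by rw [mul_sub, map_sub, hX, hY, sub_zero]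

theorem orth_zero : Orth W 0 := fun j => by rw [mul_zero, map_zero]

theorem orth_sum {ι : Type*} (s : Finset ι) {f : ι → TimeSeries (LaurentSeries k)}
    (hf : ∀ i ∈ s, Orth W (f i)) : Orth W (∑ i ∈ s, f i) := fun j => by
  rw [Finset.mul_sum, map_sum, Finset.sum_eq_zero fun i hi => hf i hi j]

theorem Orth.indepOfLam_mul (f : TimeSeries k) {Y : TimeSeries (LaurentSeries k)}
    (hY : Orth W Y) : Orth W (indepOfLam f * Y) := fun j => by
  rw [mul_left_comm, ct_indepOfLam_mul, hY, mul_zero]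

/-- Differentiate the orthogonality relations. By the eigenfunction equation ∂_{2n+1}∂^jψ is again a
combination of the ∂^iψ, so only the term with ∂_{2n+1}Y is left. -/
theorem Orth.dt (h : IsBKP L W) (n : ℕ) {Y : TimeSeries (LaurentSeries k)}
    (hY : Orth W Y) : Orth W (dt n Y) := by
  intro j
  have h1 : BKP.TimeSeries.dt n ((dx^[j]) (ba W)) =
      PDO.apply (baseChange HahnSeries.C (dpow (j : ℤ) * B L n)) (ba W) := by
    rw [dt_iterate_dx, h.isEigenfunction_ba n, BKP.lax₁, ← baseChange_B, baseChange_mul,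
      baseChange_dpow, apply_dpow_mul]
    exact fun i hi => by rw [coeff_baseChange, isDiff_B n i hi, map_zero]
  have h2 := ct_dt_mul n ((dx^[j]) (ba W)) Y
  obtain ⟨K, hK⟩ := (dpow (j : ℤ) * B L n).exists_ordLE_natCast
  rw [hY j, h1, ct_apply_mul _ hK, Finset.sum_eq_zero fun i _ => by rw [hY i, mul_zero],
    zero_add, BKP.TimeSeries.dt, map_zero] at h2
  exact h2.symm

theorem Orth.iterate_dx (h : IsBKP L W) (n : ℕ) {Y : TimeSeries (LaurentSeries k)}
    (hY : Orth W Y) : Orth W ((dx^[n]) Y) := by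
  induction n with
  | zero => exact hY
  | succ n ih => rw [Function.iterate_succ_apply']; exact ih.dt h 0

theorem Orth.bires (h : IsBKP L W) (i : ℕ) {Y : TimeSeries (LaurentSeries k)} (hY : Orth W Y)
    (Φ : TimeSeries k) : Orth W (bires i Y (indepOfLam Φ)) := by
  induction i generalizing Y with
  | zero => exact orth_zero
  | succ i ih =>
    rw [PDO.bires, iterate_dx_indepOfLam, mul_comm]
    exact (hY.indepOfLam_mul _).sub (ih (hY.dt h 0))

theorem Orth.omega (h : IsBKP L W) {Y : TimeSeries (LaurentSeries k)} (hY : Orth W Y) (n : ℕ)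
    (Φ : TimeSeries k) : Orth W (omega (B (lax₁ L) n) (indepOfLam Φ) Y) := by
  refine orth_sum _ fun i _ => ?_
  rw [coeff_B_lax₁, mul_comm]
  exact (hY.indepOfLam_mul _).bires h i Φ

/-- The pairing of ∂^jψ(t,λ) with ψ(t,-λ) is constant in t, and that of ∂^{j+1}ψ is zero, so the
product rule leaves zero. -/
theorem IsBKP.orth_dx_baNeg (h : IsBKP L W) : Orth W (dx (baNeg W)) := by
  intro j
  have h1 := ct_dt_mul 0 ((dx^[j]) (ba W)) (baNeg W)
  have h2 := h.ct_iterate_dx_mul (j + 1)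
  rw [if_neg (by omega), Function.iterate_succ_apply'] at h2
  rw [h.ct_iterate_dx_mul, show dt 0 ((dx^[j]) (ba W)) = dx ((dx^[j]) (ba W)) from rfl, h2,
    zero_add] at h1
  rw [dx, ← h1]
  split_ifs
  · exact MvPowerSeries.pderiv_one
  · exact map_zero _

theorem IsBKP.isEigenfunction_baNeg (h : IsBKP L W) :
    IsEigenfunction (BKP.lax₁ L) (baNeg W) := by
  have := h.isEigenfunction_ba.map negVarHom
  rwa [baseChange_negVarHom_lax₁] at this

/-- Since B has no constant term, ∂_{2n+1}ψ(t,-λ) is a combination of ψ(t,-λ)_x and its derivatives.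
This lets ψ(t,-λ) itself enter the residue argument, with the constant 1 as eigenfunction. -/
theorem IsBKP.orth_dt_baNeg (h : IsBKP L W) (n : ℕ) : Orth W (dt n (baNeg W)) := by
  obtain ⟨K, hK⟩ := (B (BKP.lax₁ L) n).exists_ordLE_natCast
  rw [h.isEigenfunction_baNeg n, apply_eq_sum hK (K + 1) (by simp)]
  refine orth_sum _ fun i _ => ?_
  rw [coeff_B_lax₁]
  cases i with
  | zero =>
    rw [Nat.cast_zero, h.coeff_zero_B, BKP.indepOfLam, map_zero, zero_mul]
    exact orth_zero
  | succ i =>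
    rw [Function.iterate_succ_apply]
    exact (h.orth_dx_baNeg.iterate_dx h i).indepOfLam_mul _

theorem finsupp_induction_add_single {p : (ℕ →₀ ℕ) → Prop} (h0 : p 0)
    (h1 : ∀ m i, p m → p (m + Finsupp.single i 1)) (m : ℕ →₀ ℕ) : p m := by
  induction m using Finsupp.induction with
  | zero => exact h0
  | single_add i b f _ _ ih =>
    rw [add_comm]
    clear * - ih h1
    induction b with
    | zero => simpa using ih
    | succ b ihb =>
      rw [Finsupp.single_add, ← add_assoc]
      exact h1 _ _ ihb

/-- The coefficient of a derivative is m_n + 1 times the next Taylor coefficient, and k has no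
torsion. Pairings at t = t' can thus be propagated to independent t and t'. -/
theorem coeff_mul_add_single (n : ℕ) (X : TimeSeries (LaurentSeries k)) (m : ℕ →₀ ℕ)
    (y : LaurentSeries k)
    (h : (MvPowerSeries.coeff m (dt n X) * y).coeff 0 = 0) :
    (MvPowerSeries.coeff (m + Finsupp.single n 1) X * y).coeff 0 = 0 := by
  rw [dt, MvPowerSeries.coeff_pderiv, ← Nat.cast_succ, ← nsmul_eq_mul', smul_mul_assoc,
    HahnSeries.coeff_smul] at h
  have := IsAddTorsionFree.of_module_rat k
  exact (nsmul_eq_zero_iff_right (by omega)).1 h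

theorem Orth.coeff_mul_coeff (h : IsBKP L W) {Y : TimeSeries (LaurentSeries k)} (hY : Orth W Y)
    (m m' : ℕ →₀ ℕ) :
    (MvPowerSeries.coeff m' Y * MvPowerSeries.coeff m (ba W)).coeff 0 = 0 := by
  -- The induction needs a class of functions X closed under time derivatives: those that pair to
  -- zero with every orthogonal Y. It contains ψ.
  have key : ∀ m' m, ∀ X Y : TimeSeries (LaurentSeries k),
      (∀ Y, Orth W Y → ct (X * Y) = 0) → Orth W Y →
      (MvPowerSeries.coeff m' Y * MvPowerSeries.coeff m X).coeff 0 = 0 := by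
    intro m'
    induction m' using finsupp_induction_add_single with
    | h0 =>
      intro m
      induction m using finsupp_induction_add_single with
      | h0 =>
        intro X Y hX hY
        have := congrArg (MvPowerSeries.coeff 0) (hX Y hY)
        rwa [coeff_ct, MvPowerSeries.coeff_zero_eq_constantCoeff, map_mul, mul_comm] at this
      | h1 m i ih =>
        intro X Y hX hY
        rw [mul_comm]
        refine coeff_mul_add_single i X m _ ?_
        rw [mul_comm]
        refine ih (BKP.TimeSeries.dt i X) Y (fun Z hZ => ?_) hY
        have h2 := ct_dt_mul i X Z
        rw [hX Z hZ, hX _ (hZ.dt h i), add_zero, BKP.TimeSeries.dt, map_zero] at h2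
        exact h2.symm
    | h1 m' i ih =>
      intro m X Y hX hY
      exact coeff_mul_add_single i Y m' _ (ih m X _ hX (hY.dt h i))
  exact key m' m _ Y (fun Y hY => hY 0) hY

/-- Pairing with a function all of whose derivatives are orthogonal to the Baker-Akhiezer
function. -/
theorem IsBKP.coeff_mul_coeff (h : IsBKP L W) {φ : TimeSeries (LaurentSeries k)}
    (hφ : ∀ n, Orth W (dt n φ)) (m m' : ℕ →₀ ℕ) :
    (MvPowerSeries.coeff m' φ * MvPowerSeries.coeff m (ba W)).coeff 0 =
      if m' = 0 then MvPowerSeries.coeff m (ct (ba W * φ)) else 0 := by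
  classical
  have h0 : ∀ m m', m' ≠ 0 →
      (MvPowerSeries.coeff m' φ * MvPowerSeries.coeff m (ba W)).coeff 0 = 0 := by
    intro m m'
    induction m' using finsupp_induction_add_single with
    | h0 => intro h; exact absurd rfl h
    | h1 m' i _ =>
      intro _
      exact coeff_mul_add_single i φ m' _ ((hφ i).coeff_mul_coeff h m m')
  split_ifs with hm
  · subst hm
    -- On the diagonal t' = t only the term with t'-exponent 0 survives, by `h0`.
    rw [coeff_ct, mul_comm (ba W), MvPowerSeries.coeff_mul, HahnSeries.coeff_sum,
      Finset.sum_eq_single (0, m)]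
    · rintro ⟨a, b⟩ hab hne
      refine h0 _ _ fun ha => hne ?_
      rw [Finset.HasAntidiagonal.mem_antidiagonal] at hab
      simp only at ha hab
      rw [ha, zero_add] at hab
      rw [ha, hab]
    · intro hn; exact absurd (Finset.HasAntidiagonal.mem_antidiagonal.2 (zero_add m)) hn
  · exact h0 m m' hm

theorem IsBKP.isSpectralDensity (h : IsBKP L W) {φ : TimeSeries (LaurentSeries k)}
    (hφ : ∀ n, Orth W (dt n φ)) : IsSpectralDensity W (ct (ba W * φ)) φ := by
  classical
  refine funext fun m => funext fun m' => ?_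
  change MvPowerSeries.coeff m' (MvPowerSeries.C (MvPowerSeries.coeff m (ct (ba W * φ)))) =
    integral (lamInv * MvPowerSeries.coeff m' φ * MvPowerSeries.coeff m (ba W))
  rw [mul_assoc, integral_lamInv_mul, h.coeff_mul_coeff hφ, MvPowerSeries.coeff_C]

end Pairing

/-! ### Exchanging power series in λ⁻¹ with power series in the times. -/

section OfPowerSeries
variable {R : Type*} [CommRing R]

/-- The function underlying `ofTimePowerSeries`. -/
noncomputable def ofTimeFun (p : PowerSeries (TimeSeries R)) : TimeSeries (LaurentSeries R) :=
  fun m => HahnSeries.ofPowerSeries ℤ R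
    (PowerSeries.mk fun n => MvPowerSeries.coeff m (PowerSeries.coeff n p))

theorem coeff_ofTimeFun (p : PowerSeries (TimeSeries R)) (m : ℕ →₀ ℕ) :
    MvPowerSeries.coeff m (ofTimeFun p) = HahnSeries.ofPowerSeries ℤ R
      (PowerSeries.mk fun n => MvPowerSeries.coeff m (PowerSeries.coeff n p)) := rfl

/-- A power series in `λ⁻¹` whose coefficients are power series in the times, regarded as a power
series in the times. -/
noncomputable def ofTimePowerSeries : PowerSeries (TimeSeries R) →+*
    TimeSeries (LaurentSeries R) where
  toFun := ofTimeFun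
  map_one' := by
    classical
    ext1 m
    rw [coeff_ofTimeFun, MvPowerSeries.coeff_one]
    split_ifs with hm
    · rw [← map_one (HahnSeries.ofPowerSeries ℤ R)]
      congr 1
      ext n
      rw [PowerSeries.coeff_mk, PowerSeries.coeff_one, PowerSeries.coeff_one, hm]
      split_ifs <;> simp
    · rw [← map_zero (HahnSeries.ofPowerSeries ℤ R)]
      congr 1
      ext n
      rw [PowerSeries.coeff_mk, PowerSeries.coeff_one]
      split_ifs <;> simp [MvPowerSeries.coeff_one, hm]
  map_zero' := by
    ext1 m
    rw [coeff_ofTimeFun, map_zero, ← map_zero (HahnSeries.ofPowerSeries ℤ R)]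
    congr 1
  map_add' p q := by
    ext1 m
    rw [map_add, coeff_ofTimeFun, coeff_ofTimeFun, coeff_ofTimeFun, ← map_add]
    congr 1
  map_mul' p q := by
    classical
    ext1 m
    rw [MvPowerSeries.coeff_mul, coeff_ofTimeFun]
    simp only [coeff_ofTimeFun, ← map_mul]
    rw [← map_sum]
    congr 1
    ext n
    rw [PowerSeries.coeff_mk, PowerSeries.coeff_mul, map_sum, map_sum]
    simp only [PowerSeries.coeff_mul, MvPowerSeries.coeff_mul, PowerSeries.coeff_mk]
    exact Finset.sum_comm

theorem coeff_ofTimePowerSeries (p : PowerSeries (TimeSeries R)) (m : ℕ →₀ ℕ) (n : ℤ) :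
    (MvPowerSeries.coeff m (ofTimePowerSeries p)).coeff n =
      if n < 0 then 0 else MvPowerSeries.coeff m (PowerSeries.coeff n.natAbs p) := by
  change (HahnSeries.ofPowerSeries ℤ R _).coeff n = _
  rw [PowerSeries.coeff_coe, PowerSeries.coeff_mk]

theorem ofTimePowerSeries_C (f : TimeSeries R) :
    ofTimePowerSeries (PowerSeries.C f) = indepOfLam f := by
  ext m n
  rw [coeff_ofTimePowerSeries, indepOfLam, MvPowerSeries.coeff_map, HahnSeries.C_apply,
    HahnSeries.coeff_single, PowerSeries.coeff_C]
  by_cases h1 : n = 0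
  · simp [h1]
  · by_cases h2 : n < 0
    · simp [h1, h2]
    · simp [h1]

/-- The coefficients of an operator of nonpositive order, as a power series in `∂⁻¹`. -/
noncomputable def powerSymbol (P : PDO R) : PowerSeries (TimeSeries R) :=
  PowerSeries.mk fun n => P.coeff (-(n : ℤ))

theorem ofTimePowerSeries_powerSymbol {P : PDO R} (hP : OrdLE P 0) :
    ofTimePowerSeries (powerSymbol P) = symbol P := by
  ext m n
  rw [coeff_ofTimePowerSeries, coeff_symbol, powerSymbol, PowerSeries.coeff_mk]
  split_ifs with h
  · rw [hP _ (by omega), map_zero]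
  · congr 3; omega

theorem negLam_ofTimePowerSeries (p : PowerSeries (TimeSeries R)) :
    negLam (ofTimePowerSeries p) =
      ofTimePowerSeries (PowerSeries.mk fun n => (-1) ^ n * PowerSeries.coeff n p) := by
  ext m n
  rw [negLam, MvPowerSeries.coeff_map, coeff_negVarHom, coeff_ofTimePowerSeries,
    coeff_ofTimePowerSeries, PowerSeries.coeff_mk]
  split_ifs with h
  · simp
  · obtain ⟨j, rfl⟩ : ∃ j : ℕ, n = j := ⟨n.toNat, by omega⟩
    rw [Int.natAbs_natCast]
    rcases Nat.even_or_odd j with hj | hj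
    · rw [hj.neg_one_pow, one_mul, Int.negOnePow_even _ (by exact_mod_cast hj)]
      simp
    · rw [hj.neg_one_pow, Int.negOnePow_odd _ (by exact_mod_cast hj)]
      simp

theorem ct_lamPow_mul_ofTimePowerSeries (j : ℕ) (p : PowerSeries (TimeSeries R)) :
    ct (lamPow (j : ℤ) * ofTimePowerSeries p) = PowerSeries.coeff j p := by
  ext m
  rw [coeff_ct, MvPowerSeries.coeff_C_mul, HahnSeries.coeff_single_mul, one_mul,
    coeff_ofTimePowerSeries, if_neg (by omega), show (0 - -(j : ℤ)).natAbs = j by omega]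

/-- Apply `∂_{2i+1}` to the coefficients. -/
noncomputable def dtSeries (i : ℕ) (p : PowerSeries (TimeSeries R)) :
    PowerSeries (TimeSeries R) := PowerSeries.mk fun n => dt i (PowerSeries.coeff n p)

theorem dtSeries_mul (i : ℕ) (p q : PowerSeries (TimeSeries R)) :
    dtSeries i (p * q) = dtSeries i p * q + p * dtSeries i q := by
  refine PowerSeries.ext fun n => ?_
  rw [dtSeries, PowerSeries.coeff_mk, PowerSeries.coeff_mul, map_add, PowerSeries.coeff_mul,
    PowerSeries.coeff_mul, dt, map_sum, ← Finset.sum_add_distrib]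
  refine Finset.sum_congr rfl fun a _ => ?_
  simp only [dtSeries, PowerSeries.coeff_mk, Derivation.leibniz, smul_eq_mul]
  ring

/-- Additive maps between ℚ-modules are ℚ-linear for any module structure. The structure is an
argument so that the one induced by an algebra instance is covered as well as the coefficientwise
one. -/
theorem coeff_rat_smul [Module ℚ R] (inst : Module ℚ (LaurentSeries R)) (r : ℚ)
    (x : LaurentSeries R) (j : ℤ) : (inst.toSMul.smul r x).coeff j = r • x.coeff j :=
  @map_rat_smul _ _ _ _ inst _ _ _ _ (HahnSeries.coeff.addMonoidHom (Γ := ℤ) (R := R) j) r x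

end OfPowerSeries

/-! ### Shifts by c[z⁻¹], characterized by a differential equation in z⁻¹. -/

section Shift
variable {R : Type*} [CommRing R] [Algebra ℚ R]

/-- The multi-indices `a` with `∑ (2i+1) a_i = n`. -/
noncomputable def weightSet (n : ℕ) : Finset (ℕ →₀ ℕ) :=
  {a ∈ (Finset.range n).finsupp (fun _ => Finset.range (n + 1)) |
    (a.sum fun i e => (2 * i + 1) * e) = n}

theorem mul_le_weight (a : ℕ →₀ ℕ) (i : ℕ) :
    (2 * i + 1) * a i ≤ a.sum fun i e => (2 * i + 1) * e := by
  by_cases h : i ∈ a.support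
  · exact Finset.single_le_sum (f := fun i => (2 * i + 1) * a i) (fun _ _ => Nat.zero_le _) h
  · rw [Finsupp.notMem_support_iff.1 h]; simp

/-- The box in the definition only provides finiteness: weight n already forces i < n on the support
and a_i ≤ n. -/
theorem mem_weightSet {n : ℕ} {a : ℕ →₀ ℕ} :
    a ∈ weightSet n ↔ (a.sum fun i e => (2 * i + 1) * e) = n := by
  rw [weightSet, Finset.mem_filter, and_iff_right_iff_imp]
  intro h
  rw [Finset.mem_finsupp_iff]
  refine ⟨fun i hi => ?_, fun i _ => ?_⟩
  · have h1 := mul_le_weight a i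
    rw [Finsupp.mem_support_iff] at hi
    have : 1 ≤ a i := by omega
    rw [Finset.mem_range]
    nlinarith
  · have h1 := mul_le_weight a i
    rw [Finset.mem_range]
    nlinarith

/-- The weight of the multi-index `a` in the Taylor expansion of `F(t + c[z⁻¹])`. -/
noncomputable def taylorWeight (c : ℚ) (m a : ℕ →₀ ℕ) : ℚ :=
  a.prod fun i e => ((m i + e).choose e : ℚ) * (c / (2 * i + 1)) ^ e

/-- The coefficient of `z⁻ⁿ` in `F(t + c[z⁻¹])`. -/
noncomputable def shiftCoeff (c : ℚ) (n : ℕ) (F : TimeSeries R) : TimeSeries R := fun m =>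
  ∑ a ∈ weightSet n, taylorWeight c m a • MvPowerSeries.coeff (m + a) F

theorem coeff_shiftCoeff (c : ℚ) (n : ℕ) (F : TimeSeries R) (m : ℕ →₀ ℕ) :
    MvPowerSeries.coeff m (shiftCoeff c n F) =
      ∑ a ∈ weightSet n, taylorWeight c m a • MvPowerSeries.coeff (m + a) F := rfl

/-- `F(t + c[z⁻¹])` as a power series in `z⁻¹`. -/
noncomputable def shiftSeries (c : ℚ) (F : TimeSeries R) : PowerSeries (TimeSeries R) :=
  PowerSeries.mk fun n => shiftCoeff c n F

theorem shift_eq (c : ℚ) (F : TimeSeries R) :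
    shift c F = ofTimePowerSeries (shiftSeries c F) := by
  refine funext fun m => ?_
  change _ = HahnSeries.ofPowerSeries ℤ R _
  rw [shift]
  congr 1
  ext n
  rw [PowerSeries.coeff_mk, PowerSeries.coeff_mk, shiftSeries, PowerSeries.coeff_mk]
  rfl

theorem weightSet_zero : weightSet 0 = {0} := by
  ext a
  rw [mem_weightSet, Finset.mem_singleton]
  refine ⟨fun h => Finsupp.ext fun i => ?_, fun h => by simp [h]⟩
  have := mul_le_weight a i
  rw [h] at this
  have h2 : (2 * i + 1) * a i = 0 := by omega
  rcases Nat.mul_eq_zero.1 h2 with h3 | h3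
  · omega
  · exact h3

theorem shiftCoeff_zero (c : ℚ) (F : TimeSeries R) : shiftCoeff c 0 F = F := by
  ext m
  rw [coeff_shiftCoeff, weightSet_zero, Finset.sum_singleton, taylorWeight]
  simp

theorem weight_add_single (a : ℕ →₀ ℕ) (i : ℕ) :
    ((a + Finsupp.single i 1).sum fun i e => (2 * i + 1) * e) =
      (a.sum fun i e => (2 * i + 1) * e) + (2 * i + 1) := by
  rw [Finsupp.sum_add_index' (by simp) (by intros; ring), Finsupp.sum_single_index (by simp)]
  ring

theorem taylorWeight_add_single (c : ℚ) (m a : ℕ →₀ ℕ) (i : ℕ) :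
    ((2 * i + 1) * (a i + 1) : ℚ) * taylorWeight c m (a + Finsupp.single i 1) =
      c * (m i + 1) * taylorWeight c (m + Finsupp.single i 1) a := by
  have h1 : (a.erase i).prod (fun j e => ((m j + e).choose e : ℚ) * (c / (2 * j + 1)) ^ e) =
      (a.erase i).prod (fun j e => (((m + Finsupp.single i 1 : ℕ →₀ ℕ) j + e).choose e : ℚ) *
        (c / (2 * j + 1)) ^ e) := by
    refine Finsupp.prod_congr fun j hj => ?_
    have : j ≠ i := fun h => by
      rw [Finsupp.mem_support_iff, h, Finsupp.erase_same] at hj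
      exact hj rfl
    rw [Finsupp.add_apply, Finsupp.single_eq_of_ne this, add_zero]
  rw [taylorWeight, taylorWeight, ← Finsupp.mul_prod_erase' _ i _ (fun j => by simp),
    ← Finsupp.mul_prod_erase' a i _ (fun j => by simp), ← h1, Finsupp.erase_add,
    Finsupp.erase_single, add_zero]
  simp only [Finsupp.add_apply, Finsupp.single_eq_same]
  set p := (a.erase i).prod (fun j e => ((m j + e).choose e : ℚ) * (c / (2 * j + 1)) ^ e)
  have h2 : ((m i + (a i + 1)).choose (a i + 1) : ℚ) * (a i + 1) =
      (m i + 1) * ((m i + 1 + a i).choose (a i) : ℚ) := by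
    have e1 := Nat.add_one_mul_choose_eq (m i + a i) (a i)
    have e2 := Nat.add_one_mul_choose_eq (m i + a i) (m i)
    have e3 : (m i + 1 + a i).choose (a i) = (m i + a i + 1).choose (m i + 1) := by
      rw [show m i + 1 + a i = m i + a i + 1 by ring]
      exact (Nat.choose_symm_of_eq_add (by ring)).symm
    have e4 : (m i + a i).choose (a i) = (m i + a i).choose (m i) :=
      (Nat.choose_symm_of_eq_add (by ring)).symm
    have e5 : (m i + (a i + 1)).choose (a i + 1) * (a i + 1) =
        (m i + 1) * (m i + 1 + a i).choose (a i) := by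
      rw [e3, ← add_assoc, ← e1, e4, e2]; ring
    exact_mod_cast e5
  have h3 : (2 * i + 1 : ℚ) ≠ 0 := by positivity
  calc _ = (2 * i + 1) * (c / (2 * i + 1)) ^ (a i + 1) *
        (((m i + (a i + 1)).choose (a i + 1) : ℚ) * (a i + 1)) * p := by ring
    _ = _ := by rw [h2, pow_succ]; field_simp

theorem coeff_dt_eq_smul (i : ℕ) (F : TimeSeries R) (m : ℕ →₀ ℕ) :
    MvPowerSeries.coeff m (dt i F) =
      (m i + 1 : ℚ) • MvPowerSeries.coeff (m + Finsupp.single i 1) F := by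
  rw [dt, MvPowerSeries.coeff_pderiv, ← Nat.cast_succ, ← Nat.cast_succ,
    Nat.cast_smul_eq_nsmul, nsmul_eq_mul']

/-- The factor a_i removes the indices with a_i = 0. The others are b + e_i with b of weight n -
(2i+1), and `taylorWeight_add_single` turns their weights into those of ∂_{2i+1} of the shifted
series. -/
theorem sum_weightSet_mul (c : ℚ) (n i : ℕ) (F : TimeSeries R) (m : ℕ →₀ ℕ) :
    ∑ a ∈ weightSet n, ((2 * i + 1) * a i : ℚ) •
        taylorWeight c m a • MvPowerSeries.coeff (m + a) F =
      if 2 * i + 1 ≤ n then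
        c • MvPowerSeries.coeff m (dt i (shiftCoeff c (n - (2 * i + 1)) F)) else 0 := by
  split_ifs with hi
  · rw [coeff_dt_eq_smul, coeff_shiftCoeff, smul_smul, Finset.smul_sum]
    rw [← Finset.sum_filter_of_ne (p := fun a => a i ≠ 0)]
    · symm
      refine Finset.sum_bij (fun a _ => a + Finsupp.single i 1) ?_ ?_ ?_ ?_
      · intro a ha
        rw [mem_weightSet] at ha
        rw [Finset.mem_filter, mem_weightSet, weight_add_single, ha]
        refine ⟨by omega, by simp⟩
      · intro a _ b _ h
        exact add_right_cancel h
      · intro b hb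
        rw [Finset.mem_filter, mem_weightSet] at hb
        have hle : Finsupp.single i 1 ≤ b := by
          rw [Finsupp.single_le_iff]; omega
        refine ⟨b - Finsupp.single i 1, ?_, tsub_add_cancel_of_le hle⟩
        have := weight_add_single (b - Finsupp.single i 1) i
        rw [tsub_add_cancel_of_le hle, hb.1] at this
        rw [mem_weightSet]
        omega
      · intro a _
        have h := taylorWeight_add_single c m a i
        rw [smul_smul, smul_smul, Finsupp.add_apply, Finsupp.single_eq_same]
        push_cast at h ⊢
        rw [h, add_assoc m, add_comm a]
    · intro a _ ha h0
      rw [h0] at ha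
      simp at ha
  · refine Finset.sum_eq_zero fun a ha => ?_
    rw [mem_weightSet] at ha
    have h1 := mul_le_weight a i
    have : a i = 0 := by
      by_contra h0
      have : 1 ≤ a i := by omega
      nlinarith
    rw [this]
    simp

/-- The differential equation in `z` for `F(t + c[z⁻¹])`. -/
theorem nsmul_shiftCoeff (c : ℚ) (n : ℕ) (F : TimeSeries R) :
    n • shiftCoeff c n F = c • ∑ i ∈ Finset.range n,
      if 2 * i + 1 ≤ n then dt i (shiftCoeff c (n - (2 * i + 1)) F) else 0 := by
  ext m
  have h1 : ∀ a ∈ weightSet n, (n : ℚ) • taylorWeight c m a • MvPowerSeries.coeff (m + a) F =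
      ∑ i ∈ Finset.range n, ((2 * i + 1) * a i : ℚ) •
        taylorWeight c m a • MvPowerSeries.coeff (m + a) F := by
    intro a ha
    rw [← Finset.sum_smul]
    congr 1
    rw [mem_weightSet] at ha
    have h2 : (a.sum fun i e => (2 * i + 1) * e) =
        ∑ i ∈ Finset.range n, (2 * i + 1) * a i := by
      refine Finset.sum_subset (fun i hi => ?_) (fun i _ hi => ?_)
      · have h1 := mul_le_weight a i
        rw [Finsupp.mem_support_iff] at hi
        have : 1 ≤ a i := by omega
        rw [Finset.mem_range]
        nlinarith
      · simp [Finsupp.notMem_support_iff.1 hi]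
    rw [← ha, h2]
    push_cast
    rw [← h2, ha]
  rw [map_nsmul, coeff_shiftCoeff, ← Nat.cast_smul_eq_nsmul ℚ, Finset.smul_sum,
    Finset.sum_congr rfl h1, Finset.sum_comm]
  simp only [sum_weightSet_mul]
  have h3 : MvPowerSeries.coeff m (c • ∑ i ∈ Finset.range n,
      if 2 * i + 1 ≤ n then dt i (shiftCoeff c (n - (2 * i + 1)) F) else 0) =
      c • MvPowerSeries.coeff m (∑ i ∈ Finset.range n,
      if 2 * i + 1 ≤ n then dt i (shiftCoeff c (n - (2 * i + 1)) F) else 0) := rfl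
  rw [h3, map_sum, Finset.smul_sum]
  refine Finset.sum_congr rfl fun i _ => ?_
  split_ifs
  · rfl
  · rw [map_zero, smul_zero]

/-- `p` satisfies the differential equation in `z` of the shifts by `c[z⁻¹]`. -/
def IsShift (c : ℚ) (p : PowerSeries (TimeSeries R)) : Prop :=
  ∀ n, n • PowerSeries.coeff n p =
    c • PowerSeries.coeff n (∑ i ∈ Finset.range n, PowerSeries.X ^ (2 * i + 1) * dtSeries i p)

theorem isShift_iff {c : ℚ} {p : PowerSeries (TimeSeries R)} :
    IsShift c p ↔ ∀ n, n • PowerSeries.coeff n p = c • ∑ i ∈ Finset.range n,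
      if 2 * i + 1 ≤ n then dt i (PowerSeries.coeff (n - (2 * i + 1)) p) else 0 := by
  refine forall_congr' fun n => ?_
  rw [map_sum]
  simp only [PowerSeries.coeff_X_pow_mul', dtSeries, PowerSeries.coeff_mk]

theorem isShift_shiftSeries (c : ℚ) (F : TimeSeries R) : IsShift c (shiftSeries c F) := by
  rw [isShift_iff]
  intro n
  simp only [shiftSeries, PowerSeries.coeff_mk]
  exact nsmul_shiftCoeff c n F

/-- For n > 0 the equation expresses n times the n-th coefficient through earlier ones, and n can be
cancelled. Multiplicativity of the shift, its sign rule and its effect on e^ξ are all derived from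
this uniqueness. -/
theorem IsShift.eq_of_constantCoeff {c : ℚ} {p q : PowerSeries (TimeSeries R)} (hp : IsShift c p)
    (hq : IsShift c q) (h : PowerSeries.coeff 0 p = PowerSeries.coeff 0 q) : p = q := by
  have := IsAddTorsionFree.of_module_rat (TimeSeries R)
  rw [isShift_iff] at hp hq
  refine PowerSeries.ext fun n => ?_
  induction n using Nat.strong_induction_on with
  | _ n ih =>
    by_cases hn : n = 0
    · rw [hn, h]
    · refine (smul_right_inj hn).1 ?_
      rw [hp, hq]
      congr 1
      refine Finset.sum_congr rfl fun i _ => ?_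
      split_ifs
      · rw [ih _ (by omega)]
      · rfl

theorem IsShift.coeff_eq {c : ℚ} {p : PowerSeries (TimeSeries R)} (hp : IsShift c p) {n N : ℕ}
    (h : n ≤ N) : n • PowerSeries.coeff n p =
    c • PowerSeries.coeff n (∑ i ∈ Finset.range N, PowerSeries.X ^ (2 * i + 1) * dtSeries i p) := by
  rw [hp n, map_sum, map_sum]
  congr 1
  refine Finset.sum_subset (Finset.range_mono h) fun i _ hi => ?_
  rw [Finset.mem_range] at hi
  rw [PowerSeries.coeff_X_pow_mul', if_neg (by omega)]

/-- Both sides of the equation are derivations in p: z⁻¹ d/dz⁻¹, and c∑ z^{-(2i+1)}∂_{2i+1}. -/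
theorem IsShift.mul {c : ℚ} {p q : PowerSeries (TimeSeries R)} (hp : IsShift c p)
    (hq : IsShift c q) : IsShift c (p * q) := by
  intro n
  have h1 : ∑ i ∈ Finset.range n, PowerSeries.X ^ (2 * i + 1) * dtSeries i (p * q) =
      (∑ i ∈ Finset.range n, PowerSeries.X ^ (2 * i + 1) * dtSeries i p) * q +
      p * ∑ i ∈ Finset.range n, PowerSeries.X ^ (2 * i + 1) * dtSeries i q := by
    rw [Finset.sum_mul, Finset.mul_sum, ← Finset.sum_add_distrib]
    refine Finset.sum_congr rfl fun i _ => ?_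
    rw [dtSeries_mul]; ring
  rw [h1, map_add, PowerSeries.coeff_mul, PowerSeries.coeff_mul, PowerSeries.coeff_mul,
    ← Finset.sum_add_distrib, Finset.smul_sum, Finset.smul_sum]
  refine Finset.sum_congr rfl fun a ha => ?_
  rw [Finset.HasAntidiagonal.mem_antidiagonal] at ha
  rw [smul_add, ← smul_mul_assoc c, ← mul_smul_comm c, ← hp.coeff_eq (by omega : a.1 ≤ n),
    ← hq.coeff_eq (by omega : a.2 ≤ n), ← ha, add_smul, smul_mul_assoc, mul_smul_comm]

theorem shiftSeries_mul (c : ℚ) (F G : TimeSeries R) :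
    shiftSeries c (F * G) = shiftSeries c F * shiftSeries c G := by
  refine (isShift_shiftSeries c _).eq_of_constantCoeff
    ((isShift_shiftSeries c F).mul (isShift_shiftSeries c G)) ?_
  rw [PowerSeries.coeff_mul]
  simp [shiftSeries, shiftCoeff_zero]

theorem shiftSeries_one (c : ℚ) : shiftSeries c (1 : TimeSeries R) = 1 := by
  refine (isShift_shiftSeries c _).eq_of_constantCoeff ?_ ?_
  · rw [isShift_iff]
    intro n
    rw [Finset.sum_eq_zero]
    · rw [PowerSeries.coeff_one, smul_zero]
      split_ifs with h
      · rw [h, zero_smul]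
      · rw [smul_zero]
    · intro i _
      rw [PowerSeries.coeff_one]
      split_ifs
      · exact MvPowerSeries.pderiv_one
      · exact map_zero _
      · rfl
  · simp [shiftSeries, shiftCoeff_zero]

theorem shiftCoeff_ofTimePowerSeries (c : ℚ) (n : ℕ) (p : PowerSeries (TimeSeries R)) :
    shiftCoeff c n (ofTimePowerSeries p) =
      ofTimePowerSeries (PowerSeries.mk fun j => shiftCoeff c n (PowerSeries.coeff j p)) := by
  ext m j
  rw [coeff_shiftCoeff, HahnSeries.coeff_sum, coeff_ofTimePowerSeries, PowerSeries.coeff_mk,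
    coeff_shiftCoeff]
  refine (Finset.sum_congr rfl (g := fun a => taylorWeight c m a •
    (MvPowerSeries.coeff (m + a) (ofTimePowerSeries p)).coeff j) fun a _ => ?_).trans ?_
  · exact coeff_rat_smul (R := R) Algebra.toModule _ _ _
  simp only [coeff_ofTimePowerSeries]
  split_ifs
  · simp
  · rfl

/-- The differential equation contains only odd powers of z⁻¹, so z ↦ -z changes c into -c. -/
theorem neg_shift (c : ℚ) (F : TimeSeries R) : negLam (shift c F) = shift (-c) F := by
  rw [shift_eq, shift_eq, negLam_ofTimePowerSeries]
  congr 1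
  refine IsShift.eq_of_constantCoeff (c := -c) ?_ (isShift_shiftSeries _ F) ?_
  · rw [isShift_iff]
    intro n
    simp only [shiftSeries, PowerSeries.coeff_mk]
    rw [← mul_smul_comm, nsmul_shiftCoeff, mul_smul_comm, neg_smul, ← smul_neg, Finset.mul_sum,
      ← Finset.sum_neg_distrib]
    congr 1
    refine Finset.sum_congr rfl fun i _ => ?_
    split_ifs with h
    · obtain ⟨j, rfl⟩ := Nat.exists_eq_add_of_le h
      rw [Nat.add_sub_cancel_left, pow_add, (by exact ⟨i, rfl⟩ : Odd (2 * i + 1)).neg_one_pow]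
      rcases neg_one_pow_eq_or (TimeSeries R) j with hj | hj <;> rw [hj] <;> simp
    · simp
  · simp [shiftSeries, shiftCoeff_zero]

theorem neg_two_zsmul_eq {M : Type*} [AddCommGroup M] (_ : Module ℚ M) (x : M) :
    (-2 : ℤ) • x = (-2 : ℚ) • x := by
  rw [← Int.cast_smul_eq_zsmul ℚ (-2 : ℤ)]
  norm_num

/-- The coefficients of `(1 - y) / (1 + y)`. -/
def cayleyCoeff (n : ℕ) : ℤ := if n = 0 then 1 else 2 * (-1) ^ n

/-- In generating functions, y/(1-y²) · (1-y)/(1+y) = y/(1+y)². With `mul_cayleyCoeff` it shows that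
(1-λ/z)/(1+λ/z) solves the equation of the shift by -2[z⁻¹]. -/
theorem sum_cayleyCoeff (n : ℕ) :
    (∑ i ∈ Finset.range n, if 2 * i + 1 ≤ n then cayleyCoeff (n - (2 * i + 1)) else 0) =
      -(n * (-1) ^ n) := by
  induction n using Nat.twoStepInduction with
  | zero => simp
  | one => simp [cayleyCoeff]
  | more n ih _ =>
    rw [Finset.sum_range_succ', Finset.sum_range_succ, if_neg (by omega), add_zero]
    have h : ∀ i ∈ Finset.range n, (if 2 * (i + 1) + 1 ≤ n + 2 then
        cayleyCoeff (n + 2 - (2 * (i + 1) + 1)) else 0) =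
        if 2 * i + 1 ≤ n then cayleyCoeff (n - (2 * i + 1)) else 0 := by
      intro i _
      by_cases hi : 2 * i + 1 ≤ n
      · rw [if_pos hi, if_pos (by omega)]; congr 1; omega
      · rw [if_neg hi, if_neg (by omega)]
    rw [Finset.sum_congr rfl h, ih, if_pos (by omega)]
    simp only [mul_zero, zero_add, cayleyCoeff]
    rw [if_neg (by omega), show n + 2 - 1 = n + 1 by omega]
    push_cast
    ring

theorem mul_cayleyCoeff (n : ℕ) : (n : ℤ) * cayleyCoeff n = -2 *
    ∑ i ∈ Finset.range n, if 2 * i + 1 ≤ n then cayleyCoeff (n - (2 * i + 1)) else 0 := by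
  rw [sum_cayleyCoeff, cayleyCoeff]
  split_ifs with h
  · simp [h]
  · ring

/-- `e^{ξ(t - 2[z⁻¹], λ)} = e^{ξ(t,λ)} (1 - λ/z) / (1 + λ/z)`. -/
theorem shiftCoeff_expXi (n : ℕ) : shiftCoeff (-2) n (expXi (k := R)) =
    cayleyCoeff n • (lamPow (n : ℤ) * expXi) := by
  have h : shiftSeries (-2) (expXi (k := R)) =
      PowerSeries.mk fun n => cayleyCoeff n • (lamPow (n : ℤ) * expXi) := by
    refine (isShift_shiftSeries _ _).eq_of_constantCoeff ?_ ?_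
    · rw [isShift_iff]
      intro n
      simp only [PowerSeries.coeff_mk]
      have h1 : ∀ i ∈ Finset.range n, (if 2 * i + 1 ≤ n then dt i (cayleyCoeff (n - (2 * i + 1)) •
          (lamPow ((n - (2 * i + 1) : ℕ) : ℤ) * expXi (k := R))) else 0) =
          (if 2 * i + 1 ≤ n then cayleyCoeff (n - (2 * i + 1)) else 0) •
            (lamPow (n : ℤ) * expXi (k := R)) := by
        intro i _
        split_ifs with hi
        · have h2 : dt i (lamPow ((n - (2 * i + 1) : ℕ) : ℤ) * expXi (k := R)) =
              lamPow (n : ℤ) * expXi := by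
            have h3 : dt i (lamPow ((n - (2 * i + 1) : ℕ) : ℤ) * expXi (k := R)) =
                lamPow ((n - (2 * i + 1) : ℕ) : ℤ) * dt i expXi := by
              have := dt_const i (HahnSeries.single (-((n - (2 * i + 1) : ℕ) : ℤ)) (1 : R))
              rw [dt] at this
              rw [dt, Derivation.leibniz, this]
              simp
            rw [h3, dt_expXi, ← mul_assoc, lamPow_mul_lamPow]
            congr 2
            omega
          rw [← h2]
          exact map_zsmul (MvPowerSeries.pderiv (LaurentSeries R) i) _ _
        · rw [zero_smul]
      rw [Finset.sum_congr rfl h1, ← Finset.sum_smul, ← natCast_zsmul, smul_smul,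
        mul_cayleyCoeff, mul_smul]
      set X := (∑ i ∈ Finset.range n, if 2 * i + 1 ≤ n then cayleyCoeff (n - (2 * i + 1)) else 0) •
        (lamPow (n : ℤ) * expXi (k := R))
      exact neg_two_zsmul_eq Algebra.toModule X
    · simp [shiftSeries, shiftCoeff_zero, cayleyCoeff, lamPow]
  have := congrArg (PowerSeries.coeff n) h
  simpa [shiftSeries] using this

end Shift

/-! ### The residue computation and the closed form of the potentials. -/

section Potential
open Finset.HasAntidiagonal (antidiagonal)
variable {k : Type*} [CommRing k] {L W : PDO k}

theorem IsBKP.ordLE_dressing (h : IsBKP L W) : OrdLE W 0 := h.dressing_form.2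

theorem coeff_powerSymbol (P : PDO k) (n : ℕ) :
    PowerSeries.coeff n (powerSymbol P) = P.coeff (-(n : ℤ)) := PowerSeries.coeff_mk _ _

theorem IsBKP.ordLE_potential (h : IsBKP L W) (Φ : TimeSeries k) : OrdLE (potential W Φ) 0 :=
  ((ordLE_dpow (-1)).mul (((ordLE_dpow 1).mul h.ordLE_dressing).smul Φ)).mono (by omega)

theorem IsBKP.coeff_zero_potential (h : IsBKP L W) (Φ : TimeSeries k) :
    (potential W Φ).coeff 0 = Φ := by
  rw [potential, coeff_dpow_mul (((ordLE_dpow 1).mul h.ordLE_dressing).smul Φ) (-1) 0 1 (by simp)]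
  simp [coeff_dpow_one_mul, h.dressing_form.1, h.dressing_form.2]

/-- The double series in the residue computation, with the summation rearranged. -/
theorem sum_cayleyCoeff_antidiagonal (n : ℕ) (s : ℕ → ℕ → TimeSeries k) (p : ℕ → TimeSeries k) :
    ∑ x ∈ antidiagonal n, cayleyCoeff x.2 • ∑ a ∈ antidiagonal x.2,
        s x.1 a.1 * ((-1) ^ a.2 * p a.2) =
      2 * (∑ y ∈ antidiagonal n, p y.1 *
        ∑ b ∈ antidiagonal y.2, (-1) ^ b.2 * s b.1 b.2) - s n 0 * p 0 := by
  -- The constant coefficient of 2/(1+y) - 1 is 1 = 2 - 1, whence the correction at (n, 0).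
  -- Elsewhere the sign (-1)^{a₁+a₂}(-1)^{a₂} is (-1)^{a₁}, which moves the alternation from p to s.
  have h1 : ∀ x ∈ antidiagonal n, cayleyCoeff x.2 • ∑ a ∈ antidiagonal x.2,
      s x.1 a.1 * ((-1) ^ a.2 * p a.2) =
      2 * (∑ a ∈ antidiagonal x.2, p a.2 * ((-1) ^ a.1 * s x.1 a.1)) -
        if x = (n, 0) then s n 0 * p 0 else 0 := by
    rintro ⟨i, j⟩ hx
    rw [Finset.HasAntidiagonal.mem_antidiagonal] at hx
    by_cases hj : j = 0
    · subst hj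
      simp only [add_zero] at hx
      subst hx
      simp [cayleyCoeff]
      ring
    · rw [if_neg (by simp [hj]), sub_zero, cayleyCoeff, if_neg hj, Finset.smul_sum, Finset.mul_sum]
      refine Finset.sum_congr rfl fun a ha => ?_
      rw [Finset.HasAntidiagonal.mem_antidiagonal] at ha
      simp only at ha
      rw [← ha, pow_add, zsmul_eq_mul]
      push_cast
      have : ((-1 : TimeSeries k) ^ a.2) * (-1) ^ a.2 = 1 := by
        rw [← mul_pow]; simp
      linear_combination (2 * (-1) ^ a.1 * s i a.1 * p a.2) * this
  rw [Finset.sum_congr rfl h1, Finset.sum_sub_distrib, Finset.sum_ite_eq', if_pos (by simp),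
    ← Finset.mul_sum]
  congr 2
  simp only [Finset.mul_sum]
  rw [Finset.sum_sigma', Finset.sum_sigma']
  refine Finset.sum_nbij' (fun x => ⟨(x.2.2, x.1.1 + x.2.1), (x.1.1, x.2.1)⟩)
    (fun y => ⟨(y.2.1, y.2.2 + y.1.1), (y.2.2, y.1.1)⟩) ?_ ?_ ?_ ?_ ?_
  · rintro ⟨⟨i, j⟩, ⟨b, a⟩⟩ hx
    simp only [Finset.mem_sigma, Finset.HasAntidiagonal.mem_antidiagonal] at hx ⊢
    exact ⟨by omega, trivial⟩
  · rintro ⟨⟨i, j⟩, ⟨b, a⟩⟩ hx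
    simp only [Finset.mem_sigma, Finset.HasAntidiagonal.mem_antidiagonal] at hx ⊢
    exact ⟨by omega, trivial⟩
  · rintro ⟨⟨i, j⟩, ⟨b, a⟩⟩ hx
    simp only [Finset.mem_sigma, Finset.HasAntidiagonal.mem_antidiagonal] at hx ⊢
    rw [hx.2]
  · rintro ⟨⟨i, j⟩, ⟨b, a⟩⟩ hx
    simp only [Finset.mem_sigma, Finset.HasAntidiagonal.mem_antidiagonal] at hx ⊢
    rw [hx.2]
  · rintro ⟨⟨i, j⟩, ⟨b, a⟩⟩ _
    rfl

theorem coeff_mul_rat_smul [Module ℚ k] (inst : Module ℚ (LaurentSeries k)) (r : ℚ)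
    (y x : LaurentSeries k) (j : ℤ) :
    (y * inst.toSMul.smul r x).coeff j = r • (y * x).coeff j :=
  @map_rat_smul _ _ _ _ inst _ _ _ _ ((HahnSeries.coeff.addMonoidHom (Γ := ℤ) (R := k) j).comp
    (AddMonoidHom.mulLeft y)) r x

end Potential

section Potential
open Finset.HasAntidiagonal (antidiagonal)
variable {k : Type*} [CommRing k] [Algebra ℚ k] {L W : PDO k}

/-- The pairing of φ(t') with ψ(t) does not depend on t', so shifting t affects ψ alone, and t' = t
may be set afterwards. -/
theorem IsBKP.shiftCoeff_ct (h : IsBKP L W) {φ : TimeSeries (LaurentSeries k)}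
    (hφ : ∀ n, Orth W (dt n φ)) (c : ℚ) (n : ℕ) :
    shiftCoeff c n (ct (ba W * φ)) = ct (shiftCoeff c n (ba W) * φ) := by
  classical
  have h1 : ∀ m m', (MvPowerSeries.coeff m' φ *
      MvPowerSeries.coeff m (shiftCoeff c n (ba W))).coeff 0 =
      if m' = 0 then MvPowerSeries.coeff m (shiftCoeff c n (ct (ba W * φ))) else 0 := by
    intro m m'
    rw [coeff_shiftCoeff, coeff_shiftCoeff, Finset.mul_sum, HahnSeries.coeff_sum]
    refine (Finset.sum_congr rfl (g := fun a => taylorWeight c m a •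
      if m' = 0 then MvPowerSeries.coeff (m + a) (ct (ba W * φ)) else 0) fun a _ => ?_).trans ?_
    · rw [← h.coeff_mul_coeff hφ]
      exact coeff_mul_rat_smul (k := k) Algebra.toModule _ _ _ _
    · split_ifs <;> simp
  ext m
  rw [coeff_ct, mul_comm (shiftCoeff c n (ba W)) φ, MvPowerSeries.coeff_mul,
    HahnSeries.coeff_sum, Finset.sum_eq_single (0, m)]
  · rw [h1, if_pos rfl]
  · rintro ⟨a, b⟩ hab hne
    rw [h1, if_neg]
    intro ha
    refine hne ?_
    rw [Finset.HasAntidiagonal.mem_antidiagonal] at hab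
    simp only at ha hab
    rw [ha, zero_add] at hab
    rw [ha, hab]
  · intro hn; exact absurd (Finset.HasAntidiagonal.mem_antidiagonal.2 (zero_add m)) hn

/-- The exponentials cancel, so this reads off the λ^{-j} coefficient of a product of two power
series in λ⁻¹. -/
theorem ct_lamPow_mul_mul_negLam_wave {P : PDO k} (hP : OrdLE P 0) (j : ℕ)
    (q : PowerSeries (TimeSeries k)) :
    ct (ofTimePowerSeries q * (lamPow (j : ℤ) * expXi) * negLam (wave P)) =
      ∑ a ∈ antidiagonal j,
        PowerSeries.coeff a.1 q * ((-1) ^ a.2 * P.coeff (-(a.2 : ℤ))) := by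
  rw [wave_apply, map_mul negLam, ← ofTimePowerSeries_powerSymbol hP, negLam_ofTimePowerSeries]
  set p := PowerSeries.mk fun n => (-1) ^ n * PowerSeries.coeff n (powerSymbol P) with hp
  have h1 : ofTimePowerSeries q * (lamPow (j : ℤ) * expXi) *
      (ofTimePowerSeries p * negLam expXi) =
      lamPow (j : ℤ) * ofTimePowerSeries (q * p) := by
    rw [map_mul ofTimePowerSeries]
    calc _ = lamPow (j : ℤ) * (ofTimePowerSeries q * ofTimePowerSeries p) *
          (expXi * negLam expXi) := by ring
      _ = _ := by rw [expXi_mul_negLam, mul_one]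
  rw [h1, ct_lamPow_mul_ofTimePowerSeries, PowerSeries.coeff_mul]
  simp only [hp, PowerSeries.coeff_mk, coeff_powerSymbol]

theorem IsBKP.ct_ba_mul_negLam_wave (h : IsBKP L W) {P : PDO k} (hP : OrdLE P 0) :
    ct (ba W * negLam (wave P)) = P.coeff 0 := by
  have h1 := ct_lamPow_mul_mul_negLam_wave hP 0 (powerSymbol W)
  rw [ofTimePowerSeries_powerSymbol h.ordLE_dressing] at h1
  have h2 : (lamPow ((0 : ℕ) : ℤ) : TimeSeries (LaurentSeries k)) = 1 := by
    simp [lamPow]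
  rw [h2, one_mul] at h1
  rw [ba, h1]
  simp [coeff_powerSymbol, h.dressing_form.1]

/-- `w(t - 2[z⁻¹], -z)` as a power series in `z⁻¹`. -/
noncomputable def shiftedDressing (W : PDO k) : PowerSeries (TimeSeries k) :=
  PowerSeries.mk fun n => ∑ b ∈ antidiagonal n,
    (-1) ^ b.2 * shiftCoeff (-2) b.1 (W.coeff (-(b.2 : ℤ)))

/-- Shift t in P.coeff 0 = ct(ψφ), with φ = `negLam (wave P)`. The shifted ψ is
w(t-2[z⁻¹],λ)e^ξ(2/(1+λ/z) - 1). The geometric series 1/(1+λ/z) evaluates the other factors at λ =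
-z, and the term -1 contributes -P.coeff 0. -/
theorem IsBKP.shiftSeries_eq (h : IsBKP L W) {P : PDO k} (hP : OrdLE P 0)
    (hφ : ∀ n, Orth W (dt n (negLam (wave P)))) :
    shiftSeries (-2) (P.coeff 0) =
      2 * (powerSymbol P * shiftedDressing W) - PowerSeries.C (P.coeff 0) := by
  ext1 n
  have h1 : shiftCoeff (-2) n (ba W) = ∑ x ∈ antidiagonal n,
      ofTimePowerSeries (PowerSeries.mk fun j => shiftCoeff (-2) x.1 (W.coeff (-(j : ℤ)))) *
        cayleyCoeff x.2 • (lamPow (x.2 : ℤ) * expXi) := by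
    have h2 := congrArg (PowerSeries.coeff n) (shiftSeries_mul (-2) (symbol W) expXi)
    rw [PowerSeries.coeff_mul] at h2
    simp only [shiftSeries, PowerSeries.coeff_mk, shiftCoeff_expXi] at h2
    rw [ba, h2]
    refine Finset.sum_congr rfl fun x _ => ?_
    rw [← ofTimePowerSeries_powerSymbol h.ordLE_dressing, shiftCoeff_ofTimePowerSeries]
    simp only [coeff_powerSymbol]
  have h3 := h.shiftCoeff_ct hφ (-2) n
  rw [h.ct_ba_mul_negLam_wave hP, h1, Finset.sum_mul, map_sum] at h3
  have h4 : ∀ x ∈ antidiagonal n, ct (ofTimePowerSeries (PowerSeries.mk fun j =>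
      shiftCoeff (-2) x.1 (W.coeff (-(j : ℤ)))) * cayleyCoeff x.2 • (lamPow (x.2 : ℤ) * expXi) *
      negLam (wave P)) = cayleyCoeff x.2 • ∑ a ∈ antidiagonal x.2,
        shiftCoeff (-2) x.1 (W.coeff (-(a.1 : ℤ))) * ((-1) ^ a.2 * P.coeff (-(a.2 : ℤ))) := by
    intro x _
    rw [mul_smul_comm, smul_mul_assoc, map_zsmul, ct_lamPow_mul_mul_negLam_wave hP]
    simp only [PowerSeries.coeff_mk]
  rw [Finset.sum_congr rfl h4, sum_cayleyCoeff_antidiagonal n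
    (fun i b => shiftCoeff (-2) i (W.coeff (-(b : ℤ)))) (fun a => P.coeff (-(a : ℤ)))] at h3
  have h5 : shiftCoeff (-2) n (W.coeff (-((0 : ℕ) : ℤ))) = if n = 0 then 1 else 0 := by
    have := congrArg (PowerSeries.coeff n) (shiftSeries_one (R := k) (-2))
    rw [PowerSeries.coeff_one, shiftSeries, PowerSeries.coeff_mk] at this
    rw [← this, Nat.cast_zero, neg_zero, h.dressing_form.1]
  rw [shiftSeries, PowerSeries.coeff_mk, h3, map_sub, h5, PowerSeries.coeff_C, two_mul, two_mul,
    map_add, PowerSeries.coeff_mul]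
  simp only [coeff_powerSymbol, shiftedDressing, PowerSeries.coeff_mk]
  congr 1
  split_ifs <;> simp

/-- The residue formula for P = W, whose leading coefficient 1 is invariant under shifts, reads 1 =
2wv - 1. -/
theorem IsBKP.powerSymbol_mul_shiftedDressing (h : IsBKP L W) :
    powerSymbol W * shiftedDressing W = 1 := by
  have h1 := h.shiftSeries_eq h.ordLE_dressing fun n => by
    rw [← ba_eq_wave, ← baNeg_eq]; exact h.orth_dt_baNeg n
  rw [h.dressing_form.1, shiftSeries_one, map_one, eq_sub_iff_add_eq, one_add_one_eq_two] at h1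
  have h2 : (2 : ℚ) • (powerSymbol W * shiftedDressing W - 1) = 0 := by
    rw [ofNat_smul_eq_nsmul, two_nsmul]
    linear_combination -h1
  rw [smul_eq_zero_iff_right (by norm_num)] at h2
  exact sub_eq_zero.1 h2

/-- The residue formula for a function of the spectral parameter with orthogonal derivatives. -/
theorem IsBKP.two_mul_wave (h : IsBKP L W) {P : PDO k} (hP : OrdLE P 0)
    (hφ : ∀ n, Orth W (dt n (negLam (wave P)))) :
    wave P + wave P = ba W * (shift (-2) (P.coeff 0) + indepOfLam (P.coeff 0)) := by
  have h1 : powerSymbol P + powerSymbol P =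
      powerSymbol W * (shiftSeries (-2) (P.coeff 0) + PowerSeries.C (P.coeff 0)) := by
    rw [h.shiftSeries_eq hP hφ]
    linear_combination (-2 * powerSymbol P) * h.powerSymbol_mul_shiftedDressing
  have h2 := congrArg ofTimePowerSeries h1
  rw [map_add, map_mul, map_add, ofTimePowerSeries_C, ← shift_eq,
    ofTimePowerSeries_powerSymbol hP, ofTimePowerSeries_powerSymbol h.ordLE_dressing] at h2
  rw [wave_apply, ← add_mul, h2, ba]
  ring

theorem IsBKP.isSEP_negLam_potential (h : IsBKP L W) {Φ : TimeSeries k}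
    (hΦ : IsEigenfunction L Φ) :
    IsSEP (BKP.lax₁ L) (BKP.indepOfLam Φ) (dx (baNeg W)) (negLam (wave (potential W Φ))) := by
  have := (h.isSEP_potential hΦ).map negVarHom
  rwa [baseChange_negVarHom_lax₁, map_dt, ← baNeg_eq,
    show MvPowerSeries.map negVarHom (BKP.indepOfLam Φ) = BKP.indepOfLam Φ from
      negLam_indepOfLam Φ] at this

theorem IsBKP.orth_dt_potential (h : IsBKP L W) {Φ : TimeSeries k} (hΦ : IsEigenfunction L Φ)
    (n : ℕ) : Orth W (dt n (negLam (wave (potential W Φ)))) := by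
  rw [isSEP_iff.1 (h.isSEP_negLam_potential hΦ) n]
  exact h.orth_dx_baNeg.omega h n Φ

theorem IsBKP.two_mul_potential (h : IsBKP L W) {Φ : TimeSeries k} (hΦ : IsEigenfunction L Φ) :
    wave (potential W Φ) + wave (potential W Φ) = ba W * (shift (-2) Φ + indepOfLam Φ) := by
  have := h.two_mul_wave (h.ordLE_potential Φ) (h.orth_dt_potential hΦ)
  rwa [h.coeff_zero_potential] at this

theorem IsBKP.isNormalized_potential (h : IsBKP L W) (Φ : TimeSeries k) :
    IsNormalized Φ (negLam (wave (potential W Φ))) := by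
  refine ⟨negLam (symbol (potential W Φ)), ?_, fun m => ⟨fun n hn => ?_, ?_⟩⟩
  · rw [wave_apply, map_mul, mul_comm]; rfl
  · rw [negLam, MvPowerSeries.coeff_map, coeff_negVarHom, coeff_symbol,
      h.ordLE_potential Φ _ (by omega), map_zero, smul_zero]
  · rw [negLam, MvPowerSeries.coeff_map, coeff_negVarHom, coeff_symbol, neg_zero,
      h.coeff_zero_potential]
    simp

/-- Two normalized potentials give G - H = c e^ξ with no nonnegative powers of λ on the left. On the
right, the coefficient of x^N is c λ^N/N!, which would bring every coefficient of c into that range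
for N large. -/
theorem IsNormalized.const_eq_zero {Φ : TimeSeries k} {S T : TimeSeries (LaurentSeries k)}
    (hS : IsNormalized Φ S) (hT : IsNormalized Φ T) {c : LaurentSeries k}
    (h : S = T + const c) : c = 0 := by
  obtain ⟨G, hG, hG2⟩ := hS
  obtain ⟨H, hH, hH2⟩ := hT
  have h1 : G - H = const c * expXi := by
    have h2 : expXi * (negLam expXi * (G - H)) = expXi * const c := by
      rw [mul_sub]
      change expXi * (mapCoeff negVar expXi * G - mapCoeff negVar expXi * H) = _
      rw [← hG, ← hH, h, add_sub_cancel_left]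
    rw [← mul_assoc, expXi_mul_negLam, one_mul] at h2
    rw [h2, mul_comm]
  ext N
  -- At x^{|N|} the coefficient with index N - |N| ≤ 0 equals c_N/|N|! on the right, while G and H
  -- agree there.
  have h2 := congrArg (fun f => (MvPowerSeries.coeff (Finsupp.single 0 N.natAbs) f).coeff
    (N - N.natAbs)) h1
  simp only [map_sub, HahnSeries.coeff_sub] at h2
  have h3 : (MvPowerSeries.coeff (Finsupp.single 0 N.natAbs) G).coeff (N - N.natAbs) =
      (MvPowerSeries.coeff (Finsupp.single 0 N.natAbs) H).coeff (N - N.natAbs) := by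
    rcases lt_or_eq_of_le (show N - N.natAbs ≤ 0 by omega) with h4 | h4
    · rw [(hG2 _).1 _ h4, (hH2 _).1 _ h4]
    · rw [h4, (hG2 _).2, (hH2 _).2]
  rw [h3, sub_self, MvPowerSeries.coeff_C_mul] at h2
  change 0 = (c * HahnSeries.single _ _).coeff _ at h2
  rw [HahnSeries.coeff_mul_single, Finsupp.sum_single_index (by simp),
    Finsupp.prod_single_index (by simp)] at h2
  simp only [Nat.cast_zero, mul_zero, zero_add, one_mul, sub_neg_eq_add, sub_add_cancel] at h2
  have h5 : IsUnit (algebraMap ℚ k (1 / (N.natAbs.factorial : ℚ))) :=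
    IsUnit.map _ (IsUnit.mk0 _ (by positivity))
  exact (h5.mul_left_eq_zero.1 h2.symm)

theorem isSEP_iff_exists_const {R : Type*} [CommRing R] [Algebra ℚ R] {L : PDO R}
    {Φ Ψ S₀ : TimeSeries R} (h : IsSEP L Φ Ψ S₀) (S : TimeSeries R) :
    IsSEP L Φ Ψ S ↔ ∃ c, S = S₀ + const c := by
  constructor
  · intro hS
    refine ⟨MvPowerSeries.constantCoeff (S - S₀), ?_⟩
    rw [← eq_const_of_dt_eq_zero (f := S - S₀), add_sub_cancel]
    intro n
    rw [dt, map_sub]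
    exact sub_eq_zero.2 ((hS n).trans (h n).symm)
  · rintro ⟨c, rfl⟩ n
    have h1 : dt n (S₀ + const c) = dt n S₀ := by
      have := dt_const n c
      rw [dt] at this ⊢
      rw [map_add, this, add_zero]
    rw [h1]
    exact h n

theorem eq_half_smul {M : Type*} [AddCommGroup M] (_ : Module ℚ M) {x y : M} (h : y + y = x) :
    y = (1 / 2 : ℚ) • x := by
  rw [← h, ← two_smul ℚ, smul_smul]
  norm_num

end Potential

/-! ### Integration functionals as pairings that commute with the flows in t. -/

section Pair
variable {k S : Type*} [CommRing k] [CommRing S]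

/-- The pairing of series in two sets of times that is induced by an additive functional on the
coefficients. -/
noncomputable def pair (ℓ : S →+ k) (Θ : TimeSeries S) :
    TimeSeries S →+ TimeSeries (TimeSeries k) where
  toFun F := fun m m' => ℓ (MvPowerSeries.coeff m' Θ * MvPowerSeries.coeff m F)
  map_zero' := by
    refine funext fun m => funext fun m' => ?_
    rw [map_zero, mul_zero, map_zero]; rfl
  map_add' F G := by
    refine funext fun m => funext fun m' => ?_
    rw [map_add, mul_add, map_add]; rfl

theorem coeff_pair (ℓ : S →+ k) (Θ F : TimeSeries S) (m m' : ℕ →₀ ℕ) :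
    MvPowerSeries.coeff m' (MvPowerSeries.coeff m (pair ℓ Θ F)) =
      ℓ (MvPowerSeries.coeff m' Θ * MvPowerSeries.coeff m F) := rfl

theorem pair_dt (ℓ : S →+ k) (Θ F : TimeSeries S) (n : ℕ) :
    pair ℓ Θ (dt n F) = dt n (pair ℓ Θ F) := by
  ext m m'
  rw [coeff_pair, dt, dt, MvPowerSeries.coeff_pderiv, MvPowerSeries.coeff_pderiv, ← Nat.cast_succ,
    ← Nat.cast_succ, ← nsmul_eq_mul', ← nsmul_eq_mul', map_nsmul, coeff_pair, mul_smul_comm,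
    map_nsmul]

theorem pair_iterate_dx (ℓ : S →+ k) (Θ F : TimeSeries S) (i : ℕ) :
    pair ℓ Θ ((dx^[i]) F) = (dx^[i]) (pair ℓ Θ F) := by
  induction i with
  | zero => rfl
  | succ i ih => rw [Function.iterate_succ_apply', Function.iterate_succ_apply', dx, pair_dt, ih]

theorem pair_mul_map (ℓ : S →+ k) (g : k →+* S) (hg : ∀ x c, ℓ (x * g c) = ℓ x * c)
    (Θ F : TimeSeries S) (f : TimeSeries k) :
    pair ℓ Θ (F * MvPowerSeries.map g f) = pair ℓ Θ F * indepOfPrime f := by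
  classical
  ext m m'
  rw [coeff_pair, MvPowerSeries.coeff_mul, MvPowerSeries.coeff_mul, Finset.mul_sum, map_sum,
    map_sum]
  refine Finset.sum_congr rfl fun p _ => ?_
  rw [indepOfPrime, MvPowerSeries.coeff_map, MvPowerSeries.coeff_map, MvPowerSeries.coeff_mul_C,
    coeff_pair, ← mul_assoc, hg]

/-- Fubini for products of a function of μ and a function of λ: a double integral of such a product
is the product of the two integrals. -/
theorem pair_map_mul_map {S₁ S₂ : Type*} [CommRing S₁] [CommRing S₂] {ℓ : S →+ k} {ℓ₁ : S₁ →+ k}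
    {ℓ₂ : S₂ →+ k} {g₁ : S₁ →+* S} {g₂ : S₂ →+* S}
    (h : ∀ x y, ℓ (g₁ x * g₂ y) = ℓ₁ x * ℓ₂ y) (θ₁ F₁ : TimeSeries S₁) (θ₂ F₂ : TimeSeries S₂) :
    pair ℓ (MvPowerSeries.map g₁ θ₁ * MvPowerSeries.map g₂ θ₂)
        (MvPowerSeries.map g₁ F₁ * MvPowerSeries.map g₂ F₂) =
      pair ℓ₁ θ₁ F₁ * pair ℓ₂ θ₂ F₂ := by
  classical
  ext m m'
  rw [coeff_pair, MvPowerSeries.coeff_mul, MvPowerSeries.coeff_mul, Finset.sum_mul_sum, map_sum,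
    MvPowerSeries.coeff_mul, map_sum]
  simp only [map_sum, MvPowerSeries.coeff_mul, MvPowerSeries.coeff_map]
  rw [Finset.sum_comm]
  refine Finset.sum_congr rfl fun p _ => Finset.sum_congr rfl fun q _ => ?_
  rw [coeff_pair, coeff_pair, ← h, map_mul g₁, map_mul g₂, mul_mul_mul_comm]

theorem pair_bires {S₁ S₂ : Type*} [CommRing S₁] [CommRing S₂] {ℓ : S →+ k} {ℓ₁ : S₁ →+ k}
    {ℓ₂ : S₂ →+ k} {g₁ : S₁ →+* S} {g₂ : S₂ →+* S}
    (h : ∀ x y, ℓ (g₁ x * g₂ y) = ℓ₁ x * ℓ₂ y) (i : ℕ) (θ₁ F₁ : TimeSeries S₁)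
    (θ₂ F₂ : TimeSeries S₂) :
    pair ℓ (MvPowerSeries.map g₁ θ₁ * MvPowerSeries.map g₂ θ₂)
        (bires i (MvPowerSeries.map g₂ F₂) (MvPowerSeries.map g₁ F₁)) =
      bires i (pair ℓ₂ θ₂ F₂) (pair ℓ₁ θ₁ F₁) := by
  induction i generalizing F₂ with
  | zero => exact map_zero _
  | succ i ih =>
    rw [bires, bires, map_sub, ← map_iterate_dx, mul_comm (MvPowerSeries.map g₂ F₂),
      pair_map_mul_map h, dx, ← map_dt, ih, pair_dt, pair_iterate_dx, mul_comm]

end Pair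

/-! ### Spectral integrals as instances of the pairing. -/

section SpectralIntegral
variable {k : Type*} [CommRing k]

/-- The constant term of a Laurent series. -/
noncomputable abbrev constTerm : LaurentSeries k →+ k :=
  HahnSeries.coeff.addMonoidHom (Γ := ℤ) (R := k) 0

theorem spectralIntegral_eq (φ F : TimeSeries (LaurentSeries k)) :
    spectralIntegral φ F = pair constTerm φ F := by
  refine funext fun m => funext fun m' => ?_
  rw [spectralIntegral, mul_assoc, integral_lamInv_mul]; rfl

/-- `inMu` as a ring homomorphism. -/
noncomputable def inMuHom : LaurentSeries k →+* LaurentSeries (LaurentSeries k) where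
  toFun := inMu
  map_one' := by
    ext1; funext n
    change HahnSeries.C ((1 : LaurentSeries k).coeff n) = _
    rw [HahnSeries.coeff_one, HahnSeries.coeff_one]
    split_ifs <;> simp
  map_mul' x y := HahnSeries.map_mul (HahnSeries.C : k →+* LaurentSeries k).toNonUnitalRingHom
  map_zero' := by
    ext1; funext n
    exact map_zero HahnSeries.C
  map_add' x y := HahnSeries.map_add (HahnSeries.C : k →+* LaurentSeries k).toAddMonoidHom

theorem constTerm_mul_C (x : LaurentSeries k) (c : k) :
    constTerm (x * HahnSeries.C c) = constTerm x * c := by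
  rw [mul_comm, HahnSeries.C_mul_eq_smul, mul_comm]; rfl

theorem constTerm_inMuHom_mul_C (x y : LaurentSeries k) :
    constTerm (constTerm (inMuHom x * HahnSeries.C y)) = constTerm x * constTerm y := by
  rw [constTerm_mul_C, mul_comm, mul_comm (constTerm x)]
  exact constTerm_mul_C _ _

theorem doubleSpectralIntegral_eq (φ₁ φ₂ : TimeSeries (LaurentSeries k))
    (F : TimeSeries (LaurentSeries (LaurentSeries k))) :
    doubleSpectralIntegral φ₁ φ₂ F = pair (constTerm.comp constTerm)
      (MvPowerSeries.map inMuHom φ₁ * MvPowerSeries.map HahnSeries.C φ₂) F := by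
  refine funext fun m => funext fun m' => ?_
  have h1 : inMu (lamInv : LaurentSeries k) = lamInv := by
    ext1; funext n
    change HahnSeries.C (HahnSeries.coeff lamInv n) = _
    rw [lamInv, lamInv, HahnSeries.coeff_single, HahnSeries.coeff_single]
    split_ifs <;> simp
  rw [doubleSpectralIntegral, h1, mul_assoc, mul_assoc]
  have h2 : ∀ x : LaurentSeries (LaurentSeries k),
      integral (inLam lamInv * x) = lamInv * integral x := fun x => by
    rw [inLam, HahnSeries.C_mul_eq_smul]; rfl
  rw [h2, integral_lamInv_mul, integral_lamInv_mul]
  rfl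

end SpectralIntegral

/-! ### The formulas for the squared eigenfunction potentials. -/

section Main
variable {k : Type*} [CommRing k] [Algebra ℚ k] {L W : PDO k}

/-- T need not factor, but its time derivatives are sums of products of derivatives of ψ(t,μ) and of
ψ(t,λ)_x times coefficients of B. The pairing commutes with ∂_{2n+1} and splits on such products,
and the spectral densities replace each ψ by Φ₁ or Φ₂. -/
theorem IsSEP.doubleSpectralIntegral {T : TimeSeries (LaurentSeries (LaurentSeries k))}
    (hT : IsSEP (lax₂ L) (mapCoeff inMu (ba W)) (dx (mapCoeff inLam (ba W))) T)
    {Φ₁ Φ₂ : TimeSeries k} {φ₁ φ₂ : TimeSeries (LaurentSeries k)}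
    (h₁ : IsSpectralDensity W Φ₁ φ₁) (h₂ : IsSpectralDensity W Φ₂ φ₂) :
    IsSEP (baseChange MvPowerSeries.C L) (indepOfPrime Φ₁) (dx (indepOfPrime Φ₂))
      (doubleSpectralIntegral φ₁ φ₂ T) := by
  rw [isSEP_iff] at hT ⊢
  intro n
  obtain ⟨K, hK⟩ := (B L n).exists_ordLE_natCast
  rw [doubleSpectralIntegral_eq, ← pair_dt, hT n, lax₂, BKP.lax₁, ← baseChange_B, ← baseChange_B,
    ← baseChange_B,
    omega_eq_sum (fun i hi => by rw [coeff_baseChange, coeff_baseChange, isDiff_B n i hi,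
      map_zero, map_zero]) ((hK.baseChange _).baseChange _),
    omega_eq_sum (fun i hi => by rw [coeff_baseChange, isDiff_B n i hi, map_zero])
      (hK.baseChange _), map_sum]
  refine Finset.sum_congr rfl fun i _ => ?_
  have h3 : dx (mapCoeff inLam (ba W)) *
      (baseChange HahnSeries.C (baseChange HahnSeries.C (B L n))).coeff i =
      MvPowerSeries.map HahnSeries.C (dx (ba W) *
        MvPowerSeries.map HahnSeries.C ((B L n).coeff i)) := by
    rw [map_mul, map_dt]; rfl
  have h4 : mapCoeff inMu (ba W) = MvPowerSeries.map inMuHom (ba W) := rfl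
  rw [h3, h4, pair_bires constTerm_inMuHom_mul_C, pair_mul_map _ _ constTerm_mul_C, dx, pair_dt,
    ← spectralIntegral_eq, ← spectralIntegral_eq, ← h₁, ← h₂]
  rfl

theorem IsBKP.negLam_wave_potential (h : IsBKP L W) {Φ : TimeSeries k} (hΦ : IsEigenfunction L Φ) :
    negLam (wave (potential W Φ)) =
      (1 / 2 : ℚ) • (baNeg W * (shift 2 Φ + indepOfLam Φ)) := by
  have h1 := congrArg negLam (h.two_mul_potential hΦ)
  rw [map_add, map_mul, map_add, neg_shift, neg_neg, negLam_indepOfLam, ← baNeg_eq] at h1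
  exact eq_half_smul Algebra.toModule h1

theorem IsBKP.isSEP_half_smul (h : IsBKP L W) {Φ : TimeSeries k} (hΦ : IsEigenfunction L Φ) :
    IsSEP (BKP.lax₁ L) (ba W) (dx (BKP.indepOfLam Φ))
      ((1 / 2 : ℚ) • (ba W * (BKP.indepOfLam Φ - shift (-2) Φ))) := by
  have h2 : BKP.indepOfLam Φ * ba W - wave (potential W Φ) +
      (BKP.indepOfLam Φ * ba W - wave (potential W Φ)) =
      ba W * (BKP.indepOfLam Φ - shift (-2) Φ) := by
    linear_combination -h.two_mul_potential hΦ
  have h1 : BKP.indepOfLam Φ * ba W - wave (potential W Φ) =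
      (1 / 2 : ℚ) • (ba W * (BKP.indepOfLam Φ - shift (-2) Φ)) :=
    eq_half_smul Algebra.toModule h2
  rw [← h1]
  exact h.isSEP_sub_potential hΦ

theorem expXi_laurent : expXi (k := LaurentSeries k) = mapCoeff inMu expXi := by
  refine funext fun m => ?_
  ext1; funext n
  have h : ∀ q : ℚ, algebraMap ℚ (LaurentSeries k) q = HahnSeries.C (algebraMap ℚ k q) :=
    fun q => RingHom.congr_fun (Subsingleton.elim (algebraMap ℚ (LaurentSeries k))
      (HahnSeries.C.comp (algebraMap ℚ k))) q
  change (HahnSeries.single _ _).coeff n = HahnSeries.C ((HahnSeries.single _ _).coeff n)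
  rw [h, HahnSeries.coeff_single, HahnSeries.coeff_single]
  split_ifs <;> simp

theorem ba_baseChange_C (W : PDO k) :
    ba (baseChange HahnSeries.C W) = mapCoeff inMu (ba W) := by
  have h : mapCoeff inMu (ba W) = MvPowerSeries.map inMuHom (symbol W * expXi) := rfl
  rw [h, map_mul, ba, expXi_laurent]
  rfl

end Main

end BKP

open BKP BKP.TimeSeries in
theorem mainTheorem7 {k : Type*} [CommRing k] [Algebra ℚ k] (L W : PDO k) (hLW : IsBKP L W) :
    -- S(ψ(t,μ), ψ(t,-λ)_x), up to terms independent of t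
    (∀ S : TimeSeries (LaurentSeries (LaurentSeries k)),
      IsSEP (lax₂ L) (mapCoeff inMu (ba W)) (dx (mapCoeff inLam (baNeg W))) S ↔
        ∃ c, S = (1 / 2 : ℚ) • ((mapCoeff inLam (baNeg W) - shift (-2) (baNeg W)) *
          mapCoeff inMu (ba W)) + const c) ∧
    -- S(Φ, ψ(t,-λ)_x), up to terms independent of t
    (∀ Φ : TimeSeries k, IsEigenfunction L Φ → ∀ S : TimeSeries (LaurentSeries k),
      IsSEP (lax₁ L) (indepOfLam Φ) (dx (baNeg W)) S ↔
        ∃ c, S = (1 / 2 : ℚ) • (baNeg W * (shift 2 Φ + indepOfLam Φ)) + const c) ∧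
    -- the normalized S(Φ, ψ(t,-λ)_x) is given exactly by the same formula
    (∀ Φ : TimeSeries k, IsEigenfunction L Φ → ∀ S : TimeSeries (LaurentSeries k),
      (IsSEP (lax₁ L) (indepOfLam Φ) (dx (baNeg W)) S ∧ IsNormalized Φ S) ↔
        S = (1 / 2 : ℚ) • (baNeg W * (shift 2 Φ + indepOfLam Φ))) ∧
    -- S(ψ(t,λ), Φ_x), up to terms independent of t
    (∀ Φ : TimeSeries k, IsEigenfunction L Φ → ∀ S : TimeSeries (LaurentSeries k),
      IsSEP (lax₁ L) (ba W) (dx (indepOfLam Φ)) S ↔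
        ∃ c, S = (1 / 2 : ℚ) • (ba W * (indepOfLam Φ - shift (-2) Φ)) + const c) ∧
    -- the normalized S(Φ(t'), ψ(t',-λ)_{x'}) is a spectral density of Φ
    (∀ Φ : TimeSeries k, IsEigenfunction L Φ → ∀ φ : TimeSeries (LaurentSeries k),
      IsSEP (lax₁ L) (indepOfLam Φ) (dx (baNeg W)) φ → IsNormalized Φ φ →
        IsSpectralDensity W Φ φ) ∧
    -- S(Φ₁, Φ₂_x) as a double integral, up to terms independent of t
    (∀ Φ₁ Φ₂ : TimeSeries k, IsEigenfunction L Φ₁ → IsEigenfunction L Φ₂ →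
      ∀ φ₁ φ₂ : TimeSeries (LaurentSeries k),
        IsSpectralDensity W Φ₁ φ₁ → IsSpectralDensity W Φ₂ φ₂ →
      ∀ T : TimeSeries (LaurentSeries (LaurentSeries k)),
        IsSEP (lax₂ L) (mapCoeff inMu (ba W)) (dx (mapCoeff inLam (ba W))) T →
      ∀ S : TimeSeries (TimeSeries k),
        IsSEP (L.baseChange MvPowerSeries.C) (indepOfPrime Φ₁) (dx (indepOfPrime Φ₂)) S ↔
          ∃ c, S = doubleSpectralIntegral φ₁ φ₂ T + const c) := by
  have hsep := fun {Φ : TimeSeries k} (hΦ : IsEigenfunction L Φ) =>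
    hLW.isSEP_negLam_potential hΦ
  have hunique : ∀ Φ : TimeSeries k, IsEigenfunction L Φ → ∀ S,
      IsSEP (lax₁ L) (indepOfLam Φ) (dx (baNeg W)) S → IsNormalized Φ S →
        S = negLam (wave (potential W Φ)) := by
    intro Φ hΦ S hS hN
    obtain ⟨c, hc⟩ := (isSEP_iff_exists_const (hsep hΦ) S).1 hS
    rw [hc, hN.const_eq_zero (hLW.isNormalized_potential Φ) hc, const, map_zero, add_zero]
  refine ⟨fun S => ?_, fun Φ hΦ S => ?_, fun Φ hΦ S => ⟨fun hS => ?_, ?_⟩, fun Φ hΦ S => ?_,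
    fun Φ hΦ φ hS hN => ?_, fun Φ₁ Φ₂ _ _ φ₁ φ₂ h₁ h₂ T hT S => ?_⟩
  · refine isSEP_iff_exists_const ?_ S
    -- The formula for S(ψ, Φ_x) over the ring k((λ⁻¹)), with spectral parameter μ and the
    -- eigenfunction ψ(t,-λ) in the role of Φ.
    have h := hLW.lax₁.isSEP_half_smul hLW.isEigenfunction_baNeg
    rwa [ba_baseChange_C, mul_comm] at h
  · rw [← hLW.negLam_wave_potential hΦ]
    exact isSEP_iff_exists_const (hsep hΦ) S
  · rw [← hLW.negLam_wave_potential hΦ]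
    exact hunique Φ hΦ S hS.1 hS.2
  · rintro rfl
    rw [← hLW.negLam_wave_potential hΦ]
    exact ⟨hsep hΦ, hLW.isNormalized_potential Φ⟩
  · exact isSEP_iff_exists_const (hLW.isSEP_half_smul hΦ) S
  · rw [hunique Φ hΦ φ hS hN]
    have h := hLW.isSpectralDensity (hLW.orth_dt_potential hΦ)
    rwa [hLW.ct_ba_mul_negLam_wave (hLW.ordLE_potential Φ), hLW.coeff_zero_potential] at h
  · exact isSEP_iff_exists_const (hT.doubleSpectralIntegral h₁ h₂) S
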